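/- Let $k$ be a field with $\operatorname{char} k\neq 2$. Write $\Delta(h)=h_{(1)}\otimes h_{(2)}$ (Sweedler notation) for comultiplications, $\varepsilon$ for counits and $S$ for antipodes. **Notation.** $H_4$ is Sweedler's Hopf algebra: it has $k$-basis $\{1,g,x,gx\}$, with $g^2=1$, $x^2=0$, $xg=-gx$, where $g$ is group-like and $\Delta(x)=x\otimes 1+g\otimes x$. $k[C_2]$ is the group Hopf algebra of the cyclic group $C_2$ of order $2$, with generator $c$. Let $A$, $H$ be Hopf algebras over $k$, with $H$ cocommutative. A *crossed system* $(A,H,\triangleright,f)$ consists of coalgebra maps $\triangleright:H\otimes A\to A$ and $f:H\otimes H\to A$ such that, for all $a,b\in A$ and $g,h,l\in H$: $$1\triangleright a=a,\quad h\triangleright 1=\varepsilon(h)1,\quad h\triangleright(ab)=(h_{(1)}\triangleright a)(h_{(2)}\triangleright b),\quad f(h,1)=f(1,h)=\varepsilon(h)1,$$ $$\big(g_{(1)}\triangleright(h_{(1)}\triangleright a)\big)f(g_{(2)},h_{(2)})=f(g_{(1)},h_{(1)})\big((g_{(2)}h_{(2)})\triangleright a\big),$$ $$\big(g_{(1)}\triangleright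 f(h_{(1)},l_{(1)})\big)f(g_{(2)},h_{(2)}l_{(2)})=f(g_{(1)},h_{(1)})f(g_{(2)}h_{(2)},l),$$ $$g_{(1)}\otimes(g_{(2)}\triangleright a)=g_{(2)}\otimes(g_{(1)}\triangleright a),\qquad g_{(1)}h_{(1)}\otimes f(g_{(2)},h_{(2)})=g_{(2)}h_{(2)}\otimes f(g_{(1)},h_{(1)}).$$ Its *crossed product* $A\#_f^{\triangleright}H$ is the Hopf algebra with underlying coalgebra $A\otimes H$, unit $1\#1$ and multiplication $$(a\#g)(b\#h)=a\,(g_{(1)}\triangleright b)\,f(g_{(2)},h_{(1)})\,\#\,g_{(3)}h_{(2)}.$$ It is an extension $A\to A\#_f^{\triangleright}H\to H$ by the maps $a\mapsto a\#1$ and $a\#h\mapsto\varepsilon(a)h$. Two extensions $A\xrightarrow{i}E\xrightarrow{\pi}H$ and $A\xrightarrow{i'}E'\xrightarrow{\pi'}H$ are *equivalent* if there is an isomorphism of Hopf algebras $\psi:E\to E'$ with $\psi i=i'$ and $\pi'\psi=\pi$. Two crossed systems $(\triangleright,f)$ and $(\triangleright',f')$ are *cohomologous* if there is a coalgebra map $r:H\to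 A$ with $r(1)=1$ and $r(h_{(1)})\otimes h_{(2)}=r(h_{(2)})\otimes h_{(1)}$ such that $$h\triangleright'a=r(h_{(1)})(h_{(2)}\triangleright a)S(r(h_{(3)})),\qquad f'(h,g)=r(h_{(1)})\big(h_{(2)}\triangleright r(g_{(1)})\big)f(h_{(3)},g_{(2)})S\big(r(h_{(4)}g_{(3)})\big).$$ This is an equivalence relation; $\mathcal H^2(H,A)$ is the set of classes of crossed systems, and $\mathrm{Crp}(H,A)$ is the set of Hopf algebra isomorphism classes of all crossed products $A\#_f^{\triangleright}H$. For $\zeta\in k$ with $\zeta^2=-1$, let $H_{8,\zeta}$ be the $8$-dimensional Hopf algebra with $k$-basis $\{1,g,x,gx,d,gd,xd,gxd\}$ and relations $$g^2=1,\quad x^2=0,\quad d^2=g,\quad xg=-gx,\quad dg=gd,\quad dx=\zeta\,xd,$$ where $g,d$ are group-like and $\Delta(x)=x\otimes1+g\otimes x$. We regard it as an extension of $H_4$ by $k[C_2]$ by the Hopf algebra maps $H_4\to H_{8,\zeta}$, $g\mapsto g$, $x\mapsto x$, and $H_{8,\zeta}\to k[C_2]$, $d\mapsto c$, $x\mapsto0$.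 We regard $H_4\otimes k[C_2]$ as such an extension by $a\mapsto a\otimes1$ and $a\otimes h\mapsto\varepsilon(a)h$. **Statement.** Two crossed systems $(H_4,k[C_2],\triangleright,f)$ and $(H_4,k[C_2],\triangleright',f')$ are cohomologous if and only if their crossed products are isomorphic Hopf algebras, so that $\mathcal H^2(k[C_2],H_4)\cong\mathrm{Crp}(k[C_2],H_4)$ canonically. Moreover: 1. If $-1$ is not a square in $k$, then $\mathcal H^2(k[C_2],H_4)$ has exactly one element, the class of a crossed system whose crossed product extension is equivalent to $H_4\otimes k[C_2]$, and $\mathrm{Crp}(k[C_2],H_4)=\{H_4\otimes k[C_2]\}$. 2. If $\zeta\in k$ and $\zeta^2=-1$, then $\mathcal H^2(k[C_2],H_4)$ has exactly two elements, the class of a crossed system whose crossed product extension is equivalent to $H_4\otimes k[C_2]$ and the class of a crossed system whose crossed product extension is equivalent to $H_{8,\zeta}$. The Hopf algebras $H_4\otimes k[C_2]$ and $H_{8,\zeta}$ are not isomorphic, and $\mathrm{Crp}(k[C_2],H_4)=\{H_4\otimes k[C_2],\,H_{8,\zeta}\}$. -/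

import Mathlib

open scoped TensorProduct

universe u

noncomputable section

open Coalgebra WithConv

section Aux

variable {k : Type*} [Field k]

/-- For a linear map `φ : C → M`, the linear map `C ⊗ D → M`, `c ⊗ d ↦ ε(d) φ(c)`. -/
def tensorCounit {C M : Type*} (D : Type*) [AddCommGroup C] [Module k C] [AddCommGroup M]
    [Module k M] [AddCommGroup D] [Module k D] [CoalgebraStruct k D] :
    (C →ₗ[k] M) →ₗ[k] (C ⊗[k] D →ₗ[k] M) where
  toFun φ := (TensorProduct.rid k M).toLinearMap ∘ₗ TensorProduct.map φ (counit (R := k) (A := D))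
  map_add' _ _ := by ext; simp
  map_smul' _ _ := by ext; simp [smul_comm (counit (R := k) (A := D) _)]

@[simp] lemma tensorCounit_tmul {C D M : Type*} [AddCommGroup C] [Module k C] [AddCommGroup M]
    [Module k M] [AddCommGroup D] [Module k D] [CoalgebraStruct k D] (φ : C →ₗ[k] M) (c : C)
    (d : D) : tensorCounit D φ (c ⊗ₜ[k] d) = counit (R := k) d • φ c := by
  simp [tensorCounit]

/-- A representation of `Δ(a ⊗ b)` obtained from representations of `Δ(a)` and of `Δ(b)`. -/
def Coalgebra.Repr.tmul' {C D ι κ : Type*} [AddCommGroup C] [Module k C] [Coalgebra k C]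
    [AddCommGroup D] [Module k D] [Coalgebra k D] {a : C} {b : D}
    (ra : Repr k a ι) (rb : Repr k b κ) :
    Repr k (a ⊗ₜ[k] b) (ι × κ) where
  index := ra.index ×ˢ rb.index
  left i := ra.left i.1 ⊗ₜ rb.left i.2
  right i := ra.right i.1 ⊗ₜ rb.right i.2
  eq := by
    simp [← ra.eq, ← rb.eq, TensorProduct.sum_tmul ra.index, TensorProduct.tmul_sum,
      ← Finset.sum_product']

lemma convMul_tmul {C D M : Type*} [AddCommGroup C] [Module k C] [Coalgebra k C]
    [AddCommGroup D] [Module k D] [Coalgebra k D] [Ring M] [Algebra k M]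
    (u v : WithConv (C ⊗[k] D →ₗ[k] M)) {ι κ : Type*} {c : C} {d : D} (rc : Repr k c ι)
    (rd : Repr k d κ) : (u * v) (c ⊗ₜ d) = ∑ i ∈ rc.index, ∑ j ∈ rd.index,
      u (rc.left i ⊗ₜ rd.left j) * v (rc.right i ⊗ₜ rd.right j) := by
  rw [(rc.tmul' rd).convMul_apply, ← Finset.sum_product']
  rfl

lemma tensorCounit_convMul {C D M : Type*} [AddCommGroup C] [Module k C] [Coalgebra k C]
    [AddCommGroup D] [Module k D] [Coalgebra k D] [Ring M] [Algebra k M]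
    (u v : WithConv (C →ₗ[k] M)) : toConv (tensorCounit D (u * v).ofConv) =
      toConv (tensorCounit D u.ofConv) * toConv (tensorCounit D v.ofConv) := by
  ext c d
  have := congr(counit (R := k) $(sum_counit_smul (ℛ k d)))
  simp only [map_sum, map_smul, smul_eq_mul] at this
  simp only [TensorProduct.AlgebraTensorModule.curry_apply, LinearMap.restrictScalars_self,
    TensorProduct.curry_apply, convMul_tmul _ _ (ℛ k c) (ℛ k d), tensorCounit_tmul,
    (ℛ k c).convMul_apply, smul_mul_smul_comm, ← Finset.sum_smul, this, Finset.smul_sum]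

lemma algHom_convMul {C M N : Type*} [AddCommGroup C] [Module k C] [Coalgebra k C]
    [Ring M] [Algebra k M] [Ring N] [Algebra k N] (φ : M →ₐ[k] N) (u v : WithConv (C →ₗ[k] M)) :
    toConv (φ.toLinearMap ∘ₗ (u * v).ofConv) =
      toConv (φ.toLinearMap ∘ₗ u.ofConv) * toConv (φ.toLinearMap ∘ₗ v.ofConv) :=
  congrArg toConv (LinearMap.algHom_comp_convMul_distrib φ u v)

lemma convMul_coalgHom {C D M : Type*} [AddCommGroup C] [Module k C] [Coalgebra k C]
    [AddCommGroup D] [Module k D] [Coalgebra k D] [Ring M] [Algebra k M]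
    (u v : WithConv (C →ₗ[k] M)) (φ : D →ₗc[k] C) :
    toConv ((u * v).ofConv ∘ₗ φ.toLinearMap) =
      toConv (u.ofConv ∘ₗ φ.toLinearMap) * toConv (v.ofConv ∘ₗ φ.toLinearMap) :=
  congrArg toConv (LinearMap.convMul_comp_coalgHom_distrib u v φ)

end Aux

variable (k A H : Type u) [Field k] [Ring A] [Ring H] [HopfAlgebra k A] [HopfAlgebra k H] in
/-- A crossed system `(A, H, ▷, f)` of Hopf algebras over the field `k`: coalgebra maps
`act : H ⊗ A → A`, written `h ▷ a`, and `cocycle : H ⊗ H → A`, written `f(g, h)`, subject to the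
normalization conditions and the compatibilities below.

Identities between maps out of a coalgebra `C` are written in the convolution algebra
`WithConv (C →ₗ[k] A)`, whose product is `(u * v)(c) = u(c₁) v(c₂)`. The coalgebra structures on
`H ⊗ H` and on `(H ⊗ H) ⊗ H` are the tensor product ones. The linear map
`(TensorProduct.curry act.toLinearMap).flip a : H → A` is `h ↦ h ▷ a`. -/
structure CrossedSystem where
  /-- The weak action `h ⊗ a ↦ h ▷ a`, a map of coalgebras. -/
  act : H ⊗[k] A →ₗc[k] A
  /-- The cocycle `g ⊗ h ↦ f(g, h)`, a map of coalgebras. -/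
  cocycle : H ⊗[k] H →ₗc[k] A
  /-- `1 ▷ a = a` -/
  one_act : ∀ a : A, act (1 ⊗ₜ a) = a
  /-- `h ▷ 1 = ε(h) 1` -/
  act_one : ∀ h : H, act (h ⊗ₜ 1) = algebraMap k A (counit h)
  /-- `h ▷ (a b) = (h₁ ▷ a) (h₂ ▷ b)` -/
  act_mul : ∀ a b : A,
    toConv ((TensorProduct.curry act.toLinearMap).flip (a * b)) =
      toConv ((TensorProduct.curry act.toLinearMap).flip a) *
        toConv ((TensorProduct.curry act.toLinearMap).flip b)
  /-- `f(h, 1) = ε(h) 1` -/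
  cocycle_one : ∀ h : H, cocycle (h ⊗ₜ 1) = algebraMap k A (counit h)
  /-- `f(1, h) = ε(h) 1` -/
  one_cocycle : ∀ h : H, cocycle (1 ⊗ₜ h) = algebraMap k A (counit h)
  /-- `(g₁ ▷ (h₁ ▷ a)) f(g₂, h₂) = f(g₁, h₁) ((g₂ h₂) ▷ a)` -/
  twisted : ∀ a : A,
    toConv (act.toLinearMap ∘ₗ
        ((TensorProduct.curry act.toLinearMap).flip a).lTensor H) * toConv cocycle.toLinearMap =
      toConv cocycle.toLinearMap *
        toConv ((TensorProduct.curry act.toLinearMap).flip a ∘ₗ LinearMap.mul' k H)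
  /-- `(g₁ ▷ f(h₁, l₁)) f(g₂, h₂ l₂) = f(g₁, h₁) f(g₂ h₂, l)` -/
  cocycle_cond :
    toConv (act.toLinearMap ∘ₗ cocycle.toLinearMap.lTensor H ∘ₗ
        (TensorProduct.assoc k H H H).toLinearMap) *
      toConv (cocycle.toLinearMap ∘ₗ (LinearMap.mul' k H).lTensor H ∘ₗ
        (TensorProduct.assoc k H H H).toLinearMap) =
    toConv (tensorCounit H cocycle.toLinearMap) *
      toConv (cocycle.toLinearMap ∘ₗ (LinearMap.mul' k H).rTensor H)
  /-- `g₁ ⊗ (g₂ ▷ a) = g₂ ⊗ (g₁ ▷ a)` -/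
  act_comm : ∀ (g : H) (a : A),
    ((TensorProduct.curry act.toLinearMap).flip a).lTensor H (comul (R := k) g) =
      ((TensorProduct.curry act.toLinearMap).flip a).lTensor H
        (TensorProduct.comm k H H (comul g))
  /-- `g₁ h₁ ⊗ f(g₂, h₂) = g₂ h₂ ⊗ f(g₁, h₁)` -/
  cocycle_comm : ∀ y : H ⊗[k] H,
    TensorProduct.map (LinearMap.mul' k H) cocycle.toLinearMap (comul (R := k) y) =
      TensorProduct.map (LinearMap.mul' k H) cocycle.toLinearMap
        (TensorProduct.comm k (H ⊗[k] H) (H ⊗[k] H) (comul y))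

namespace CrossedSystem

variable {k A H : Type u} [Field k] [Ring A] [Ring H] [HopfAlgebra k A] [HopfAlgebra k H]

/-- `s.actOn a : H → A` is the linear map `h ↦ h ▷ a`. -/
def actOn (s : CrossedSystem k A H) : A →ₗ[k] H →ₗ[k] A :=
  (TensorProduct.curry s.act.toLinearMap).flip

@[simp] lemma actOn_apply (s : CrossedSystem k A H) (a : A) (h : H) :
    s.actOn a h = s.act (h ⊗ₜ a) := rfl

variable (k A H) in
/-- `a ↦ a ⊗ 1`, into the tensor product algebra. -/
abbrev inl : A →ₐ[k] A ⊗[k] H := Algebra.TensorProduct.includeLeft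
variable (k A H) in
/-- `h ↦ 1 ⊗ h`, into the tensor product algebra. -/
abbrev inr : H →ₐ[k] A ⊗[k] H := Algebra.TensorProduct.includeRight

/-- `g ⊗ h ↦ f(g₁, h₁) ⊗ g₂ h₂`. -/
def Q (s : CrossedSystem k A H) : WithConv (H ⊗[k] H →ₗ[k] A ⊗[k] H) :=
    toConv ((inl k A H).toLinearMap ∘ₗ s.cocycle.toLinearMap) *
    toConv ((inr k A H).toLinearMap ∘ₗ LinearMap.mul' k H)

/-- For `b` in `A`, the map `g ⊗ h ↦ (g₁ ▷ b) f(g₂, h₁) ⊗ g₃ h₂`. -/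
def Phi (s : CrossedSystem k A H) : A →ₗ[k] H ⊗[k] H →ₗ[k] A ⊗[k] H where
  toFun b := (toConv ((inl k A H).toLinearMap ∘ₗ tensorCounit H (s.actOn b)) * s.Q).ofConv
  map_add' a b := by
    simp only [map_add, LinearMap.comp_add, toConv_add, add_mul, ofConv_add]
  map_smul' c b := by
    simp only [map_smul, LinearMap.comp_smul, toConv_smul, smul_mul_assoc, ofConv_smul,
      RingHom.id_apply]

lemma Phi_apply (s : CrossedSystem k A H) (b : A) : s.Phi b =
  (toConv ((inl k A H).toLinearMap ∘ₗ tensorCounit H (s.actOn b)) * s.Q).ofConv := rfl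

/-- Left multiplication by `1 # g`: the map `b ⊗ h ↦ (g₁ ▷ b) f(g₂, h₁) ⊗ g₃ h₂`. -/
def J (s : CrossedSystem k A H) : H →ₗ[k] A ⊗[k] H →ₗ[k] A ⊗[k] H :=
  (TensorProduct.uncurry (.id k) A H (A ⊗[k] H)) ∘ₗ
    (LinearMap.flip ((TensorProduct.lcurry (.id k) H H (A ⊗[k] H)) ∘ₗ s.Phi))

@[simp] lemma J_tmul (s : CrossedSystem k A H) (g h : H) (b : A) :
    s.J g (b ⊗ₜ h) = s.Phi b (g ⊗ₜ h) := rfl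

/-- The multiplication `(a # g) (b # h) = a (g₁ ▷ b) f(g₂, h₁) # g₃ h₂`. -/
def mulMap (s : CrossedSystem k A H) : A ⊗[k] H →ₗ[k] A ⊗[k] H →ₗ[k] A ⊗[k] H :=
  TensorProduct.lift (LinearMap.mk₂ k (fun a g => LinearMap.mulLeft k (inl k A H a) ∘ₗ s.J g)
    (by intros; ext; simp [add_mul, TensorProduct.add_tmul])
    (by intros; ext; simp)
    (by intros; ext; simp [mul_add])
    (by intros; ext; simp))

@[simp] lemma mulMap_tmul (s : CrossedSystem k A H) (a b : A) (g h : H) :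
    s.mulMap (a ⊗ₜ g) (b ⊗ₜ h) = (a ⊗ₜ 1) * s.Phi b (g ⊗ₜ h) := rfl

lemma act_mul_comp (s : CrossedSystem k A H) {C : Type*} [AddCommGroup C] [Module k C]
    [Coalgebra k C] (u v : WithConv (C →ₗ[k] A)) :
    toConv (s.act.toLinearMap ∘ₗ (u * v).ofConv.lTensor H) =
      toConv (s.act.toLinearMap ∘ₗ u.ofConv.lTensor H) *
      toConv (s.act.toLinearMap ∘ₗ v.ofConv.lTensor H) := by
  ext g y
  have h1 := fun a b => congr($(s.act_mul a b) g)
  simp only [(ℛ k g).convMul_apply] at h1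
  simp at h1
  simp [-LinearMap.convMul_apply, convMul_tmul _ _ (ℛ k g) (ℛ k y), (ℛ k y).convMul_apply,
    TensorProduct.tmul_sum, h1]
  rw [Finset.sum_comm]

lemma Phi_tmul (s : CrossedSystem k A H) (b : A) (g h : H) {ι : Type*} (r : Repr k g ι) :
    s.Phi b (g ⊗ₜ h) = ∑ i ∈ r.index, (s.act (r.left i ⊗ₜ b)) ⊗ₜ 1 * s.Q (r.right i ⊗ₜ h) := by
  rw [Phi_apply, convMul_tmul _ _ r (ℛ k h)]
  refine Finset.sum_congr rfl fun i _ => ?_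
  conv_rhs => rw [← sum_counit_smul (ℛ k h)]
  simp [TensorProduct.tmul_sum, Finset.mul_sum]

variable (s : CrossedSystem k A H)

lemma J_apply {C : Type*} [AddCommGroup C] [Module k C]
    [Coalgebra k C] (u : WithConv (C →ₗ[k] A)) (v : C →ₗc[k] H) (g : H) (y : C) :
    s.J g ((toConv ((inl k A H).toLinearMap ∘ₗ u.ofConv) *
      toConv ((inr k A H).toLinearMap ∘ₗ v.toLinearMap)) y) =
    (toConv ((inl k A H).toLinearMap ∘ₗ s.act.toLinearMap ∘ₗ u.ofConv.lTensor H) *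
      toConv (s.Q.ofConv ∘ₗ v.toLinearMap.lTensor H)) (g ⊗ₜ y) := by
  simp [-LinearMap.convMul_apply, convMul_tmul _ _ (ℛ k g) (ℛ k y), (ℛ k y).convMul_apply,
    s.Phi_tmul _ _ _ (ℛ k g)]
  rw [Finset.sum_comm]

lemma mulMap_apply {C : Type*} [AddCommGroup C] [Module k C]
    [Coalgebra k C] (u : WithConv (C →ₗ[k] A)) (v : C →ₗ[k] H) (c : A) (l : H) (y : C) :
    s.mulMap ((toConv ((inl k A H).toLinearMap ∘ₗ u.ofConv) *
      toConv ((inr k A H).toLinearMap ∘ₗ v)) y) (c ⊗ₜ l) =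
    (toConv ((inl k A H).toLinearMap ∘ₗ tensorCounit H u.ofConv) *
      toConv (s.Phi c ∘ₗ v.rTensor H)) (y ⊗ₜ l) := by
  simp [-LinearMap.convMul_apply, convMul_tmul _ _ (ℛ k y) (ℛ k l), (ℛ k y).convMul_apply]
  refine Finset.sum_congr rfl fun i _ => ?_
  conv_lhs => rw [← sum_counit_smul (ℛ k l)]
  simp [TensorProduct.tmul_sum, Finset.mul_sum]

lemma mulMap_mul_left (a : A) (p q : A ⊗[k] H) :
    s.mulMap (a ⊗ₜ 1 * p) q = a ⊗ₜ 1 * s.mulMap p q := by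
  induction p with
  | zero => simp
  | add p p' h h' => simp [mul_add, h, h']
  | tmul b g =>
    induction q with
    | zero => simp
    | add p p' h h' => simp only [map_add, mul_add, h, h']
    | tmul c h => simp [← mul_assoc]

lemma Q_one_left (h : H) : s.Q ((1 : H) ⊗ₜ[k] h) = 1 ⊗ₜ h := by
  have r : Repr k (1 : H) Unit := ⟨Finset.univ, fun _ => 1, fun _ => 1, by simp; rfl⟩
  have e : comul (R := k) ((1 : H)) = 1 ⊗ₜ 1 := by simp; rfl
  rw [Q, convMul_tmul _ _ (⟨Finset.univ, fun _ => 1, fun _ => 1, by simp [e]⟩ : Repr k (1 : H) Unit)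
    (ℛ k h)]
  simp only [Finset.univ_unique, Finset.sum_singleton]
  simp only [LinearMap.coe_comp, Function.comp_apply]
  conv_rhs => rw [← sum_counit_smul (ℛ k h)]
  simp [s.one_cocycle, TensorProduct.tmul_sum, Algebra.algebraMap_eq_smul_one]

lemma Q_one_right (h : H) : s.Q (h ⊗ₜ[k] (1 : H)) = 1 ⊗ₜ h := by
  have e : comul (R := k) ((1 : H)) = 1 ⊗ₜ 1 := by simp; rfl
  rw [Q, convMul_tmul _ _ (ℛ k h)
    (⟨Finset.univ, fun _ => 1, fun _ => 1, by simp [e]⟩ : Repr k (1 : H) Unit)]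
  conv_rhs => rw [← sum_counit_smul (ℛ k h)]
  simp [s.cocycle_one, TensorProduct.tmul_sum, Algebra.algebraMap_eq_smul_one]

lemma one_mulMap (x : A ⊗[k] H) : s.mulMap (1 ⊗ₜ 1) x = x := by
  have e : comul (R := k) ((1 : H)) = 1 ⊗ₜ 1 := by simp; rfl
  induction x with
  | zero => simp
  | add p p' h h' => simp [h, h']
  | tmul b h =>
    rw [mulMap_tmul, s.Phi_tmul _ _ _ (⟨Finset.univ, fun _ => 1, fun _ => 1, by simp [e]⟩ :
      Repr k (1 : H) Unit)]
    simp [s.one_act, Q_one_left]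

lemma mulMap_one (x : A ⊗[k] H) : s.mulMap x (1 ⊗ₜ 1) = x := by
  induction x with
  | zero => simp
  | add p p' h h' => simp [h, h']
  | tmul b h =>
    rw [mulMap_tmul, s.Phi_tmul _ _ _ (ℛ k h)]
    conv_rhs => rw [← sum_counit_smul (ℛ k h)]
    simp [s.act_one, Q_one_right, TensorProduct.tmul_sum, Algebra.algebraMap_eq_smul_one,
      TensorProduct.smul_tmul, Finset.mul_sum]

lemma Phi_eq (b : A) : toConv (s.Phi b) =
    toConv ((inl k A H).toLinearMap ∘ₗ (toConv (tensorCounit H (s.actOn b)) *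
      toConv s.cocycle.toLinearMap).ofConv) *
    toConv ((inr k A H).toLinearMap ∘ₗ LinearMap.mul' k H) := by
  rw [Phi_apply, Q, algHom_convMul, toConv_ofConv, mul_assoc]

/-- `(g ⊗ h) ⊗ l ↦ g h ⊗ l` as a map of coalgebras. -/
abbrev m3 (k H : Type u) [Field k] [Ring H] [HopfAlgebra k H] :
    (H ⊗[k] H) ⊗[k] H →ₗc[k] H ⊗[k] H :=
  Coalgebra.TensorProduct.map (Bialgebra.mulCoalgHom k H) (CoalgHom.id k H)

/-- The left tensor factor of the product of `1 # g`, `b # h` and `c # l`. -/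
def tripleA (b c : A) : WithConv ((H ⊗[k] H) ⊗[k] H →ₗ[k] A) :=
  toConv (tensorCounit H (tensorCounit H (s.actOn b))) *
    (toConv (tensorCounit H (s.act.toLinearMap ∘ₗ (s.actOn c).lTensor H)) *
    (toConv (tensorCounit H s.cocycle.toLinearMap) *
    toConv (s.cocycle.toLinearMap ∘ₗ (LinearMap.mul' k H).rTensor H)))

lemma tripleA_eq (b c : A) : s.tripleA b c =
    toConv (tensorCounit H (toConv (tensorCounit H (s.actOn b)) *
      toConv s.cocycle.toLinearMap).ofConv) *
    (toConv (tensorCounit H (s.actOn c ∘ₗ LinearMap.mul' k H)) *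
      toConv (s.cocycle.toLinearMap ∘ₗ (LinearMap.mul' k H).rTensor H)) := by
  have hβ : toConv (tensorCounit H (s.act.toLinearMap ∘ₗ (s.actOn c).lTensor H)) *
      toConv (tensorCounit H s.cocycle.toLinearMap) = toConv (tensorCounit H s.cocycle.toLinearMap) *
      toConv (tensorCounit H (s.actOn c ∘ₗ LinearMap.mul' k H)) := by
    have h1 := tensorCounit_convMul (D := H)
      (toConv (s.act.toLinearMap ∘ₗ (s.actOn c).lTensor H)) (toConv s.cocycle.toLinearMap)
    have h2 := tensorCounit_convMul (D := H)
      (toConv s.cocycle.toLinearMap) (toConv (s.actOn c ∘ₗ LinearMap.mul' k H))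
    have h3 : toConv (s.act.toLinearMap ∘ₗ (s.actOn c).lTensor H) * toConv s.cocycle.toLinearMap =
      toConv s.cocycle.toLinearMap * toConv (s.actOn c ∘ₗ LinearMap.mul' k H) := s.twisted c
    dsimp only at h1 h2
    rw [← h1, ← h2, h3]
  rw [tripleA, tensorCounit_convMul, ← mul_assoc (toConv (tensorCounit H (s.act.toLinearMap ∘ₗ _))),
    hβ]
  simp only [mul_assoc]

lemma Phi_mul (c : A) : toConv (s.Phi c ∘ₗ (LinearMap.mul' k H).rTensor H) =
    toConv ((inl k A H).toLinearMap ∘ₗ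
      (toConv (tensorCounit H (s.actOn c ∘ₗ LinearMap.mul' k H)) *
      toConv (s.cocycle.toLinearMap ∘ₗ (LinearMap.mul' k H).rTensor H)).ofConv) *
    toConv ((inr k A H).toLinearMap ∘ₗ LinearMap.mul' k H ∘ₗ (LinearMap.mul' k H).rTensor H) := by
  have e2 := convMul_coalgHom (toConv ((inl k A H).toLinearMap ∘ₗ
    (toConv (tensorCounit H (s.actOn c)) * toConv s.cocycle.toLinearMap).ofConv))
    (toConv ((inr k A H).toLinearMap ∘ₗ LinearMap.mul' k H)) (m3 k H)
  rw [← Phi_eq] at e2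
  have e3 := convMul_coalgHom
    (toConv (tensorCounit H (s.actOn c))) (toConv s.cocycle.toLinearMap) (m3 k H)
  have e4 : tensorCounit H (s.actOn c) ∘ₗ (m3 k H).toLinearMap =
      tensorCounit H (s.actOn c ∘ₗ LinearMap.mul' k H) := by
    ext; simp
  rw [ofConv_toConv, e4] at e3
  refine e2.trans ?_
  congr 1
  exact congrArg (fun w => toConv ((inl k A H).toLinearMap ∘ₗ w.ofConv)) e3

lemma mulMap_mulMap_left (b c : A) (g h l : H) :
    s.mulMap (s.Phi b (g ⊗ₜ h)) (c ⊗ₜ l) =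
      (toConv ((inl k A H).toLinearMap ∘ₗ (s.tripleA b c).ofConv) *
      toConv ((inr k A H).toLinearMap ∘ₗ LinearMap.mul' k H ∘ₗ (LinearMap.mul' k H).rTensor H))
        ((g ⊗ₜ h) ⊗ₜ l) := by
  have e1 := s.mulMap_apply (toConv (tensorCounit H (s.actOn b)) *
    toConv s.cocycle.toLinearMap) (LinearMap.mul' k H) c l (g ⊗ₜ h)
  rw [← Phi_eq] at e1
  refine e1.trans ?_
  have e2 := algHom_convMul (inl k A H) (toConv (tensorCounit H
    (toConv (tensorCounit H (s.actOn b)) * toConv s.cocycle.toLinearMap).ofConv))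
    (toConv (tensorCounit H (s.actOn c ∘ₗ LinearMap.mul' k H)) *
      toConv (s.cocycle.toLinearMap ∘ₗ (LinearMap.mul' k H).rTensor H))
  rw [Phi_mul, ← mul_assoc, tripleA_eq, e2]

lemma mulMap_eq (b c : A) (h l : H) : s.mulMap (b ⊗ₜ h) (c ⊗ₜ l) =
    (toConv ((inl k A H).toLinearMap ∘ₗ (toConv ((counit (R := k)).smulRight b) *
      (toConv (tensorCounit H (s.actOn c)) * toConv s.cocycle.toLinearMap)).ofConv) *
    toConv ((inr k A H).toLinearMap ∘ₗ (Bialgebra.mulCoalgHom k H).toLinearMap)) (h ⊗ₜ l) := by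
  have : toConv ((inl k A H).toLinearMap ∘ₗ (toConv ((counit (R := k)).smulRight b) *
      (toConv (tensorCounit H (s.actOn c)) * toConv s.cocycle.toLinearMap)).ofConv) *
    toConv ((inr k A H).toLinearMap ∘ₗ (Bialgebra.mulCoalgHom k H).toLinearMap) =
      toConv ((inl k A H).toLinearMap ∘ₗ (counit (R := k)).smulRight b) * toConv (s.Phi c) := by
    rw [Phi_eq, algHom_convMul, ← mul_assoc]
    rfl
  rw [this, (ℛ k (h ⊗ₜ[k] l)).convMul_apply, mulMap_tmul]
  conv_lhs => rw [← sum_counit_smul (ℛ k (h ⊗ₜ[k] l))]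
  simp [Finset.mul_sum]

lemma tripleA_eq' (b c : A) : s.tripleA b c =
    toConv ((s.act.toLinearMap ∘ₗ (toConv ((counit (R := k)).smulRight b) *
      (toConv (tensorCounit H (s.actOn c)) * toConv s.cocycle.toLinearMap)).ofConv.lTensor H) ∘ₗ
        (TensorProduct.assoc k H H H).toLinearMap) *
    toConv (s.cocycle.toLinearMap ∘ₗ (LinearMap.mul' k H).lTensor H ∘ₗ
        (TensorProduct.assoc k H H H).toLinearMap) := by
  have e1 := s.act_mul_comp (C := H ⊗[k] H) (toConv ((counit (R := k)).smulRight b))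
      (toConv (tensorCounit H (s.actOn c)) * toConv s.cocycle.toLinearMap)
  have e0 := s.act_mul_comp (C := H ⊗[k] H) (toConv (tensorCounit H (s.actOn c)))
    (toConv s.cocycle.toLinearMap)
  rw [e0] at e1
  have e2 := congrArg (fun w => toConv (w.ofConv ∘ₗ
    (Coalgebra.TensorProduct.assoc k k H H H).toCoalgHom.toLinearMap)) e1
  dsimp only at e2
  rw [convMul_coalgHom, convMul_coalgHom] at e2
  refine .trans ?_ (congrArg (· * toConv (s.cocycle.toLinearMap ∘ₗ (LinearMap.mul' k H).lTensor H ∘ₗ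
        (TensorProduct.assoc k H H H).toLinearMap)) e2.symm)
  dsimp only
  rw [tripleA, ← s.cocycle_cond, mul_assoc, mul_assoc]
  congr 2
  · ext g h l
    simp [smul_smul, mul_comm]
  · congr 1
    ext g h l
    simp [TensorProduct.tmul_smul]

lemma mulMap_mulMap_right (b c : A) (g h l : H) :
    s.J g (s.mulMap (b ⊗ₜ h) (c ⊗ₜ l)) =
      (toConv ((inl k A H).toLinearMap ∘ₗ (s.tripleA b c).ofConv) *
      toConv ((inr k A H).toLinearMap ∘ₗ LinearMap.mul' k H ∘ₗ (LinearMap.mul' k H).rTensor H))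
        ((g ⊗ₜ h) ⊗ₜ l) := by
  rw [mulMap_eq, J_apply, tripleA_eq', algHom_convMul, mul_assoc]
  have e1 := convMul_coalgHom (toConv ((inl k A H).toLinearMap ∘ₗ s.cocycle.toLinearMap))
    (toConv ((inr k A H).toLinearMap ∘ₗ LinearMap.mul' k H))
    ((Coalgebra.TensorProduct.map (CoalgHom.id k H) (Bialgebra.mulCoalgHom k H)).comp
      (Coalgebra.TensorProduct.assoc k k H H H).toCoalgHom)
  have e3 : LinearMap.mul' k H ∘ₗ (LinearMap.mul' k H).rTensor H = LinearMap.mul' k H ∘ₗ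
      (LinearMap.mul' k H).lTensor H ∘ₗ (TensorProduct.assoc k H H H).toLinearMap := by
    ext; simp [mul_assoc]
  rw [e3]
  have e4 := convMul_coalgHom (toConv ((inl k A H).toLinearMap ∘ₗ s.act.toLinearMap ∘ₗ
      (toConv ((counit (R := k)).smulRight b) * (toConv (tensorCounit H (s.actOn c)) *
        toConv s.cocycle.toLinearMap)).ofConv.lTensor H))
      (toConv (s.Q.ofConv ∘ₗ (Bialgebra.mulCoalgHom k H).toLinearMap.lTensor H))
      (Coalgebra.TensorProduct.assoc k k H H H).toCoalgHom
  refine .trans (congrArg (fun w : WithConv ((H ⊗[k] H) ⊗[k] H →ₗ[k] A ⊗[k] H) => w.ofConv ((g ⊗ₜ h) ⊗ₜ l)) e4) ?_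
  refine congrArg (fun w : WithConv ((H ⊗[k] H) ⊗[k] H →ₗ[k] A ⊗[k] H) => w.ofConv ((g ⊗ₜ h) ⊗ₜ l)) ?_
  congr 1

lemma mulMap_assoc (x y z : A ⊗[k] H) :
    s.mulMap (s.mulMap x y) z = s.mulMap x (s.mulMap y z) := by
  induction x with
  | zero => simp
  | add p p' h h' => simp [h, h']
  | tmul a g =>
  induction y with
  | zero => simp
  | add p p' h h' => simp only [map_add, LinearMap.add_apply, h, h']
  | tmul b h =>
  induction z with
  | zero => simp
  | add p p' h h' => simp only [map_add, h, h']
  | tmul c l =>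
    rw [mulMap_tmul, mulMap_mul_left]
    change _ = a ⊗ₜ 1 * s.J g _
    rw [mulMap_mulMap_left, mulMap_mulMap_right]

end CrossedSystem

namespace CrossedSystem

variable {k A H : Type u} [Field k] [Ring A] [Ring H] [HopfAlgebra k A] [HopfAlgebra k H]

/-- The crossed product `A # H` of a crossed system: the tensor product coalgebra `A ⊗ H`, with the
multiplication `mulMap` and the unit `1 # 1`. -/
def Product (_s : CrossedSystem k A H) : Type u := A ⊗[k] H

namespace Product
variable (s : CrossedSystem k A H)

instance : AddCommGroup s.Product := inferInstanceAs (AddCommGroup (A ⊗[k] H))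
instance : Module k s.Product := inferInstanceAs (Module k (A ⊗[k] H))
instance : Coalgebra k s.Product := inferInstanceAs (Coalgebra k (A ⊗[k] H))

/-- The identification of coalgebras of `A ⊗ H` with the crossed product. -/
def of : A ⊗[k] H ≃ₗc[k] s.Product := CoalgEquiv.refl k (A ⊗[k] H)

instance : Ring s.Product where
  __ := (inferInstance : AddCommGroup s.Product)
  mul x y := of s (s.mulMap ((of s).symm x) ((of s).symm y))
  one := of s (1 ⊗ₜ 1)
  zero_mul x := (congrArg (fun w => w x) (map_zero s.mulMap) :)
  mul_zero x := (map_zero (s.mulMap x) :)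
  left_distrib x y z := (map_add (s.mulMap x) y z :)
  right_distrib x y z := (congrArg (fun w => w z) (map_add s.mulMap x y) :)
  mul_assoc x y z := s.mulMap_assoc x y z
  one_mul x := s.one_mulMap x
  mul_one x := s.mulMap_one x

lemma mul_def (x y : s.Product) : x * y = of s (s.mulMap ((of s).symm x) ((of s).symm y)) := rfl
lemma one_def : (1 : s.Product) = of s (1 ⊗ₜ 1) := rfl

instance : Algebra k s.Product := Algebra.ofModule
  (fun c x y => congrArg (fun w => w y) (map_smul s.mulMap c x))
  (fun c x y => map_smul (s.mulMap x) c y)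

end Product
end CrossedSystem

namespace CrossedSystem

variable {k A H : Type u} [Field k] [Ring A] [Ring H] [HopfAlgebra k A] [HopfAlgebra k H]

section
variable {C P : Type*} [AddCommGroup C] [Module k C] [Coalgebra k C] [Ring P] [Bialgebra k P]

/-- `u ↦ u(-) ⊗ 1`. -/
def I1 : (C →ₗ[k] P) →ₗ[k] WithConv (C →ₗ[k] P ⊗[k] P) where
  toFun u := toConv ((Algebra.TensorProduct.includeLeft : P →ₐ[k] P ⊗[k] P).toLinearMap ∘ₗ u)
  map_add' u v := by simp [LinearMap.comp_add]
  map_smul' c u := by simp [LinearMap.comp_smul]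
/-- `u ↦ 1 ⊗ u(-)`. -/
def I2 : (C →ₗ[k] P) →ₗ[k] WithConv (C →ₗ[k] P ⊗[k] P) where
  toFun u := toConv ((Algebra.TensorProduct.includeRight : P →ₐ[k] P ⊗[k] P).toLinearMap ∘ₗ u)
  map_add' u v := by simp [LinearMap.comp_add]
  map_smul' c u := by simp [LinearMap.comp_smul]

lemma I1_mul (u v : WithConv (C →ₗ[k] P)) : I1 (u * v).ofConv = I1 u.ofConv * I1 v.ofConv :=
  algHom_convMul _ _ _
lemma I2_mul (u v : WithConv (C →ₗ[k] P)) : I2 (u * v).ofConv = I2 u.ofConv * I2 v.ofConv :=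
  algHom_convMul _ _ _

lemma I1_mul_I2 (u v : C →ₗ[k] P) (y : C) : (I1 u * I2 v) y = TensorProduct.map u v (comul y) := by
  simp only [(ℛ k y).convMul_apply, ← (ℛ k y).eq]
  simp [I1, I2]

lemma I2_mul_I1 (u v : C →ₗ[k] P) (y : C) :
    (I2 v * I1 u) y = TensorProduct.map u v (TensorProduct.comm k C C (comul y)) := by
  simp only [(ℛ k y).convMul_apply, ← (ℛ k y).eq]
  simp [I1, I2]

lemma I_comm (u v : C →ₗ[k] P) (h : ∀ y, TensorProduct.map u v (comul (R := k) y) =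
    TensorProduct.map u v (TensorProduct.comm k C C (comul y))) : I2 v * I1 u = I1 u * I2 v := by
  ext y
  rw [I1_mul_I2, I2_mul_I1, h]

lemma comul_eq (φ : C →ₗc[k] P) :
    toConv ((Bialgebra.comulAlgHom k P).toLinearMap ∘ₗ φ.toLinearMap) =
      I1 φ.toLinearMap * I2 φ.toLinearMap := by
  ext y
  rw [I1_mul_I2]
  exact (congr($(φ.map_comp_comul) y)).symm
end

lemma comul_inl (a : A) {ι : Type*} (r : Repr k a ι) : comul (R := k) (a ⊗ₜ[k] (1 : H)) =
    ∑ i ∈ r.index, (r.left i ⊗ₜ[k] (1 : H)) ⊗ₜ[k] (r.right i ⊗ₜ[k] (1 : H)) := by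
  simp [← r.eq, TensorProduct.sum_tmul, Algebra.TensorProduct.one_def]

lemma comul_inr (h : H) {ι : Type*} (r : Repr k h ι) : comul (R := k) ((1 : A) ⊗ₜ[k] h) =
    ∑ i ∈ r.index, ((1 : A) ⊗ₜ[k] r.left i) ⊗ₜ[k] ((1 : A) ⊗ₜ[k] r.right i) := by
  simp [← r.eq, TensorProduct.tmul_sum, Algebra.TensorProduct.one_def]

variable (k A H) in
/-- `a ↦ a ⊗ 1` as a map of coalgebras. -/
def inlc : A →ₗc[k] A ⊗[k] H where
  __ := (inl k A H).toLinearMap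
  counit_comp := by ext; simp
  map_comp_comul := by
    ext a
    simp [-TensorProduct.comul_tmul, comul_inl a (ℛ k a)]
    simp [← (ℛ k a).eq]

variable (k A H) in
/-- `h ↦ 1 ⊗ h` as a map of coalgebras. -/
def inrc : H →ₗc[k] A ⊗[k] H where
  __ := (inr k A H).toLinearMap
  counit_comp := by ext; simp
  map_comp_comul := by
    ext a
    simp [-TensorProduct.comul_tmul, comul_inr a (ℛ k a)]
    simp [← (ℛ k a).eq]

variable (s : CrossedSystem k A H)

lemma comul_actOn (b : A) {ι : Type*} (r : Repr k b ι) :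
    toConv ((Bialgebra.comulAlgHom k (A ⊗[k] H)).toLinearMap ∘ₗ
      (inl k A H).toLinearMap ∘ₗ tensorCounit H (s.actOn b)) =
    ∑ i ∈ r.index, I1 ((inl k A H).toLinearMap ∘ₗ tensorCounit H (s.actOn (r.left i))) *
      I2 ((inl k A H).toLinearMap ∘ₗ tensorCounit H (s.actOn (r.right i))) := by
  have key : toConv ((Bialgebra.comulAlgHom k (A ⊗[k] H)).toLinearMap ∘ₗ
      (inl k A H).toLinearMap ∘ₗ s.actOn b) =
    ∑ i ∈ r.index, I1 ((inl k A H).toLinearMap ∘ₗ s.actOn (r.left i)) *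
      I2 ((inl k A H).toLinearMap ∘ₗ s.actOn (r.right i)) := by
    ext g
    have h1 := congr($((inlc k A H).map_comp_comul) (s.act (g ⊗ₜ b)))
    have h2 := congr($(s.act.map_comp_comul) (g ⊗ₜ b))
    have h3 : comul (R := k) (g ⊗ₜ[k] b) = _ := ((ℛ k g).tmul r).eq.symm
    simp only [LinearMap.comp_apply] at h1 h2
    rw [h3] at h2
    refine h1.symm.trans ?_
    refine (congrArg _ h2.symm).trans ?_
    simp [Finset.sum_product, -LinearMap.convMul_apply, I1_mul_I2, ← (ℛ k g).eq]
    rw [Finset.sum_comm]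
    rfl
  have h4 := congrArg (fun w : WithConv (H →ₗ[k] _) => toConv (tensorCounit H w.ofConv)) key
  refine .trans ?_ (h4.trans ?_)
  · ext; simp
  · have (t : Finset ι) (F : ι → WithConv (H →ₗ[k] (A ⊗[k] H) ⊗[k] (A ⊗[k] H))) :
        toConv (tensorCounit H (∑ i ∈ t, F i).ofConv) =
          ∑ i ∈ t, toConv (tensorCounit H (F i).ofConv) := by
      classical
      induction t using Finset.induction_on with
      | empty => simp
      | insert a t ha ih => rw [Finset.sum_insert ha, Finset.sum_insert ha, ← ih, ofConv_add, map_add, toConv_add]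
    rw [this]
    refine Finset.sum_congr rfl fun i _ => ?_
    rw [tensorCounit_convMul]
    congr 1 <;> · ext; simp [I1, I2]

lemma comm_ZY : I2 ((inl k A H).toLinearMap ∘ₗ s.cocycle.toLinearMap) *
    I1 ((inr k A H).toLinearMap ∘ₗ LinearMap.mul' k H) =
    I1 ((inr k A H).toLinearMap ∘ₗ LinearMap.mul' k H) *
     I2 ((inl k A H).toLinearMap ∘ₗ s.cocycle.toLinearMap) := by
  apply I_comm
  intro y
  have := congrArg (TensorProduct.map (inr k A H).toLinearMap (inl k A H).toLinearMap)
    (s.cocycle_comm y)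
  simpa only [TensorProduct.map_map] using this

lemma comm_FX (F : H ⊗[k] H →ₗ[k] A ⊗[k] H) (b : A) :
    I2 ((inl k A H).toLinearMap ∘ₗ tensorCounit H (s.actOn b)) * I1 F =
    I1 F * I2 ((inl k A H).toLinearMap ∘ₗ tensorCounit H (s.actOn b)) := by
  apply I_comm
  intro y
  induction y with
  | zero => simp
  | add y z hy hz => simp only [map_add, hy, hz]
  | tmul g h =>
  have h1 := congrArg (TensorProduct.map (F ∘ₗ (TensorProduct.mk k H H).flip h)
    (inl k A H).toLinearMap) (s.act_comm g b)
  rw [← ((ℛ k g).tmul (ℛ k h)).eq]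
  rw [← (ℛ k g).eq] at h1
  simp [Finset.sum_product] at h1 ⊢
  have e1 : ∑ i ∈ (ℛ k h).index, counit (R := k) ((ℛ k h).left i) • (ℛ k h).right i = h :=
    sum_counit_smul _
  have e2 : ∑ i ∈ (ℛ k h).index, counit (R := k) ((ℛ k h).right i) • (ℛ k h).left i = h :=
    by simpa only [map_sum, TensorProduct.rid_tmul, one_smul] using
        congr(TensorProduct.rid k H $(sum_tmul_counit_eq (R := k) (ℛ k h)))
  refine .trans ?_ (h1.trans ?_)
  · refine Finset.sum_congr rfl fun i _ => ?_
    conv_rhs => rw [← e2]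
    simp [TensorProduct.tmul_sum, TensorProduct.sum_tmul, TensorProduct.smul_tmul]
  · refine Finset.sum_congr rfl fun i _ => ?_
    conv_lhs => rw [← e1]
    simp [TensorProduct.tmul_sum, TensorProduct.sum_tmul, TensorProduct.smul_tmul]

lemma six_comm {R : Type*} [Ring R] {X1 X2 Y1 Y2 Z1 Z2 : R} (c1 : Y2 * Z1 = Z1 * Y2)
    (c2 : X2 * Y1 = Y1 * X2) (c3 : X2 * Z1 = Z1 * X2) :
    X1 * X2 * (Y1 * Y2 * (Z1 * Z2)) = X1 * (Y1 * Z1) * (X2 * (Y2 * Z2)) :=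
  calc X1 * X2 * (Y1 * Y2 * (Z1 * Z2)) = X1 * (X2 * Y1) * (Y2 * Z1) * Z2 := by
        simp only [mul_assoc]
    _ = X1 * Y1 * (X2 * Z1) * Y2 * Z2 := by rw [c2, c1]; simp only [mul_assoc]
    _ = _ := by rw [c3]; simp only [mul_assoc]

lemma I1_Phi (b : A) : I1 (s.Phi b) = I1 ((inl k A H).toLinearMap ∘ₗ tensorCounit H (s.actOn b)) *
    (I1 ((inl k A H).toLinearMap ∘ₗ s.cocycle.toLinearMap) *
      I1 ((inr k A H).toLinearMap ∘ₗ LinearMap.mul' k H)) := by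
  rw [Phi_apply, I1_mul, Q, I1_mul]

lemma I2_Phi (b : A) : I2 (s.Phi b) = I2 ((inl k A H).toLinearMap ∘ₗ tensorCounit H (s.actOn b)) *
    (I2 ((inl k A H).toLinearMap ∘ₗ s.cocycle.toLinearMap) *
      I2 ((inr k A H).toLinearMap ∘ₗ LinearMap.mul' k H)) := by
  rw [Phi_apply, I2_mul, Q, I2_mul]

lemma comul_Phi (b : A) {ι : Type*} (r : Repr k b ι) :
    toConv ((Bialgebra.comulAlgHom k (A ⊗[k] H)).toLinearMap ∘ₗ s.Phi b) =
      ∑ i ∈ r.index, I1 (s.Phi (r.left i)) * I2 (s.Phi (r.right i)) := by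
  have hf : toConv ((Bialgebra.comulAlgHom k (A ⊗[k] H)).toLinearMap ∘ₗ
      (toConv ((inl k A H).toLinearMap ∘ₗ s.cocycle.toLinearMap)).ofConv) =
      I1 ((inl k A H).toLinearMap ∘ₗ s.cocycle.toLinearMap) *
      I2 ((inl k A H).toLinearMap ∘ₗ s.cocycle.toLinearMap) := comul_eq ((inlc k A H).comp s.cocycle)
  have hm : toConv ((Bialgebra.comulAlgHom k (A ⊗[k] H)).toLinearMap ∘ₗ
      (toConv ((inr k A H).toLinearMap ∘ₗ LinearMap.mul' k H)).ofConv) =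
      I1 ((inr k A H).toLinearMap ∘ₗ LinearMap.mul' k H) *
      I2 ((inr k A H).toLinearMap ∘ₗ LinearMap.mul' k H) :=
    comul_eq ((inrc k A H).comp (Bialgebra.mulCoalgHom k H))
  rw [Phi_apply, algHom_convMul, Q, algHom_convMul, hf, hm]
  rw [comul_actOn s b r, Finset.sum_mul]
  refine Finset.sum_congr rfl fun i _ => ?_
  rw [I1_Phi, I2_Phi]
  exact six_comm s.comm_ZY
    (s.comm_FX ((inl k A H).toLinearMap ∘ₗ s.cocycle.toLinearMap) (r.right i))
    (s.comm_FX ((inr k A H).toLinearMap ∘ₗ LinearMap.mul' k H) (r.right i))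

lemma comul_mulMap (x y : A ⊗[k] H) : comul (R := k) (s.mulMap x y) =
    TensorProduct.map (TensorProduct.lift s.mulMap) (TensorProduct.lift s.mulMap)
      (comul (R := k) (x ⊗ₜ[k] y)) := by
  induction x with
  | zero => simp
  | add p p' h h' => simp only [map_add, LinearMap.add_apply, h, h', TensorProduct.add_tmul]
  | tmul a g =>
  induction y with
  | zero => simp
  | add p p' h h' => simp only [map_add, h, h', TensorProduct.tmul_add]
  | tmul b h =>
  rw [mulMap_tmul, Bialgebra.comul_mul, comul_inl a (ℛ k a)]
  have := congr(($(s.comul_Phi b (ℛ k b))).ofConv (g ⊗ₜ h))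
  refine (congrArg _ this).trans ?_
  rw [← (((ℛ k a).tmul (ℛ k g)).tmul ((ℛ k b).tmul (ℛ k h))).eq]
  simp only [WithConv.ofConv_sum, LinearMap.sum_apply, I1_mul_I2]
  rw [← ((ℛ k g).tmul (ℛ k h)).eq]
  rw [Finset.sum_mul]
  simp [Finset.sum_product, Finset.mul_sum]
  refine Finset.sum_congr rfl fun i _ => ?_
  rw [Finset.sum_comm]

lemma counit_sum {C : Type*} [AddCommGroup C] [Module k C] [Coalgebra k C] (c : C) :
    ∑ i ∈ (ℛ k c).index, counit (R := k) ((ℛ k c).left i) * counit (R := k) ((ℛ k c).right i) =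
      counit (R := k) c := by
  simpa only [map_sum, map_smul, smul_eq_mul] using
    congr(counit (R := k) $(sum_counit_smul (ℛ k c)))

lemma counit_Q (g h : H) : counit (R := k) (s.Q (g ⊗ₜ h)) = counit (R := k) g * counit (R := k) h := by
  rw [Q, convMul_tmul _ _ (ℛ k g) (ℛ k h)]
  simp only [map_sum]
  rw [← counit_sum g, ← counit_sum h, Finset.sum_mul_sum]
  refine Finset.sum_congr rfl fun i _ => Finset.sum_congr rfl fun j _ => ?_
  simp
  ring

lemma counit_mulMap (x y : A ⊗[k] H) : counit (R := k) (s.mulMap x y) =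
    counit (R := k) x * counit (R := k) y := by
  induction x with
  | zero => simp
  | add p p' h h' => simp only [map_add, LinearMap.add_apply, h, h', add_mul]
  | tmul a g =>
  induction y with
  | zero => simp
  | add p p' h h' => simp only [map_add, h, h', mul_add]
  | tmul b h =>
  rw [mulMap_tmul, Bialgebra.counit_mul, s.Phi_tmul _ _ _ (ℛ k g)]
  simp only [map_sum]
  simp [counit_Q]
  rw [← counit_sum g, Finset.mul_sum, Finset.sum_mul, Finset.sum_mul]
  refine Finset.sum_congr rfl fun i _ => ?_
  ring



end CrossedSystem

namespace CrossedSystem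

variable {k A H : Type u} [Field k] [Ring A] [Ring H] [HopfAlgebra k A] [HopfAlgebra k H]
variable (s : CrossedSystem k A H)

lemma comul_mul_aux (x y : s.Product) :
    (TensorProduct.map (TensorProduct.lift s.mulMap) (TensorProduct.lift s.mulMap)
      (comul (R := k) (((Product.of s).symm x) ⊗ₜ[k] ((Product.of s).symm y))) :
        (A ⊗[k] H) ⊗[k] (A ⊗[k] H)) =
    (comul (R := k) x * comul (R := k) y : s.Product ⊗[k] s.Product) := by
  have e {ι : Type u} (z : s.Product) (r : Repr k ((Product.of s).symm z) ι) : comul (R := k) z =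
      ∑ i ∈ r.index, Product.of s (r.left i) ⊗ₜ[k] Product.of s (r.right i) := r.eq.symm
  rw [e x (ℛ k _), e y (ℛ k _), ← ((ℛ k ((Product.of s).symm x)).tmul (ℛ k ((Product.of s).symm y))).eq]
  simp only [map_sum, Coalgebra.Repr.tmul_index, Finset.sum_product, Finset.sum_mul_sum]
  refine Finset.sum_congr rfl fun i _ => Finset.sum_congr rfl fun j _ => ?_
  rw [Algebra.TensorProduct.tmul_mul_tmul]
  rfl

instance : Bialgebra k s.Product := Bialgebra.mk' k s.Product
  ((TensorProduct.counit_tmul (R := k) (S := k) (1 : A) (1 : H)).trans (by simp))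
  (fun {x y} => s.counit_mulMap x y)
  ((TensorProduct.comul_tmul (R := k) (S := k) (1 : A) (1 : H)).trans (by simp; rfl))
  (fun {x y} => (s.comul_mulMap x y).trans (comul_mul_aux s x y))


namespace Product

lemma of_mul_of (a b : A) (g h : H) : of s (a ⊗ₜ g) * of s (b ⊗ₜ h) =
    of s ((a ⊗ₜ 1) * s.Phi b (g ⊗ₜ h)) := rfl

lemma of_mul_of_one (a b : A) (h : H) : of s (a ⊗ₜ 1) * of s (b ⊗ₜ h) = of s ((a * b) ⊗ₜ h) := by
  have e : comul (R := k) ((1 : H)) = 1 ⊗ₜ 1 := by simp; rfl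
  rw [of_mul_of, s.Phi_tmul _ _ _ (⟨Finset.univ, fun _ => 1, fun _ => 1, by simp [e]⟩ :
      Repr k (1 : H) Unit)]
  simp [s.one_act, Q_one_left]

/-- The inclusion `A → A # H`, `a ↦ a # 1`. -/
def incl : A →ₐc[k] s.Product :=
  { (of s).toCoalgHom.comp (inlc k A H) with
    map_one' := rfl
    map_mul' a b := (of_mul_of_one s a b 1).symm }

@[simp] lemma incl_apply (a : A) : incl s a = of s (a ⊗ₜ 1) := rfl

/-- The coalgebra section `H → A # H`, `h ↦ 1 # h`. -/
def sect : H →ₗc[k] s.Product := (of s).toCoalgHom.comp (inrc k A H)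

@[simp] lemma sect_apply (h : H) : sect s h = of s (1 ⊗ₜ h) := rfl

lemma of_eq (a : A) (h : H) : of s (a ⊗ₜ h) = incl s a * sect s h := by
  simp [of_mul_of_one]

variable (k A H) in
/-- `a ⊗ h ↦ ε(a) h` -/
def epsId : A ⊗[k] H →ₐ[k] H := (Algebra.TensorProduct.lid k H).toAlgHom.comp
  (Algebra.TensorProduct.map (Bialgebra.counitAlgHom k A) (.id k H))

@[simp] lemma epsId_tmul (a : A) (h : H) : epsId k A H (a ⊗ₜ h) = counit (R := k) a • h := by
  simp [epsId]

lemma epsId_Q (g h : H) : epsId k A H (s.Q (g ⊗ₜ h)) = g * h := by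
  rw [Q, convMul_tmul _ _ (ℛ k g) (ℛ k h)]
  simp only [map_sum]
  conv_rhs => rw [← sum_counit_smul (ℛ k g), ← sum_counit_smul (ℛ k h), Finset.sum_mul_sum]
  refine Finset.sum_congr rfl fun i _ => Finset.sum_congr rfl fun j _ => ?_
  simp [smul_smul, mul_comm]

lemma epsId_mulMap (x y : A ⊗[k] H) :
    epsId k A H (s.mulMap x y) = epsId k A H x * epsId k A H y := by
  induction x with
  | zero => simp
  | add p p' h h' => simp only [map_add, LinearMap.add_apply, h, h', add_mul]
  | tmul a g =>
  induction y with
  | zero => simp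
  | add p p' h h' => simp only [map_add, h, h', mul_add]
  | tmul b h =>
  rw [mulMap_tmul, map_mul, s.Phi_tmul _ _ _ (ℛ k g)]
  simp only [map_sum, map_mul, epsId_Q]
  conv_rhs => rw [epsId_tmul, epsId_tmul, ← sum_counit_smul (ℛ k g)]
  simp [Finset.smul_sum, Finset.sum_mul, Finset.mul_sum, smul_smul, mul_comm, mul_left_comm]

/-- The projection `A # H → H`, `a # h ↦ ε(a) h`. -/
def proj : s.Product →ₐc[k] H where
  toCoalgHom := ((Coalgebra.TensorProduct.lid k H).toCoalgHom.comp
    (Coalgebra.TensorProduct.map (counitCoalgHom k A) (CoalgHom.id k H))).comp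
      (of s).symm.toCoalgHom
  map_one' := map_one (epsId k A H)
  map_mul' x y := epsId_mulMap s x y

@[simp] lemma proj_of (a : A) (h : H) : proj s (of s (a ⊗ₜ h)) = counit (R := k) a • h :=
  epsId_tmul a h

/-! antipode -/

lemma sect_mul_sect (g h : H) : sect s g * sect s h =
    (toConv ((incl s : A →ₗ[k] s.Product) ∘ₗ s.cocycle.toLinearMap) *
      toConv ((sect s).toLinearMap ∘ₗ LinearMap.mul' k H)) (g ⊗ₜ h) := by
  have e : sect s g * sect s h = of s (s.Q (g ⊗ₜ h)) := by
    rw [sect_apply, sect_apply, of_mul_of]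
    rw [s.Phi_tmul _ _ _ (ℛ k g)]
    congr 1
    rw [← Algebra.TensorProduct.one_def, one_mul]
    conv_rhs => rw [← sum_counit_smul (ℛ k g)]
    simp [s.act_one, TensorProduct.sum_tmul, Algebra.algebraMap_eq_smul_one, ← TensorProduct.smul_tmul',
      ← Algebra.TensorProduct.one_def]
  rw [e, Q, convMul_tmul _ _ (ℛ k g) (ℛ k h), convMul_tmul _ _ (ℛ k g) (ℛ k h)]
  simp [of_mul_of_one]

lemma convMul_of (u v : WithConv (s.Product →ₗ[k] s.Product)) (a : A) (h : H) :
    (u * v) (of s (a ⊗ₜ h)) = ∑ i ∈ (ℛ k a).index, ∑ j ∈ (ℛ k h).index,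
      u (of s ((ℛ k a).left i ⊗ₜ (ℛ k h).left j)) *
        v (of s ((ℛ k a).right i ⊗ₜ (ℛ k h).right j)) :=
  convMul_tmul (toConv (u.ofConv ∘ₗ (of s).toCoalgHom.toLinearMap))
    (toConv (v.ofConv ∘ₗ (of s).toCoalgHom.toLinearMap)) (ℛ k a) (ℛ k h)

lemma hom_ext {u v : WithConv (s.Product →ₗ[k] s.Product)}
    (h : ∀ (a : A) (h : H), u (of s (a ⊗ₜ h)) = v (of s (a ⊗ₜ h))) : u = v :=
  WithConv.ext (TensorProduct.ext' h)

lemma counit_of (a : A) (h : H) : counit (R := k) (of s (a ⊗ₜ h)) =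
    counit (R := k) h * counit (R := k) a :=
  TensorProduct.counit_tmul (R := k) (S := k) a h

/-- If `δ : H → H ⊗ H` is a coalgebra map with `m δ = η ε`, then -/
lemma sect_conv (δ : H →ₗc[k] H ⊗[k] H)
    (hδ : LinearMap.mul' k H ∘ₗ δ.toLinearMap = (1 : WithConv (H →ₗ[k] H)).ofConv) :
    toConv (LinearMap.mul' k s.Product ∘ₗ
      TensorProduct.map (sect s).toLinearMap (sect s).toLinearMap ∘ₗ δ.toLinearMap) =
    toConv ((incl s : A →ₐ[k] s.Product).toLinearMap ∘ₗ (s.cocycle.comp δ).toLinearMap) := by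
  have h1 : LinearMap.mul' k s.Product ∘ₗ
      TensorProduct.map (sect s).toLinearMap (sect s).toLinearMap =
      (toConv ((incl s : A →ₗ[k] s.Product) ∘ₗ s.cocycle.toLinearMap) *
      toConv ((sect s).toLinearMap ∘ₗ LinearMap.mul' k H)).ofConv := by
    ext g h
    exact sect_mul_sect s g h
  have h2 := convMul_coalgHom (toConv ((incl s : A →ₗ[k] s.Product) ∘ₗ s.cocycle.toLinearMap))
    (toConv ((sect s).toLinearMap ∘ₗ LinearMap.mul' k H)) δ
  rw [← h1] at h2
  have h3 : toConv ((toConv ((sect s).toLinearMap ∘ₗ LinearMap.mul' k H)).ofConv ∘ₗ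
      δ.toLinearMap) = 1 := by
    dsimp only
    rw [LinearMap.comp_assoc, hδ]
    ext y
    simp [Algebra.algebraMap_eq_smul_one]
    rfl
  rw [h3, mul_one] at h2
  exact h2

lemma comp_antipode {C : Type*} [AddCommGroup C] [Module k C] [Coalgebra k C] (φ : C →ₗc[k] A) :
    toConv φ.toLinearMap * toConv (HopfAlgebra.antipode k ∘ₗ φ.toLinearMap) = 1 ∧
      toConv (HopfAlgebra.antipode k ∘ₗ φ.toLinearMap) * toConv φ.toLinearMap = 1 := by
  have h1 := convMul_coalgHom (toConv .id) (toConv (HopfAlgebra.antipode k)) φ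
  have h2 := convMul_coalgHom (toConv (HopfAlgebra.antipode k)) (toConv .id) φ
  have h3 : toConv ((1 : WithConv (A →ₗ[k] A)).ofConv ∘ₗ φ.toLinearMap) = 1 := by
    ext y; simp
  rw [LinearMap.id_mul_antipode, h3] at h1
  rw [LinearMap.antipode_mul_id, h3] at h2
  exact ⟨h1.symm, h2.symm⟩

lemma algHom_one {C M N : Type*} [AddCommGroup C] [Module k C] [Coalgebra k C]
    [Ring M] [Algebra k M] [Ring N] [Algebra k N] (φ : M →ₐ[k] N) :
    toConv (φ.toLinearMap ∘ₗ (1 : WithConv (C →ₗ[k] M)).ofConv) = 1 := by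
  ext y; simp

lemma I1_antipode :
    I1 (k := k) (HopfAlgebra.antipode k (A := H)) * I1 (k := k) (C := H) (P := H) .id = 1 := by
  have h := I1_mul (k := k) (toConv (HopfAlgebra.antipode k (A := H))) (toConv (.id : H →ₗ[k] H))
  rw [LinearMap.antipode_mul_id] at h
  refine h.symm.trans ?_
  ext y
  simp [I1]

lemma I2_antipode :
    I2 (k := k) (HopfAlgebra.antipode k (A := H)) * I2 (k := k) (C := H) (P := H) .id = 1 := by
  have h := I2_mul (k := k) (toConv (HopfAlgebra.antipode k (A := H))) (toConv (.id : H →ₗ[k] H))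
  rw [LinearMap.antipode_mul_id] at h
  refine h.symm.trans ?_
  ext y
  simp [I2, Algebra.algebraMap_eq_smul_one, Algebra.TensorProduct.one_def]

section Cocomm
variable [IsCocomm k H]

variable (k H) in
/-- The antipode of a cocommutative Hopf algebra is a map of coalgebras. -/
def antipodec : H →ₗc[k] H where
  __ := HopfAlgebra.antipode k (A := H)
  counit_comp := by ext; simp
  map_comp_comul := by
    have h1 : (I1 (HopfAlgebra.antipode k (A := H)) * I2 (HopfAlgebra.antipode k)) *
        (I1 (C := H) (P := H) (k := k) .id * I2 .id) = 1 := by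
      have c : I2 (HopfAlgebra.antipode k (A := H)) * I1 (C := H) (P := H) (k := k) .id =
          I1 .id * I2 (HopfAlgebra.antipode k) := I_comm _ _ fun y => by simp
      calc _ = I1 (HopfAlgebra.antipode k (A := H)) *
            (I2 (HopfAlgebra.antipode k (A := H)) * I1 (C := H) (P := H) (k := k) .id) *
              I2 (C := H) (P := H) (k := k) .id := by simp only [mul_assoc]
        _ = (I1 (HopfAlgebra.antipode k (A := H)) * I1 (C := H) (P := H) (k := k) .id) *
            (I2 (HopfAlgebra.antipode k (A := H)) * I2 (C := H) (P := H) (k := k) .id) := by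
          rw [c]; simp only [mul_assoc]
        _ = 1 := by rw [I1_antipode, I2_antipode, mul_one]
    have h2 : (I1 (C := H) (P := H) (k := k) .id * I2 .id) = toConv comul := by
      ext y
      rw [I1_mul_I2]
      simp
    rw [h2] at h1
    have h3 := left_inv_eq_right_inv h1 LinearMap.comul_right_inv
    ext y
    have := congr(($h3).ofConv y)
    rw [I1_mul_I2] at this
    exact this

lemma exists_sect_inv : ∃ j : WithConv (H →ₗ[k] s.Product),
    toConv (sect s).toLinearMap * j = 1 ∧ j * toConv (sect s).toLinearMap = 1 := by
  have h1 := sect_conv s ((Coalgebra.TensorProduct.map (CoalgHom.id k H) (antipodec k H)).comp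
    (comulCoalgHom k H)) (congrArg ofConv LinearMap.id_mul_antipode)
  have h2 := sect_conv s ((Coalgebra.TensorProduct.map (antipodec k H) (CoalgHom.id k H)).comp
    (comulCoalgHom k H)) (congrArg ofConv LinearMap.antipode_mul_id)
  have e1 : toConv (LinearMap.mul' k s.Product ∘ₗ
      TensorProduct.map (sect s).toLinearMap (sect s).toLinearMap ∘ₗ
      ((Coalgebra.TensorProduct.map (CoalgHom.id k H) (antipodec k H)).comp
    (comulCoalgHom k H)).toLinearMap) = toConv (sect s).toLinearMap *
      toConv ((sect s).toLinearMap ∘ₗ HopfAlgebra.antipode k) := by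
    ext y
    simp only [(ℛ k y).convMul_apply]
    change LinearMap.mul' k s.Product (TensorProduct.map (sect s).toLinearMap (sect s).toLinearMap
      (TensorProduct.map .id (HopfAlgebra.antipode k) (comul y))) = _
    rw [← (ℛ k y).eq]
    simp
  have e2 : toConv (LinearMap.mul' k s.Product ∘ₗ
      TensorProduct.map (sect s).toLinearMap (sect s).toLinearMap ∘ₗ
      ((Coalgebra.TensorProduct.map (antipodec k H) (CoalgHom.id k H)).comp
    (comulCoalgHom k H)).toLinearMap) = toConv ((sect s).toLinearMap ∘ₗ HopfAlgebra.antipode k) *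
      toConv (sect s).toLinearMap := by
    ext y
    simp only [(ℛ k y).convMul_apply]
    change LinearMap.mul' k s.Product (TensorProduct.map (sect s).toLinearMap (sect s).toLinearMap
      (TensorProduct.map (HopfAlgebra.antipode k) .id (comul y))) = _
    rw [← (ℛ k y).eq]
    simp
  rw [e1] at h1
  rw [e2] at h2
  generalize (s.cocycle.comp ((Coalgebra.TensorProduct.map (CoalgHom.id k H)
    (antipodec k H)).comp (comulCoalgHom k H))) = φ₁ at h1
  generalize (s.cocycle.comp ((Coalgebra.TensorProduct.map
    (antipodec k H) (CoalgHom.id k H)).comp (comulCoalgHom k H))) = φ₂ at h2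
  have i1 := algHom_convMul (incl s : A →ₐ[k] s.Product) (toConv φ₁.toLinearMap)
    (toConv (HopfAlgebra.antipode k ∘ₗ φ₁.toLinearMap))
  rw [(comp_antipode φ₁).1, algHom_one] at i1
  have i2 := algHom_convMul (incl s : A →ₐ[k] s.Product)
    (toConv (HopfAlgebra.antipode k ∘ₗ φ₂.toLinearMap)) (toConv φ₂.toLinearMap)
  rw [(comp_antipode φ₂).2, algHom_one] at i2
  dsimp only at i1 i2
  rw [← h1, mul_assoc] at i1
  rw [← h2, ← mul_assoc] at i2
  refine ⟨_, i1.symm, ?_⟩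
  rw [← left_inv_eq_right_inv i2.symm i1.symm]
  exact i2.symm

/-- The convolution inverse of `h ↦ 1 # h` -/
def sectInv : WithConv (H →ₗ[k] s.Product) := (exists_sect_inv s).choose

lemma sect_mul_sectInv : toConv (sect s).toLinearMap * sectInv s = 1 :=
  (exists_sect_inv s).choose_spec.1

lemma sectInv_mul_sect : sectInv s * toConv (sect s).toLinearMap = 1 :=
  (exists_sect_inv s).choose_spec.2

/-- The antipode `a # h ↦ (1 # h)⁻¹ (S(a) # 1)`. -/
def antipodeLin : s.Product →ₗ[k] s.Product :=
  TensorProduct.lift (LinearMap.mk₂ k (fun a h => (sectInv s).ofConv h *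
        incl s (HopfAlgebra.antipode k a))
      (by intros; rw [map_add, map_add, mul_add])
      (by intros; rw [map_smul, map_smul, mul_smul_comm])
      (by intros; rw [map_add, add_mul])
      (by intros; rw [map_smul, smul_mul_assoc])) ∘ₗ (of s).symm.toLinearMap

lemma antipodeLin_of (a : A) (h : H) : antipodeLin s (of s (a ⊗ₜ h)) =
    (sectInv s).ofConv h * incl s (HopfAlgebra.antipode k a) := rfl

instance : HopfAlgebra k s.Product :=
  HopfAlgebra.ofConvInverse (antipodeLin s)
    (by
      apply hom_ext
      intro a h
      have h1 := congr(($(sectInv_mul_sect s)).ofConv h)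
      rw [(ℛ k h).convMul_apply] at h1
      have h2 := HopfAlgebra.sum_antipode_mul_eq_smul (ℛ k a)
      rw [convMul_of, Finset.sum_comm, LinearMap.convOne_apply, counit_of]
      have h3 (j) : ∑ i ∈ (ℛ k a).index, antipodeLin s (of s ((ℛ k a).left i ⊗ₜ (ℛ k h).left j)) *
          of s ((ℛ k a).right i ⊗ₜ (ℛ k h).right j) = counit (R := k) a •
            ((sectInv s).ofConv ((ℛ k h).left j) * sect s ((ℛ k h).right j)) := by
        have h4 := congrArg (incl s) h2
        rw [map_sum, map_smul, map_one] at h4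
        have h5 := congrArg (fun w => (sectInv s).ofConv ((ℛ k h).left j) * w *
          sect s ((ℛ k h).right j)) h4
        rw [mul_smul_comm, smul_mul_assoc, mul_one, Finset.mul_sum, Finset.sum_mul] at h5
        rw [← h5]
        refine Finset.sum_congr rfl fun i _ => ?_
        rw [antipodeLin_of, of_eq, map_mul]
        simp only [mul_assoc]
      refine (Finset.sum_congr rfl fun j _ => h3 j).trans ?_
      rw [← Finset.smul_sum]
      refine (congrArg _ h1).trans ?_
      rw [LinearMap.convOne_apply, Algebra.algebraMap_eq_smul_one, Algebra.algebraMap_eq_smul_one,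
        smul_smul, mul_comm])
    (by
      apply hom_ext
      intro a h
      have h1 := congr(($(sect_mul_sectInv s)).ofConv h)
      rw [(ℛ k h).convMul_apply] at h1
      have h2 := HopfAlgebra.sum_mul_antipode_eq_smul (ℛ k a)
      rw [convMul_of, LinearMap.convOne_apply, counit_of]
      have h3 (i) : ∑ j ∈ (ℛ k h).index, of s ((ℛ k a).left i ⊗ₜ (ℛ k h).left j) *
          antipodeLin s (of s ((ℛ k a).right i ⊗ₜ (ℛ k h).right j)) = counit (R := k) h •
            incl s ((ℛ k a).left i * HopfAlgebra.antipode k ((ℛ k a).right i)) := by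
        rw [LinearMap.convOne_apply, Algebra.algebraMap_eq_smul_one] at h1
        have h5 := congrArg (fun w => incl s ((ℛ k a).left i) * w *
          incl s (HopfAlgebra.antipode k ((ℛ k a).right i))) h1
        rw [mul_smul_comm, smul_mul_assoc, mul_one, Finset.mul_sum, Finset.sum_mul, ← map_mul] at h5
        rw [← h5]
        refine Finset.sum_congr rfl fun i _ => ?_
        rw [antipodeLin_of, of_eq]
        simp only [mul_assoc]
        rfl
      refine (Finset.sum_congr rfl fun i _ => h3 i).trans ?_
      rw [← Finset.smul_sum, ← map_sum, h2, map_smul, map_one, smul_smul,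
        Algebra.algebraMap_eq_smul_one])

end Cocomm

end Product

end CrossedSystem

namespace CrossedSystem

variable {k A H : Type u} [Field k] [Ring A] [Ring H] [HopfAlgebra k A] [HopfAlgebra k H]

/-- A coalgebra map `r : H → A` is unitary cocentral if `r(1) = 1` and
`r(h₁) ⊗ h₂ = r(h₂) ⊗ h₁` for all `h`. -/
def IsUnitaryCocentral (r : H →ₗc[k] A) : Prop :=
  r 1 = 1 ∧ ∀ h : H, r.toLinearMap.rTensor H (comul (R := k) h) =
      r.toLinearMap.rTensor H (TensorProduct.comm k H H (comul h))

/-- Two crossed systems `(▷, f)` and `(▷', f')` are cohomologous if there is a unitary cocentral map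
`r : H → A` such that `h ▷' a = r(h₁) (h₂ ▷ a) S(r(h₃))` and
`f'(h, g) = r(h₁) (h₂ ▷ r(g₁)) f(h₃, g₂) S(r(h₄ g₃))`. -/
def Cohomologous (s s' : CrossedSystem k A H) : Prop :=
  ∃ r : H →ₗc[k] A, IsUnitaryCocentral r ∧
    (∀ a : A, toConv (s'.actOn a) = toConv r.toLinearMap * toConv (s.actOn a) *
      toConv (HopfAlgebra.antipode k ∘ₗ r.toLinearMap)) ∧
    toConv s'.cocycle.toLinearMap =
      toConv (tensorCounit H r.toLinearMap) *
      toConv (s.act.toLinearMap ∘ₗ r.toLinearMap.lTensor H) *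
      toConv s.cocycle.toLinearMap *
      toConv (HopfAlgebra.antipode k ∘ₗ r.toLinearMap ∘ₗ LinearMap.mul' k H)

lemma tensorCounit_one {C : Type*} [AddCommGroup C] [Module k C] [Coalgebra k C] :
    toConv (tensorCounit H (1 : WithConv (C →ₗ[k] A)).ofConv) = 1 := by
  ext c h
  simp [Algebra.algebraMap_eq_smul_one, smul_smul]

lemma act_one_comp (s : CrossedSystem k A H) :
    toConv (s.act.toLinearMap ∘ₗ (1 : WithConv (H →ₗ[k] A)).ofConv.lTensor H) = 1 := by
  ext g h
  simp [Algebra.algebraMap_eq_smul_one, s.act_one, smul_smul]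

lemma comp_mul_convMul (u v : WithConv (H →ₗ[k] A)) :
    toConv ((u * v).ofConv ∘ₗ LinearMap.mul' k H) =
      toConv (u.ofConv ∘ₗ LinearMap.mul' k H) * toConv (v.ofConv ∘ₗ LinearMap.mul' k H) :=
  convMul_coalgHom u v (Bialgebra.mulCoalgHom k H)

lemma comp_mul_one :
    toConv ((1 : WithConv (H →ₗ[k] A)).ofConv ∘ₗ LinearMap.mul' k H) = 1 := by
  ext g h
  simp [Algebra.algebraMap_eq_smul_one, mul_comm]

lemma Cohomologous.refl (s : CrossedSystem k A H) : Cohomologous s s := by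
  have h1 : toConv ((Bialgebra.unitBialgHom k A : k →ₗc[k] A).comp (counitCoalgHom k H)).toLinearMap
    = 1 := rfl
  have h2 : toConv (HopfAlgebra.antipode k ∘ₗ
    ((Bialgebra.unitBialgHom k A : k →ₗc[k] A).comp (counitCoalgHom k H)).toLinearMap) = 1 := by
    ext y
    change HopfAlgebra.antipode k (algebraMap k A (counit y)) = algebraMap k A (counit y)
    simp [Algebra.algebraMap_eq_smul_one]
  refine ⟨(Bialgebra.unitBialgHom k A : k →ₗc[k] A).comp (counitCoalgHom k H), ⟨?_, ?_⟩, ?_, ?_⟩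
  · change algebraMap k A (counit (1 : H)) = 1
    simp
  · intro h
    change (1 : WithConv (H →ₗ[k] A)).ofConv.rTensor H _ =
      (1 : WithConv (H →ₗ[k] A)).ofConv.rTensor H _
    have e1 : ∑ i ∈ (ℛ k h).index, counit (R := k) ((ℛ k h).left i) • (ℛ k h).right i = h :=
      sum_counit_smul _
    have e2 : ∑ i ∈ (ℛ k h).index, counit (R := k) ((ℛ k h).right i) • (ℛ k h).left i = h :=
      by simpa only [map_sum, TensorProduct.rid_tmul, one_smul] using
        congr(TensorProduct.rid k H $(sum_tmul_counit_eq (R := k) (ℛ k h)))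
    rw [← (ℛ k h).eq]
    simp [Algebra.algebraMap_eq_smul_one, TensorProduct.smul_tmul]
    simp only [← TensorProduct.tmul_smul, ← TensorProduct.tmul_sum, e1, e2]
  · intro a
    rw [h1, h2, one_mul, mul_one]
  · have h3 := comp_mul_one (k := k) (A := A) (H := H)
    rw [← h2] at h3
    have h4 := tensorCounit_one (k := k) (A := A) (H := H) (C := H)
    rw [← h1] at h4
    have h5 := s.act_one_comp
    rw [← h1] at h5
    dsimp only [ofConv_toConv] at h3 h4 h5
    rw [LinearMap.comp_assoc] at h3
    rw [h3, h4, h5, one_mul, one_mul, mul_one]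

lemma isUnitaryCocentral_commute {r : H →ₗc[k] A} (hr : IsUnitaryCocentral r) :
    Commute (toConv ((inl k A H).toLinearMap ∘ₗ r.toLinearMap))
      (toConv (inr k A H).toLinearMap) := by
  change _ = _
  ext h
  have h2 := hr.2 h
  rw [← (ℛ k h).eq] at h2
  simp [(ℛ k h).convMul_apply] at h2 ⊢
  exact h2

lemma commute_cocentral {r : H →ₗc[k] A} (h : Commute
    (toConv ((inl k A H).toLinearMap ∘ₗ r.toLinearMap))
      (toConv (inr k A H).toLinearMap)) (y : H) :
      r.toLinearMap.rTensor H (comul (R := k) y) =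
      r.toLinearMap.rTensor H (TensorProduct.comm k H H (comul y)) := by
  have h2 := congr(($(h.eq)).ofConv y)
  rw [(ℛ k y).convMul_apply, (ℛ k y).convMul_apply] at h2
  rw [← (ℛ k y).eq]
  simp at h2 ⊢
  exact h2

lemma I_commute {r : H →ₗc[k] A} (hr : IsUnitaryCocentral r) (v : H →ₗ[k] A) :
    Commute (I1 r.toLinearMap) (I2 v) := by
  refine (I_comm _ _ fun y => ?_).symm
  have h := congrArg (v.lTensor A) (hr.2 y)
  have e (z : H ⊗[k] H) : v.lTensor A (r.toLinearMap.rTensor H z) =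
      TensorProduct.map r.toLinearMap v z := congr($(LinearMap.lTensor_comp_rTensor ..) z)
  rwa [e, e] at h

lemma counit_conv {r : H →ₗ[k] A} (h : counit (R := k) ∘ₗ r = counit) :
    toConv ((Bialgebra.counitAlgHom k A).toLinearMap ∘ₗ r) = 1 := by
  ext y
  exact congr($h y)

lemma I1_one : I1 (k := k) (C := H) (P := A) (1 : WithConv (H →ₗ[k] A)).ofConv = 1 := Product.algHom_one _
lemma I2_one : I2 (k := k) (C := H) (P := A) (1 : WithConv (H →ₗ[k] A)).ofConv = 1 := Product.algHom_one _

lemma exists_inv {r : H →ₗc[k] A} (hr : IsUnitaryCocentral r) :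
    ∃ t : H →ₗc[k] A, IsUnitaryCocentral t ∧
      t.toLinearMap = HopfAlgebra.antipode k ∘ₗ r.toLinearMap ∧
      r.toLinearMap = HopfAlgebra.antipode k ∘ₗ t.toLinearMap ∧
      toConv r.toLinearMap * toConv t.toLinearMap = 1 ∧
      toConv t.toLinearMap * toConv r.toLinearMap = 1 := by
  set S : H →ₗ[k] A := HopfAlgebra.antipode k ∘ₗ r.toLinearMap with hS
  obtain ⟨m1, m2⟩ := Product.comp_antipode r
  rw [← hS] at m1 m2
  have a1 : I1 r.toLinearMap * I1 S = 1 := by rw [← I1_one, ← m1, I1_mul]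
  have a2 : I1 S * I1 r.toLinearMap = 1 := by rw [← I1_one, ← m2, I1_mul]
  have a3 : I2 r.toLinearMap * I2 S = 1 := by rw [← I2_one, ← m1, I2_mul]
  have a4 : I2 S * I2 r.toLinearMap = 1 := by rw [← I2_one, ← m2, I2_mul]
  have c1 : I1 r.toLinearMap * I2 S = I2 S * I1 r.toLinearMap := I_commute hr S
  have d1 : I1 S * I2 S * toConv ((Bialgebra.comulAlgHom k A).toLinearMap ∘ₗ r.toLinearMap) = 1 := by
    rw [comul_eq]
    calc _ = I1 S * (I2 S * I1 r.toLinearMap) * I2 r.toLinearMap := by simp only [mul_assoc]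
      _ = (I1 S * I1 r.toLinearMap) * (I2 S * I2 r.toLinearMap) := by
        rw [← c1]; simp only [mul_assoc]
      _ = 1 := by rw [a2, a4, one_mul]
  have d2 : toConv ((Bialgebra.comulAlgHom k A).toLinearMap ∘ₗ r.toLinearMap) *
      toConv ((Bialgebra.comulAlgHom k A).toLinearMap ∘ₗ S) = 1 := by
    have := algHom_convMul (Bialgebra.comulAlgHom k A) (toConv r.toLinearMap) (toConv S)
    rw [m1, Product.algHom_one] at this
    exact this.symm
  have d3 := left_inv_eq_right_inv d1 d2
  have e1 : toConv ((Bialgebra.counitAlgHom k A).toLinearMap ∘ₗ S) = 1 := by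
    have := algHom_convMul (Bialgebra.counitAlgHom k A) (toConv r.toLinearMap) (toConv S)
    rw [m1, Product.algHom_one] at this
    dsimp only at this
    rw [counit_conv r.counit_comp, one_mul] at this
    exact this.symm
  let t : H →ₗc[k] A :=
    { S with
      counit_comp := by
        ext y
        exact congr(($e1).ofConv y)
      map_comp_comul := by
        ext y
        have := congr(($d3).ofConv y)
        refine .trans ?_ this
        exact (I1_mul_I2 S S y).symm }
  obtain ⟨n1, n2⟩ := Product.comp_antipode t
  refine ⟨t, ⟨?_, commute_cocentral ?_⟩, rfl, ?_, m1, m2⟩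
  · change HopfAlgebra.antipode k (r 1) = 1
    rw [hr.1, HopfAlgebra.antipode_one]
  · have h1 := isUnitaryCocentral_commute hr
    have p1 := algHom_convMul (inl k A H) (toConv r.toLinearMap) (toConv S)
    have p2 := algHom_convMul (inl k A H) (toConv S) (toConv r.toLinearMap)
    rw [m1, Product.algHom_one] at p1
    rw [m2, Product.algHom_one] at p2
    let U : (WithConv (H →ₗ[k] A ⊗[k] H))ˣ := ⟨_, _, p1.symm, p2.symm⟩
    exact Commute.units_inv_left (u := U) h1
  · exact congrArg ofConv (left_inv_eq_right_inv m1 n1)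

lemma exists_mul {r r' : H →ₗc[k] A} (hr : IsUnitaryCocentral r) (hr' : IsUnitaryCocentral r') :
    ∃ t : H →ₗc[k] A, IsUnitaryCocentral t ∧
      toConv t.toLinearMap = toConv r.toLinearMap * toConv r'.toLinearMap := by
  set M := toConv r.toLinearMap * toConv r'.toLinearMap with hM
  have d1 := algHom_convMul (Bialgebra.comulAlgHom k A) (toConv r.toLinearMap)
    (toConv r'.toLinearMap)
  have d2 := algHom_convMul (Bialgebra.counitAlgHom k A) (toConv r.toLinearMap)
    (toConv r'.toLinearMap)
  dsimp only at d1 d2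
  rw [counit_conv r.counit_comp, counit_conv r'.counit_comp, one_mul] at d2
  have d3 : toConv ((Bialgebra.comulAlgHom k A).toLinearMap ∘ₗ M.ofConv) =
      I1 M.ofConv * I2 M.ofConv := by
    refine d1.trans ?_
    rw [comul_eq, comul_eq, hM, I1_mul, I2_mul]
    have c : I2 r.toLinearMap * I1 r'.toLinearMap = _ := (I_commute hr' r.toLinearMap).eq.symm
    dsimp only
    calc _ = I1 r.toLinearMap * (I2 r.toLinearMap * I1 r'.toLinearMap) * I2 r'.toLinearMap := by
            simp only [mul_assoc]
      _ = _ := by rw [c]; simp only [mul_assoc]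
  let t : H →ₗc[k] A :=
    { M.ofConv with
      counit_comp := by
        ext y
        exact congr(($d2).ofConv y)
      map_comp_comul := by
        ext y
        have := congr(($d3).ofConv y)
        refine .trans ?_ this.symm
        exact (I1_mul_I2 _ _ y).symm }
  refine ⟨t, ⟨?_, commute_cocentral ?_⟩, rfl⟩
  · change (toConv r.toLinearMap * toConv r'.toLinearMap) (1 : H) = 1
    have e : comul (R := k) ((1 : H)) = 1 ⊗ₜ 1 := by simp; rfl
    rw [(⟨Finset.univ, fun _ => 1, fun _ => 1, by simp [e]⟩ :
      Repr k (1 : H) Unit).convMul_apply]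
    simp [hr.1, hr'.1]
  · have h1 := isUnitaryCocentral_commute hr
    have h2 := isUnitaryCocentral_commute hr'
    have h3 := algHom_convMul (inl k A H) (toConv r.toLinearMap) (toConv r'.toLinearMap)
    have h4 := Commute.mul_left h1 h2
    rw [← h3] at h4
    exact h4

lemma tensorCounit_mul_apply {C M : Type*} [AddCommGroup C] [Module k C] [Coalgebra k C]
    [Ring M] [Algebra k M] (p : H →ₗ[k] M) (F : WithConv (H ⊗[k] C →ₗ[k] M)) (g : H) (c : C) :
    (toConv (tensorCounit C p) * F).ofConv (g ⊗ₜ c) =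
      ∑ i ∈ (ℛ k g).index, p ((ℛ k g).left i) * F.ofConv ((ℛ k g).right i ⊗ₜ c) := by
  refine (convMul_tmul _ _ (ℛ k g) (ℛ k c)).trans (Finset.sum_congr rfl fun i _ => ?_)
  conv_rhs => rw [← sum_counit_smul (ℛ k c)]
  simp [TensorProduct.tmul_sum, Finset.mul_sum]

lemma mul_tensorCounit_apply {C M : Type*} [AddCommGroup C] [Module k C] [Coalgebra k C]
    [Ring M] [Algebra k M] (p : H →ₗ[k] M) (F : WithConv (H ⊗[k] C →ₗ[k] M)) (g : H) (c : C) :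
    (F * toConv (tensorCounit C p)).ofConv (g ⊗ₜ c) =
      ∑ i ∈ (ℛ k g).index, F.ofConv ((ℛ k g).left i ⊗ₜ c) * p ((ℛ k g).right i) := by
  refine (convMul_tmul _ _ (ℛ k g) (ℛ k c)).trans (Finset.sum_congr rfl fun i _ => ?_)
  have e2 : ∑ i ∈ (ℛ k c).index, counit (R := k) ((ℛ k c).right i) • (ℛ k c).left i = c :=
      by simpa only [map_sum, TensorProduct.rid_tmul, one_smul] using
        congr(TensorProduct.rid k C $(sum_tmul_counit_eq (R := k) (ℛ k c)))
  conv_rhs => rw [← e2]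
  simp [TensorProduct.tmul_sum, Finset.sum_mul]

lemma act_conj {s s' : CrossedSystem k A H} {p q : H →ₗ[k] A} (h : ∀ a : A,
    toConv (s'.actOn a) = toConv p * toConv (s.actOn a) * toConv q)
    {C : Type*} [AddCommGroup C] [Module k C] [Coalgebra k C] (φ : C →ₗ[k] A) :
    toConv (s'.act.toLinearMap ∘ₗ φ.lTensor H) =
      toConv (tensorCounit C p) * toConv (s.act.toLinearMap ∘ₗ φ.lTensor H) *
        toConv (tensorCounit C q) := by
  refine WithConv.ext (TensorProduct.ext' fun g c => ?_)
  rw [mul_tensorCounit_apply]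
  simp only [tensorCounit_mul_apply]
  have := congr(($(h (φ c))).ofConv g)
  rw [(ℛ k g).convMul_apply] at this
  refine this.trans (Finset.sum_congr rfl fun i _ => ?_)
  rw [(ℛ k _).convMul_apply]
  rfl

lemma Cohomologous.symm {s s' : CrossedSystem k A H} (h : Cohomologous s s') :
    Cohomologous s' s := by
  obtain ⟨r, hr, ha, hf⟩ := h
  obtain ⟨t, ht, h1, h2, h3, h4⟩ := exists_inv hr
  rw [← h1] at ha
  rw [← LinearMap.comp_assoc, ← h1] at hf
  refine ⟨t, ht, fun a => ?_, ?_⟩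
  · rw [ha, ← h2]
    calc _ = 1 * toConv (s.actOn a) * 1 := by simp
      _ = _ := by rw [← h4]; simp only [mul_assoc]
  · rw [← LinearMap.comp_assoc, ← h2]
    have hc := act_conj ha (C := H) t.toLinearMap
    have t1 := tensorCounit_convMul (D := H) (toConv r.toLinearMap) (toConv t.toLinearMap)
    have t2 := tensorCounit_convMul (D := H) (toConv t.toLinearMap) (toConv r.toLinearMap)
    have m1 := comp_mul_convMul (toConv t.toLinearMap) (toConv r.toLinearMap)
    have d1 := s.act_mul_comp (toConv t.toLinearMap) (toConv r.toLinearMap)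
    rw [h3, tensorCounit_one] at t1
    rw [h4, tensorCounit_one] at t2
    rw [h4, comp_mul_one] at m1
    rw [h4, act_one_comp] at d1
    dsimp only at t1 t2 m1 d1
    rw [hf, hc]
    refine Eq.symm ?_
    calc _ = toConv (tensorCounit H t.toLinearMap) * toConv (tensorCounit H r.toLinearMap) *
          (toConv (s.act.toLinearMap ∘ₗ t.toLinearMap.lTensor H) *
          (toConv (tensorCounit H t.toLinearMap) * toConv (tensorCounit H r.toLinearMap)) *
          toConv (s.act.toLinearMap ∘ₗ r.toLinearMap.lTensor H)) * toConv s.cocycle.toLinearMap *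
          (toConv (t.toLinearMap ∘ₗ LinearMap.mul' k H) *
            toConv (r.toLinearMap ∘ₗ LinearMap.mul' k H)) := by simp only [mul_assoc]
      _ = _ := by rw [← t2, ← m1, mul_one, one_mul, mul_one, ← d1, one_mul]

lemma Cohomologous.trans {s s' s'' : CrossedSystem k A H} (h : Cohomologous s s')
    (h' : Cohomologous s' s'') : Cohomologous s s'' := by
  obtain ⟨r, hr, ha, hf⟩ := h
  obtain ⟨r', hr', ha', hf'⟩ := h'
  obtain ⟨t, ht, h1, h2, h3, h4⟩ := exists_inv hr
  obtain ⟨t', ht', h1', h2', h3', h4'⟩ := exists_inv hr'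
  obtain ⟨m, hm, em⟩ := exists_mul hr' hr
  obtain ⟨n1, n2⟩ := Product.comp_antipode m
  have hn : toConv (HopfAlgebra.antipode k ∘ₗ m.toLinearMap) =
      toConv t.toLinearMap * toConv t'.toLinearMap := by
    refine left_inv_eq_right_inv n2 ?_
    rw [em]
    calc _ = toConv r'.toLinearMap * (toConv r.toLinearMap * toConv t.toLinearMap) *
          toConv t'.toLinearMap := by simp only [mul_assoc]
      _ = 1 := by rw [h3, mul_one, h3']
  refine ⟨m, hm, fun a => ?_, ?_⟩
  · rw [ha', ha, hn, em, ← h1, ← h1']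
    simp only [mul_assoc]
  · rw [← LinearMap.comp_assoc]
    rw [← LinearMap.comp_assoc, ← h1] at hf
    rw [← LinearMap.comp_assoc, ← h1'] at hf'
    rw [← h1] at ha
    have hc := act_conj ha (C := H) r'.toLinearMap
    have t0 := tensorCounit_convMul (D := H) (toConv r'.toLinearMap) (toConv r.toLinearMap)
    have t1 := tensorCounit_convMul (D := H) (toConv t.toLinearMap) (toConv r.toLinearMap)
    have m1 := comp_mul_convMul (toConv t.toLinearMap) (toConv t'.toLinearMap)
    have d1 := s.act_mul_comp (toConv r'.toLinearMap) (toConv r.toLinearMap)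
    rw [h4, tensorCounit_one] at t1
    rw [← em] at t0 d1
    rw [← hn] at m1
    dsimp only at t0 t1 m1 d1
    rw [t0, d1, m1, hf', hc, hf]
    calc _ = toConv (tensorCounit H r'.toLinearMap) * toConv (tensorCounit H r.toLinearMap) *
          (toConv (s.act.toLinearMap ∘ₗ r'.toLinearMap.lTensor H) *
          (toConv (tensorCounit H t.toLinearMap) * toConv (tensorCounit H r.toLinearMap)) *
          toConv (s.act.toLinearMap ∘ₗ r.toLinearMap.lTensor H)) * toConv s.cocycle.toLinearMap *
          (toConv (t.toLinearMap ∘ₗ LinearMap.mul' k H) *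
            toConv (t'.toLinearMap ∘ₗ LinearMap.mul' k H)) := by simp only [mul_assoc]
      _ = _ := by rw [← t1, mul_one]

variable (k A H) in
/-- The setoid of cohomologous crossed systems. -/
instance setoid : Setoid (CrossedSystem k A H) where
  r := Cohomologous
  iseqv := ⟨Cohomologous.refl, Cohomologous.symm, Cohomologous.trans⟩

/-- The extension `A → A # H → H` given by the crossed product of `s`, with the maps `a ↦ a # 1` and
`a # h ↦ ε(a) h`, is equivalent to the extension `A → E → H` with the maps `i` and `π`: some
isomorphism of Hopf algebras `A # H ≅ E` stabilizes `A` and co-stabilizes `H`. -/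
def IsEquivTo (s : CrossedSystem k A H) {E : Type u} [Ring E] [HopfAlgebra k E]
    (i : A →ₐc[k] E) (π : E →ₐc[k] H) : Prop :=
  ∃ ψ : s.Product ≃ₐc[k] E, (∀ a, ψ (Product.incl s a) = i a) ∧
    ∀ y, π (ψ y) = Product.proj s y

end CrossedSystem

section

variable (k H A : Type u) [Field k] [Ring H] [Ring A] [HopfAlgebra k H] [HopfAlgebra k A]

/-- The set `ℋ²(H, A)` of crossed systems `(A, H, ▷, f)` up to the relation of being
cohomologous. -/
def H2 : Type u := Quotient (CrossedSystem.setoid k A H)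

variable {k H A} in
/-- The class of a crossed system in `ℋ²(H, A)`. -/
def H2.mk (s : CrossedSystem k A H) : H2 k H A := Quotient.mk _ s

/-- The isomorphism classes of Hopf algebras over `k`. -/
def HopfIsoClass : Type (u + 1) := Quotient (CategoryTheory.isIsomorphicSetoid (HopfAlgCat.{u} k))

/-- The isomorphism class of a Hopf algebra. -/
def isoClass (k : Type u) [Field k] (E : Type u) [Ring E] [HopfAlgebra k E] : HopfIsoClass k :=
  Quotient.mk _ (HopfAlgCat.of k E)

/-- The set `Crp(H, A)` of types of isomorphisms of Hopf algebras of all crossed products `A # H`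
associated to the crossed systems `(A, H, ▷, f)`, for a cocommutative Hopf algebra `H`. -/
def Crp [Coalgebra.IsCocomm k H] : Set (HopfIsoClass k) :=
  Set.range fun s : CrossedSystem k A H => isoClass k s.Product

end

/-- Data for a Hopf algebra generated by an abelian group `Γ` and one skew primitive element of
square zero: an element of `Γ` and a character of `Γ` taking the value `-1` on it. -/
structure LineDatum (k : Type u) (Γ : Type) [Field k] [CommGroup Γ] where
  /-- The element `γ`. -/
  elt : Γ
  /-- The character `χ`. -/
  char : Γ →* k
  /-- `χ(γ) = -1` -/
  char_elt : char elt = -1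

/-- The Hopf algebra attached to a datum `(γ, χ)`. It is generated by the group `Γ` and an element
`x`, subject to `x² = 0` and `h x = χ(h) x h` for `h ∈ Γ`; the elements of `Γ` are group-like, and
`Δ(x) = x ⊗ 1 + γ ⊗ x`. The elements `h` and `x h`, for `h ∈ Γ`, form a basis, and the pair `(p, q)`
of elements of `k[Γ]` stands for `p + x q`. -/
def Bosonization {k : Type u} {Γ : Type} [Field k] [CommGroup Γ] (_D : LineDatum k Γ) : Type u :=
  MonoidAlgebra k Γ × MonoidAlgebra k Γ

namespace Bosonization

variable {k : Type u} {Γ : Type} [Field k] [CommGroup Γ] (D : LineDatum k Γ)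

instance : AddCommGroup (Bosonization D) :=
  inferInstanceAs (AddCommGroup (MonoidAlgebra k Γ × MonoidAlgebra k Γ))

instance : Module k (Bosonization D) :=
  inferInstanceAs (Module k (MonoidAlgebra k Γ × MonoidAlgebra k Γ))

/-- The automorphism `h ↦ χ(h) h` of `k[Γ]`. -/
def twist : MonoidAlgebra k Γ →ₐ[k] MonoidAlgebra k Γ :=
  MonoidAlgebra.lift k _ Γ
    { toFun := fun h => D.char h • MonoidAlgebra.of k Γ h
      map_one' := by rw [map_one, map_one, one_smul]
      map_mul' := fun a b => by rw [map_mul, map_mul, smul_mul_smul_comm] }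

lemma twist_of (h : Γ) : twist D (MonoidAlgebra.of k Γ h) = D.char h • MonoidAlgebra.of k Γ h :=
  MonoidAlgebra.lift_of _ _

/-- `(p + x q) (p' + x q') = p p' + x (q p' + τ(p) q')`, where `τ(h) = χ(h) h`. -/
instance : Mul (Bosonization D) where
  mul u v := (u.1 * v.1, u.2 * v.1 + twist D u.1 * v.2)

instance : One (Bosonization D) where
  one := ((1 : MonoidAlgebra k Γ), (0 : MonoidAlgebra k Γ))

lemma mul_fst (u v : Bosonization D) : (u * v).1 = u.1 * v.1 := rfl
lemma mul_snd (u v : Bosonization D) : (u * v).2 = u.2 * v.1 + twist D u.1 * v.2 := rfl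
lemma add_fst (u v : Bosonization D) : (u + v).1 = u.1 + v.1 := rfl
lemma add_snd (u v : Bosonization D) : (u + v).2 = u.2 + v.2 := rfl
lemma smul_fst (c : k) (v : Bosonization D) : (c • v).1 = c • v.1 := rfl
lemma smul_snd (c : k) (v : Bosonization D) : (c • v).2 = c • v.2 := rfl
lemma zero_fst : (0 : Bosonization D).1 = 0 := rfl
lemma zero_snd : (0 : Bosonization D).2 = 0 := rfl
lemma one_fst : (1 : Bosonization D).1 = 1 := rfl
lemma one_snd : (1 : Bosonization D).2 = 0 := rfl

variable {D} in
lemma ext' {u v : Bosonization D} (h1 : u.1 = v.1) (h2 : u.2 = v.2) : u = v := Prod.ext h1 h2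

instance : Ring (Bosonization D) where
  __ := (inferInstance : AddCommGroup (Bosonization D))
  __ := (inferInstance : Mul (Bosonization D))
  __ := (inferInstance : One (Bosonization D))
  zero_mul u := by
    apply ext' <;> simp only [mul_fst, mul_snd, zero_fst, zero_snd, map_zero, zero_mul, add_zero]
  mul_zero u := by
    apply ext' <;> simp only [mul_fst, mul_snd, zero_fst, zero_snd, mul_zero, add_zero]
  left_distrib u v w := by
    apply ext' <;> simp only [mul_fst, mul_snd, add_fst, add_snd] <;> ring
  right_distrib u v w := by
    apply ext' <;> simp only [mul_fst, mul_snd, add_fst, add_snd, map_add] <;> ring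
  mul_assoc u v w := by
    apply ext' <;> simp only [mul_fst, mul_snd, map_mul] <;> ring
  one_mul u := by
    apply ext' <;> simp only [mul_fst, mul_snd, one_fst, one_snd, map_one, zero_mul, one_mul,
      zero_add]
  mul_one u := by
    apply ext' <;> simp only [mul_fst, mul_snd, one_fst, one_snd, mul_zero, mul_one, add_zero]

instance : Algebra k (Bosonization D) := Algebra.ofModule
  (fun c u v => by
    apply ext' <;> simp only [mul_fst, mul_snd, smul_fst, smul_snd, map_smul, smul_mul_assoc,
      smul_add])
  (fun c u v => by
    apply ext' <;> simp only [mul_fst, mul_snd, smul_fst, smul_snd, mul_smul_comm, smul_add])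

/-- The inclusion of `k[Γ]`. -/
def inclGrp : MonoidAlgebra k Γ →ₐ[k] Bosonization D :=
  AlgHom.ofLinearMap (LinearMap.inl k (MonoidAlgebra k Γ) (MonoidAlgebra k Γ)) rfl
    (fun p q => ext' rfl (by
      change 0 = 0 * q + twist D p * 0
      rw [zero_mul, mul_zero, add_zero]))

/-- The element of the bosonization given by `h ∈ Γ`. -/
def grp : Γ →* Bosonization D := (inclGrp D : MonoidAlgebra k Γ →* Bosonization D).comp (MonoidAlgebra.of k Γ)

/-- The generator `x`. -/
def x : Bosonization D := ((0 : MonoidAlgebra k Γ), (1 : MonoidAlgebra k Γ))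

lemma x_mul_x : x D * x D = 0 := by
  apply ext'
  · change 0 * 0 = (0 : MonoidAlgebra k Γ)
    simp
  · change 1 * 0 + twist D 0 * 1 = (0 : MonoidAlgebra k Γ)
    simp

lemma x_mul_inclGrp (q : MonoidAlgebra k Γ) :
    x D * inclGrp D q = ((0 : MonoidAlgebra k Γ), q) := by
  apply ext'
  · change 0 * q = (0 : MonoidAlgebra k Γ)
    simp
  · change 1 * q + twist D 0 * 0 = q
    simp

lemma inclGrp_mul_x (p : MonoidAlgebra k Γ) : inclGrp D p * x D = x D * inclGrp D (twist D p) := by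
  rw [x_mul_inclGrp]
  apply ext'
  · change p * 0 = (0 : MonoidAlgebra k Γ)
    simp
  · change 0 * 0 + twist D p * 1 = twist D p
    simp

/-- The relation `h x = χ(h) x h`. -/
lemma grp_mul_x (h : Γ) : grp D h * x D = D.char h • (x D * grp D h) :=
  (inclGrp_mul_x D _).trans (by rw [twist_of, map_smul, mul_smul_comm]; rfl)

lemma eq_add (u : Bosonization D) : u = inclGrp D u.1 + x D * inclGrp D u.2 := by
  rw [x_mul_inclGrp]
  apply ext'
  · exact (add_zero _).symm
  · exact (zero_add _).symm

variable {D}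

lemma hom_ext {M : Type*} [AddCommGroup M] [Module k M] {f g : Bosonization D →ₗ[k] M}
    (h1 : ∀ h, f (grp D h) = g (grp D h)) (h2 : ∀ h, f (x D * grp D h) = g (x D * grp D h)) :
    f = g := by
  have e1 : f ∘ₗ (inclGrp D).toLinearMap = g ∘ₗ (inclGrp D).toLinearMap :=
    MonoidAlgebra.lhom_ext' fun h => LinearMap.ext_ring (h1 h)
  have e2 : f ∘ₗ LinearMap.mulLeft k (x D) ∘ₗ (inclGrp D).toLinearMap =
      g ∘ₗ LinearMap.mulLeft k (x D) ∘ₗ (inclGrp D).toLinearMap :=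
    MonoidAlgebra.lhom_ext' fun h => LinearMap.ext_ring (h2 h)
  ext u
  rw [eq_add D u, map_add, map_add]
  exact congrArg₂ (· + ·) (congr($e1 u.1)) (congr($e2 u.2))

lemma algHom_ext {C : Type*} [Ring C] [Algebra k C] {f g : Bosonization D →ₐ[k] C}
    (h1 : ∀ h, f (grp D h) = g (grp D h)) (h2 : f (x D) = g (x D)) : f = g :=
  AlgHom.toLinearMap_injective (hom_ext h1 fun h => by
    change f _ = g _
    rw [map_mul, map_mul, h1, h2])

variable (D) in
/-- The universal property: an algebra map out of the bosonization is given by a homomorphism `φ` on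
`Γ` and an element `X` that satisfy the defining relations. -/
def lift {C : Type*} [Ring C] [Algebra k C] (φ : Γ →* C) (X : C) (hX : X * X = 0)
    (hφ : ∀ h, φ h * X = D.char h • (X * φ h)) : Bosonization D →ₐ[k] C :=
  AlgHom.ofLinearMap
    (LinearMap.coprod (MonoidAlgebra.lift k C Γ φ).toLinearMap
      (LinearMap.mulLeft k X ∘ₗ (MonoidAlgebra.lift k C Γ φ).toLinearMap))
    (by
      change MonoidAlgebra.lift k C Γ φ 1 + X * MonoidAlgebra.lift k C Γ φ 0 = 1
      simp)
    (fun u v => by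
      have key : ∀ p, MonoidAlgebra.lift k C Γ φ p * X =
          X * MonoidAlgebra.lift k C Γ φ (twist D p) := by
        have : LinearMap.mulRight k X ∘ₗ (MonoidAlgebra.lift k C Γ φ).toLinearMap =
            LinearMap.mulLeft k X ∘ₗ (MonoidAlgebra.lift k C Γ φ).toLinearMap ∘ₗ
              (twist D).toLinearMap :=
          MonoidAlgebra.lhom_ext' fun h => LinearMap.ext_ring (by
            change MonoidAlgebra.lift k C Γ φ (MonoidAlgebra.of k Γ h) * X =
              X * MonoidAlgebra.lift k C Γ φ (twist D (MonoidAlgebra.of k Γ h))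
            rw [twist_of, map_smul, MonoidAlgebra.lift_of, hφ, mul_smul_comm])
        exact fun p => congr($this p)
      set ψ := MonoidAlgebra.lift k C Γ φ
      change ψ (u.1 * v.1) + X * ψ (u.2 * v.1 + twist D u.1 * v.2) =
        (ψ u.1 + X * ψ u.2) * (ψ v.1 + X * ψ v.2)
      have e1 : X * ψ u.2 * (X * ψ v.2) = 0 := by
        rw [mul_assoc, ← mul_assoc (ψ u.2), key, mul_assoc, ← mul_assoc X X, hX, zero_mul]
      have e2 : ψ u.1 * (X * ψ v.2) = X * (ψ (twist D u.1) * ψ v.2) := by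
        rw [← mul_assoc, key, mul_assoc]
      rw [add_mul, mul_add, mul_add, e1, e2]
      simp only [map_mul, map_add, mul_add, mul_assoc, add_zero]
      abel)

@[simp] lemma lift_grp {C : Type*} [Ring C] [Algebra k C] (φ : Γ →* C) (X : C) (hX : X * X = 0)
    (hφ : ∀ h, φ h * X = D.char h • (X * φ h)) (h : Γ) : lift D φ X hX hφ (grp D h) = φ h := by
  change MonoidAlgebra.lift k C Γ φ (MonoidAlgebra.of k Γ h) + X * MonoidAlgebra.lift k C Γ φ 0 = _
  simp

@[simp] lemma lift_x {C : Type*} [Ring C] [Algebra k C] (φ : Γ →* C) (X : C) (hX : X * X = 0)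
    (hφ : ∀ h, φ h * X = D.char h • (X * φ h)) : lift D φ X hX hφ (x D) = X := by
  change MonoidAlgebra.lift k C Γ φ 0 + X * MonoidAlgebra.lift k C Γ φ 1 = _
  simp

lemma elt_mul_x : grp D D.elt * x D = - (x D * grp D D.elt) := by
  rw [grp_mul_x, D.char_elt, neg_one_smul]

variable (D)

/-- `Δ(h) = h ⊗ h` and `Δ(x) = x ⊗ 1 + γ ⊗ x`. -/
def comulHom : Bosonization D →ₐ[k] Bosonization D ⊗[k] Bosonization D :=
  lift D
    { toFun := fun h => grp D h ⊗ₜ grp D h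
      map_one' := by rw [map_one]; rfl
      map_mul' := fun a b => by rw [map_mul, Algebra.TensorProduct.tmul_mul_tmul] }
    (x D ⊗ₜ 1 + grp D D.elt ⊗ₜ x D)
    (by
      simp only [add_mul, mul_add, Algebra.TensorProduct.tmul_mul_tmul, x_mul_x, elt_mul_x,
        mul_one, one_mul, TensorProduct.zero_tmul, TensorProduct.tmul_zero, TensorProduct.neg_tmul]
      abel)
    (fun h => by
      change grp D h ⊗ₜ grp D h * _ = D.char h • (_ * grp D h ⊗ₜ grp D h)
      simp only [add_mul, mul_add, Algebra.TensorProduct.tmul_mul_tmul, mul_one, one_mul,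
        grp_mul_x, TensorProduct.smul_tmul', TensorProduct.tmul_smul, smul_add, ← map_mul,
        mul_comm h])

/-- `ε(h) = 1` and `ε(x) = 0`. -/
def counitHom : Bosonization D →ₐ[k] k := lift D 1 0 (mul_zero 0) (fun h => by simp)

@[simp] lemma comulHom_grp (h : Γ) : comulHom D (grp D h) = grp D h ⊗ₜ grp D h := lift_grp ..
@[simp] lemma comulHom_x : comulHom D (x D) = x D ⊗ₜ 1 + grp D D.elt ⊗ₜ x D := lift_x ..
@[simp] lemma counitHom_grp (h : Γ) : counitHom D (grp D h) = 1 := lift_grp ..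
@[simp] lemma counitHom_x : counitHom D (x D) = 0 := lift_x ..

instance : Bialgebra k (Bosonization D) := Bialgebra.ofAlgHom (comulHom D) (counitHom D)
  (algHom_ext (fun h => by simp) (by
    simp [TensorProduct.add_tmul, TensorProduct.tmul_add, Algebra.TensorProduct.one_def, add_assoc]))
  (algHom_ext (fun h => by simp) (by simp))
  (algHom_ext (fun h => by simp) (by simp))

lemma comul_grp (h : Γ) : comul (R := k) (grp D h) = grp D h ⊗ₜ grp D h := comulHom_grp D h
lemma comul_x : comul (R := k) (x D) = x D ⊗ₜ 1 + grp D D.elt ⊗ₜ x D := comulHom_x D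
lemma counit_grp (h : Γ) : counit (R := k) (grp D h) = 1 := counitHom_grp D h
lemma counit_x : counit (R := k) (x D) = 0 := counitHom_x D

lemma grp_inv_mul (h : Γ) : grp D h⁻¹ * grp D h = 1 := by rw [← map_mul, inv_mul_cancel, map_one]
lemma grp_mul_inv (h : Γ) : grp D h * grp D h⁻¹ = 1 := by rw [← map_mul, mul_inv_cancel, map_one]

lemma x_mul_grp (h : Γ) : x D * grp D h = D.char h⁻¹ • (grp D h * x D) := by
  rw [grp_mul_x, smul_smul, ← map_mul, inv_mul_cancel, map_one, one_smul]

/-- The antipode as an algebra map to the opposite: `h ↦ h⁻¹` and `x ↦ - γ⁻¹ x`. -/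
def antipodeHom : Bosonization D →ₐ[k] (Bosonization D)ᵐᵒᵖ :=
  lift D
    { toFun := fun h => MulOpposite.op (grp D h⁻¹)
      map_one' := by rw [inv_one, map_one, MulOpposite.op_one]
      map_mul' := fun a b => by rw [mul_inv_rev, map_mul, MulOpposite.op_mul] }
    (MulOpposite.op (-(grp D D.elt⁻¹ * x D)))
    (by
      rw [← MulOpposite.op_mul, neg_mul_neg, grp_mul_x, smul_mul_smul_comm, mul_assoc, ← mul_assoc
        (grp D _) (x D), grp_mul_x, smul_mul_assoc, mul_smul_comm, mul_assoc, ← mul_assoc (x D),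
        x_mul_x, zero_mul, smul_zero, smul_zero, MulOpposite.op_zero])
    (fun h => by
      change MulOpposite.op (grp D h⁻¹) * _ = D.char h • (_ * MulOpposite.op (grp D h⁻¹))
      rw [← MulOpposite.op_mul, ← MulOpposite.op_mul, ← MulOpposite.op_smul]
      congr 1
      rw [neg_mul, mul_neg, smul_neg, mul_assoc, x_mul_grp, inv_inv, mul_smul_comm, ← mul_assoc,
        ← mul_assoc, ← map_mul, ← map_mul, mul_comm h⁻¹])

/-- The antipode. -/
def antipodeMap : Bosonization D →ₗ[k] Bosonization D :=
  (MulOpposite.opLinearEquiv k).symm.toLinearMap ∘ₗ (antipodeHom D).toLinearMap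

lemma antipodeHom_grp (h : Γ) : antipodeHom D (grp D h) = MulOpposite.op (grp D h⁻¹) :=
  lift_grp ..
lemma antipodeHom_x : antipodeHom D (x D) = MulOpposite.op (-(grp D D.elt⁻¹ * x D)) := lift_x ..
lemma antipodeMap_grp (h : Γ) : antipodeMap D (grp D h) = grp D h⁻¹ :=
  congrArg MulOpposite.unop (antipodeHom_grp D h)
lemma antipodeMap_x : antipodeMap D (x D) = -(grp D D.elt⁻¹ * x D) :=
  congrArg MulOpposite.unop (antipodeHom_x D)
lemma antipodeMap_mul (a b : Bosonization D) :
    antipodeMap D (a * b) = antipodeMap D b * antipodeMap D a :=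
  congrArg MulOpposite.unop (map_mul (antipodeHom D) a b)

lemma comul_x_mul_grp (h : Γ) : comul (R := k) (x D * grp D h) =
    (x D * grp D h) ⊗ₜ grp D h + grp D (D.elt * h) ⊗ₜ (x D * grp D h) := by
  rw [Bialgebra.comul_mul, comul_x, comul_grp, add_mul, Algebra.TensorProduct.tmul_mul_tmul,
    Algebra.TensorProduct.tmul_mul_tmul, one_mul, map_mul]

instance : HopfAlgebra k (Bosonization D) where
  antipode := antipodeMap D
  mul_antipode_rTensor_comul := hom_ext
    (fun h => by
      simp only [LinearMap.comp_apply, comul_grp, LinearMap.rTensor_tmul, LinearMap.mul'_apply,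
        antipodeMap_grp, grp_inv_mul, counit_grp, Algebra.linearMap_apply, map_one])
    (fun h => by
      simp only [LinearMap.comp_apply, comul_x_mul_grp, map_add, LinearMap.rTensor_tmul,
        LinearMap.mul'_apply, antipodeMap_grp, antipodeMap_mul, antipodeMap_x, Bialgebra.counit_mul,
        counit_x, zero_mul, map_zero, map_mul, mul_neg,
        neg_mul, mul_assoc]
      exact neg_add_cancel _)
  mul_antipode_lTensor_comul := hom_ext
    (fun h => by
      simp only [LinearMap.comp_apply, comul_grp, LinearMap.lTensor_tmul, LinearMap.mul'_apply,
        antipodeMap_grp, grp_mul_inv, counit_grp, Algebra.linearMap_apply, map_one])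
    (fun h => by
      simp only [LinearMap.comp_apply, comul_x_mul_grp, map_add, LinearMap.lTensor_tmul,
        LinearMap.mul'_apply, antipodeMap_grp, antipodeMap_mul, antipodeMap_x, Bialgebra.counit_mul,
        counit_x, zero_mul, map_zero, mul_neg]
      rw [mul_assoc, grp_mul_inv, mul_one, ← mul_assoc, ← mul_assoc, ← map_mul, ← map_mul,
        mul_inv_cancel_right, mul_inv_cancel, map_one, one_mul, add_neg_cancel])

/-- The basis formed by `h` and `x h`, for `h ∈ Γ`. -/
def basis : Module.Basis (Γ ⊕ Γ) k (Bosonization D) :=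
  Module.Basis.ofRepr ((LinearEquiv.refl k (MonoidAlgebra k Γ × MonoidAlgebra k Γ) :
    Bosonization D ≃ₗ[k] MonoidAlgebra k Γ × MonoidAlgebra k Γ).trans
    (((MonoidAlgebra.coeffLinearEquiv k).prodCongr (MonoidAlgebra.coeffLinearEquiv k)).trans
      (Finsupp.sumFinsuppLEquivProdFinsupp k).symm))

lemma basis_inl (h : Γ) : basis D (Sum.inl h) = grp D h := by
  apply (basis D).repr.injective
  rw [Module.Basis.repr_self]
  refine Finsupp.ext fun i => ?_
  rcases i with i | i
  · change _ = (MonoidAlgebra.single h (1 : k)).coeff i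
    rw [MonoidAlgebra.coeff_single]
    exact Finsupp.single_apply_left Sum.inl_injective _ _ _
  · change _ = (0 : MonoidAlgebra k Γ).coeff i
    simp

lemma basis_inr (h : Γ) : basis D (Sum.inr h) = x D * grp D h := by
  apply (basis D).repr.injective
  rw [Module.Basis.repr_self, show x D * grp D h = _ from x_mul_inclGrp D _]
  refine Finsupp.ext fun i => ?_
  rcases i with i | i
  · change _ = (0 : MonoidAlgebra k Γ).coeff i
    simp
  · change _ = (MonoidAlgebra.single h (1 : k)).coeff i
    rw [MonoidAlgebra.coeff_single]
    exact Finsupp.single_apply_left Sum.inr_injective _ _ _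

/-- `h ↦ f(h)`, `x ↦ x`, as an algebra map. -/
def mapAlg {Δ : Type} [CommGroup Δ] (D' : LineDatum k Δ) (f : Γ →* Δ)
    (hχ : D'.char.comp f = D.char) : Bosonization D →ₐ[k] Bosonization D' :=
  lift D ((grp D').comp f) (x D') (x_mul_x D') fun h => by rw [← hχ]; exact grp_mul_x D' (f h)

@[simp] lemma mapAlg_grp {Δ : Type} [CommGroup Δ] (D' : LineDatum k Δ) (f : Γ →* Δ)
    (hχ : D'.char.comp f = D.char) (h : Γ) : mapAlg D D' f hχ (grp D h) = grp D' (f h) :=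
  lift_grp ..

@[simp] lemma mapAlg_x {Δ : Type} [CommGroup Δ] (D' : LineDatum k Δ) (f : Γ →* Δ)
    (hχ : D'.char.comp f = D.char) : mapAlg D D' f hχ (x D) = x D' :=
  lift_x ..

/-- `h ↦ f(h)`, `x ↦ x`, as a map of Hopf algebras. -/
def map {Δ : Type} [CommGroup Δ] (D' : LineDatum k Δ) (f : Γ →* Δ) (hf : f D.elt = D'.elt)
    (hχ : D'.char.comp f = D.char) : Bosonization D →ₐc[k] Bosonization D' :=
  BialgHom.ofAlgHom (mapAlg D D' f hχ)
    (algHom_ext (fun h => by simp [counit_grp]) (by simp [counit_x]))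
    (algHom_ext (fun h => by simp [comul_grp]) (by simp [comul_x, hf]))

/-- `h ↦ f(h)`, `x ↦ 0`, as an algebra map. -/
def toGrpAlg {Δ : Type} [CommGroup Δ] (f : Γ →* Δ) : Bosonization D →ₐ[k] MonoidAlgebra k Δ :=
  lift D ((MonoidAlgebra.of k Δ).comp f) 0 (mul_zero 0) fun h => by simp

@[simp] lemma toGrpAlg_grp {Δ : Type} [CommGroup Δ] (f : Γ →* Δ) (h : Γ) :
    toGrpAlg D f (grp D h) = MonoidAlgebra.of k Δ (f h) := lift_grp ..

@[simp] lemma toGrpAlg_x {Δ : Type} [CommGroup Δ] (f : Γ →* Δ) : toGrpAlg D f (x D) = 0 :=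
  lift_x ..

/-- `h ↦ f(h)`, `x ↦ 0`, as a map of Hopf algebras. -/
def toGrp {Δ : Type} [CommGroup Δ] (f : Γ →* Δ) : Bosonization D →ₐc[k] MonoidAlgebra k Δ :=
  BialgHom.ofAlgHom (toGrpAlg D f)
    (algHom_ext (fun h => by simp [counit_grp]) (by simp [counit_x]))
    (algHom_ext (fun h => by simp [comul_grp]) (by simp [comul_x]))

end Bosonization

/-- The cyclic group `C_n`, written multiplicatively. -/
abbrev Cyc (n : ℕ) : Type := Multiplicative (ZMod n)

/-- The generator of the cyclic group `C_n`. -/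
def Cyc.gen (n : ℕ) : Cyc n := Multiplicative.ofAdd 1

lemma Cyc.gen_pow (n : ℕ) : Cyc.gen n ^ n = 1 := by
  rw [Cyc.gen, ← ofAdd_nsmul]; simp

/-- The homomorphism from `C_n` with value `q` at the generator, where `q ^ n = 1`. -/
def Cyc.lift {M : Type*} [CommMonoid M] (n : ℕ) [NeZero n] (q : M) (hq : q ^ n = 1) : Cyc n →* M :=
  (AddChar.zmodChar n hq).toMonoidHom

lemma Cyc.lift_gen {M : Type*} [CommMonoid M] (n : ℕ) [NeZero n] (hn : 1 < n) (q : M)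
    (hq : q ^ n = 1) : Cyc.lift n q hq (Cyc.gen n) = q := by
  have : Fact (1 < n) := ⟨hn⟩
  change q ^ (1 : ZMod n).val = q
  rw [ZMod.val_one, pow_one]

lemma Cyc.hom_ext {n : ℕ} [NeZero n] {M : Type*} [Monoid M] {f g : Cyc n →* M}
    (h : f (Cyc.gen n) = g (Cyc.gen n)) : f = g := by
  refine MonoidHom.ext fun a => ?_
  have : a = Cyc.gen n ^ ZMod.val (Multiplicative.toAdd a) := by
    apply Multiplicative.toAdd.injective
    rw [toAdd_pow, Cyc.gen, toAdd_ofAdd, nsmul_one, ZMod.natCast_zmod_val]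
  rw [this, map_pow, map_pow, h]

section

variable (k : Type u) [Field k]

/-- The datum of Sweedler's Hopf algebra: `Γ = C_2` with generator `g`, `γ = g` and `χ(g) = -1`. -/
def datum4 : LineDatum k (Cyc 2) where
  elt := Cyc.gen 2
  char := Cyc.lift 2 (-1) neg_one_sq
  char_elt := Cyc.lift_gen 2 one_lt_two _ _

/-- Sweedler's four-dimensional Hopf algebra: generated by `g` and `x` with `g² = 1`, `x² = 0` and
`x g = - g x`, where `g` is group-like and `Δ(x) = x ⊗ 1 + g ⊗ x`. -/
abbrev H4 : Type u := Bosonization (datum4 k)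

namespace H4
/-- The group-like generator of `H4`. -/
def g : H4 k := Bosonization.grp (datum4 k) (Cyc.gen 2)
/-- The skew primitive generator of `H4`. -/
def x : H4 k := Bosonization.x (datum4 k)

lemma g_sq : g k ^ 2 = 1 := by rw [g, ← map_pow, Cyc.gen_pow, map_one]
lemma x_sq : x k ^ 2 = 0 := by rw [sq]; exact Bosonization.x_mul_x _
lemma x_mul_g : x k * g k = -(g k * x k) := by
  rw [eq_neg_iff_add_eq_zero]; rw [g, x]
  rw [show Bosonization.grp (datum4 k) (Cyc.gen 2) * _ = _ from Bosonization.elt_mul_x (D := datum4 k)]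
  exact add_neg_cancel _
lemma comul_g : comul (R := k) (g k) = g k ⊗ₜ g k := Bosonization.comul_grp _ _
lemma counit_g : counit (R := k) (g k) = 1 := Bosonization.counit_grp _ _
lemma comul_x : comul (R := k) (x k) = x k ⊗ₜ 1 + g k ⊗ₜ x k := Bosonization.comul_x _
lemma counit_x : counit (R := k) (x k) = 0 := Bosonization.counit_x _

end H4

variable {k} in
/-- The datum with `Γ = C_4` with generator `d`, `γ = d²` and `χ(d) = ζ`, where `ζ² = -1`. -/
def datum8 (ζ : k) (hζ : ζ ^ 2 = -1) : LineDatum k (Cyc 4) where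
  elt := Cyc.gen 4 ^ 2
  char := Cyc.lift 4 ζ (by rw [show 4 = 2 * 2 from rfl, pow_mul, hζ, neg_one_sq])
  char_elt := by rw [map_pow, Cyc.lift_gen 4 (by norm_num), hζ]

variable {k} in
/-- The eight-dimensional Hopf algebra `H_{8,ζ}`, where `ζ² = -1`: generated by `g`, `x` and `d` with
`g² = 1`, `x² = 0`, `d² = g`, `x g = - g x`, `d g = g d` and `d x = ζ x d`, where `g` and `d` are
group-like and `Δ(x) = x ⊗ 1 + g ⊗ x`. -/
abbrev H8 (ζ : k) (hζ : ζ ^ 2 = -1) : Type u := Bosonization (datum8 ζ hζ)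

namespace H8
variable {k} (ζ : k) (hζ : ζ ^ 2 = -1)
/-- The group-like generator `d` of `H8`. -/
def d : H8 ζ hζ := Bosonization.grp (datum8 ζ hζ) (Cyc.gen 4)
/-- The group-like element `g = d²` of `H8`. -/
def g : H8 ζ hζ := Bosonization.grp (datum8 ζ hζ) (Cyc.gen 4 ^ 2)
/-- The skew primitive generator `x` of `H8`. -/
def x : H8 ζ hζ := Bosonization.x (datum8 ζ hζ)

lemma d_sq : d ζ hζ ^ 2 = g ζ hζ := (map_pow _ _ _).symm
lemma g_sq : g ζ hζ ^ 2 = 1 := by rw [g, ← map_pow, ← pow_mul, Cyc.gen_pow, map_one]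
lemma x_sq : x ζ hζ ^ 2 = 0 := by rw [sq]; exact Bosonization.x_mul_x _
lemma d_mul_g : d ζ hζ * g ζ hζ = g ζ hζ * d ζ hζ := by
  rw [← d_sq, ← pow_succ, ← pow_succ']
lemma d_mul_x : d ζ hζ * x ζ hζ = ζ • (x ζ hζ * d ζ hζ) := by
  have := Bosonization.grp_mul_x (datum8 ζ hζ) (Cyc.gen 4)
  rwa [show (datum8 ζ hζ).char (Cyc.gen 4) = ζ from Cyc.lift_gen 4 (by norm_num) _ _] at this
lemma x_mul_g : x ζ hζ * g ζ hζ = -(g ζ hζ * x ζ hζ) := by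
  rw [eq_neg_iff_add_eq_zero]
  rw [show g ζ hζ * x ζ hζ = _ from Bosonization.elt_mul_x (D := datum8 ζ hζ)]
  exact add_neg_cancel _
lemma comul_d : comul (R := k) (d ζ hζ) = d ζ hζ ⊗ₜ d ζ hζ := Bosonization.comul_grp _ _
lemma counit_d : counit (R := k) (d ζ hζ) = 1 := Bosonization.counit_grp _ _
lemma comul_g : comul (R := k) (g ζ hζ) = g ζ hζ ⊗ₜ g ζ hζ := Bosonization.comul_grp _ _
lemma counit_g : counit (R := k) (g ζ hζ) = 1 := Bosonization.counit_grp _ _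
lemma comul_x : comul (R := k) (x ζ hζ) = x ζ hζ ⊗ₜ 1 + g ζ hζ ⊗ₜ x ζ hζ := Bosonization.comul_x _
lemma counit_x : counit (R := k) (x ζ hζ) = 0 := Bosonization.counit_x _

end H8

/-- The group algebra `k[C_n]`, with its usual Hopf algebra structure. -/
abbrev kC (n : ℕ) : Type u := MonoidAlgebra k (Cyc n)

namespace H8
variable {k} (ζ : k) (hζ : ζ ^ 2 = -1)

/-- The embedding `C_2 → C_4`. -/
def grpHom : Cyc 2 →* Cyc 4 := Cyc.lift 2 (Cyc.gen 4 ^ 2) (by rw [← pow_mul]; exact Cyc.gen_pow 4)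

lemma grpHom_gen : grpHom (Cyc.gen 2) = Cyc.gen 4 ^ 2 := Cyc.lift_gen 2 one_lt_two _ _

lemma char_comp_grpHom : (datum8 ζ hζ).char.comp grpHom = (datum4 k).char :=
  Cyc.hom_ext (by
    rw [MonoidHom.comp_apply, grpHom_gen]
    exact (datum8 ζ hζ).char_elt.trans (datum4 k).char_elt.symm)

/-- The map of Hopf algebras `H_4 → H_{8,ζ}`, `g ↦ g`, `x ↦ x`. -/
def incl : H4 k →ₐc[k] H8 ζ hζ :=
  Bosonization.map (datum4 k) (datum8 ζ hζ) grpHom grpHom_gen (char_comp_grpHom ζ hζ)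

/-- The map of Hopf algebras `H_{8,ζ} → k[C_2]` that sends `d` to the generator and `x` to `0`. -/
def proj : H8 ζ hζ →ₐc[k] kC k 2 :=
  Bosonization.toGrp (datum8 ζ hζ)
    (Cyc.lift 4 (Cyc.gen 2) (by rw [show 4 = 2 * 2 from rfl, pow_mul, Cyc.gen_pow, one_pow]))

lemma incl_g : incl ζ hζ (H4.g k) = g ζ hζ :=
  (Bosonization.mapAlg_grp (datum4 k) (datum8 ζ hζ) grpHom (char_comp_grpHom ζ hζ) _).trans
    (congrArg (Bosonization.grp (datum8 ζ hζ)) grpHom_gen)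
lemma incl_x : incl ζ hζ (H4.x k) = x ζ hζ :=
  Bosonization.mapAlg_x (datum4 k) (datum8 ζ hζ) grpHom (char_comp_grpHom ζ hζ)
lemma proj_d : proj ζ hζ (d ζ hζ) = MonoidAlgebra.of k (Cyc 2) (Cyc.gen 2) :=
  (Bosonization.toGrpAlg_grp ..).trans
    (congrArg (MonoidAlgebra.of k (Cyc 2)) (Cyc.lift_gen 4 (by norm_num) _ _))
lemma proj_x : proj ζ hζ (x ζ hζ) = 0 := Bosonization.toGrpAlg_x ..

/-- The elements `1, g, x, g x, d, g d, x d, g x d` form a basis of `H8`. -/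
lemma exists_basis : ∃ b : Module.Basis (Fin 8) k (H8 ζ hζ), ⇑b =
    ![1, g ζ hζ, x ζ hζ, g ζ hζ * x ζ hζ, d ζ hζ, g ζ hζ * d ζ hζ, x ζ hζ * d ζ hζ,
      g ζ hζ * x ζ hζ * d ζ hζ] := by
  let f : Fin 8 → Cyc 4 ⊕ Cyc 4 := ![.inl 1, .inl (Cyc.gen 4 ^ 2), .inr 1, .inr (Cyc.gen 4 ^ 2),
    .inl (Cyc.gen 4), .inl (Cyc.gen 4 ^ 2 * Cyc.gen 4), .inr (Cyc.gen 4),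
    .inr (Cyc.gen 4 ^ 2 * Cyc.gen 4)]
  have hf : Function.Bijective f := by
    rw [Fintype.bijective_iff_injective_and_card]
    exact ⟨by unfold Function.Injective; decide, rfl⟩
  let b := (Bosonization.basis (datum8 ζ hζ)).reindex (Equiv.ofBijective f hf).symm
  have hb (i) : b i = Bosonization.basis (datum8 ζ hζ) (f i) := Module.Basis.reindex_apply ..
  have hw : ∀ i, IsUnit ((![1, 1, 1, -1, 1, 1, 1, -1] : Fin 8 → k) i) := by
    intro i
    fin_cases i <;> simp
  refine ⟨b.isUnitSMul hw, funext fun i => ?_⟩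
  rw [Module.Basis.isUnitSMul_apply, hb]
  have hgx : g ζ hζ * x ζ hζ = - (x ζ hζ * g ζ hζ) := by rw [x_mul_g, neg_neg]
  have hgxd : g ζ hζ * x ζ hζ * d ζ hζ = - (x ζ hζ * (g ζ hζ * d ζ hζ)) := by
    rw [hgx, neg_mul, mul_assoc]
  rw [hgxd, hgx]
  fin_cases i <;> simp [f, Bosonization.basis_inl, Bosonization.basis_inr, g, x, d]

end H8

/-- The elements `1, g, x, g x` form a basis of `H4`. -/
lemma H4.exists_basis : ∃ b : Module.Basis (Fin 4) k (H4 k), ⇑b =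
    ![1, g k, x k, g k * x k] := by
  let f : Fin 4 → Cyc 2 ⊕ Cyc 2 := ![.inl 1, .inl (Cyc.gen 2), .inr 1, .inr (Cyc.gen 2)]
  have hf : Function.Bijective f := by
    rw [Fintype.bijective_iff_injective_and_card]
    exact ⟨by unfold Function.Injective; decide, rfl⟩
  let b := (Bosonization.basis (datum4 k)).reindex (Equiv.ofBijective f hf).symm
  have hb (i) : b i = Bosonization.basis (datum4 k) (f i) := Module.Basis.reindex_apply ..
  have hw : ∀ i, IsUnit ((![1, 1, 1, -1] : Fin 4 → k) i) := by
    intro i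
    fin_cases i <;> simp
  refine ⟨b.isUnitSMul hw, funext fun i => ?_⟩
  rw [Module.Basis.isUnitSMul_apply, hb]
  have hgx : g k * x k = - (x k * g k) := by rw [x_mul_g, neg_neg]
  rw [hgx]
  fin_cases i <;> simp [f, Bosonization.basis_inl, Bosonization.basis_inr, g, x]

variable (A H : Type u) [Ring A] [Ring H] [HopfAlgebra k A] [HopfAlgebra k H]

/-- The map of Hopf algebras `A → A ⊗ H`, `a ↦ a ⊗ 1`. -/
def tensorIncl : A →ₐc[k] A ⊗[k] H :=
  (Bialgebra.TensorProduct.map (.id k A) (Bialgebra.unitBialgHom k H)).comp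
    (Bialgebra.TensorProduct.rid k k A).symm
/-- The map of Hopf algebras `A ⊗ H → H`, `a ⊗ h ↦ ε(a) h`. -/
def tensorProj : A ⊗[k] H →ₐc[k] H :=
  (Bialgebra.TensorProduct.lid k H : k ⊗[k] H →ₐc[k] H).comp
    (Bialgebra.TensorProduct.map (Bialgebra.counitBialgHom k A) (.id k H))
lemma tensorIncl_apply (a : A) : tensorIncl k A H a = a ⊗ₜ 1 := by
  change a ⊗ₜ (algebraMap k H 1) = _
  rw [map_one]
lemma tensorProj_tmul (a : A) (h : H) : tensorProj k A H (a ⊗ₜ h) = counit (R := k) a • h := rfl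
end

end

/-! The algebra `k[C_2]` is spanned by the group-like elements 1 and c, and on a group-like element
a convolution product is the ordinary product of values. Evaluated on group-like elements, a crossed
system (A, k[C_2], ▷, f) therefore becomes a pair (σ, u): a Hopf algebra endomorphism σ = c ▷ (-) of
A (`genAct`) and a group-like element u = f(c, c) (`genCocycle`), with σ²(a) u = u a. Cohomology
becomes the existence of a group-like v with σ'(a) v = v σ(a) and u' = v σ(v) u
(`cohomologous_iff`). Conversely, a pair (σ, u) with σ(u) = u and σ²(a) u = u a comes from a crossed
system (`ofGen`).

For A = H_4 the pairs are few. The only group-like elements are 1 and g. The relation σ²(a) u = u a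
makes σ injective, hence σ(g) = g. The image of x is again skew primitive and anticommutes with g,
and since 2 ≠ 0 this forces σ(x) = α x (`H4.endo_x`). The relation applied to x gives α² = 1 if u =
1 and α² = -1 if u = g, because g x = -x g (`exists_genAct_x`).

So u is a complete invariant of the cohomology class. It does not change, since v σ(v) = v² = 1 for
v = 1 and v = g. If it is fixed, α is determined up to sign, and v = g, which anticommutes with x,
reverses the sign (`cohomologous_iff_genCocycle_eq`).

The extension is identified by finding in it a group-like lift D of c with D a = σ(a) D and D² = u
(`isEquivTo_of_generator`). In H_4 ⊗ k[C_2] one takes D = v ⊗ c, and in H_{8,ζ} one takes D = v d,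
where v is 1 or g according to the sign of α. Finally, the group-like elements of H_4 ⊗ k[C_2] all
square to 1, whereas d² = g ≠ 1 in H_{8,ζ}. Hence u is also determined by the isomorphism class of
the crossed product, and the value u = g occurs exactly when -1 is a square. -/

noncomputable section

open Coalgebra WithConv

/-! ### Group-like elements, convolution and tensor products -/

section GroupLike

variable {k : Type*} [Field k]

/-- This turns each convolution identity in the definitions of crossed systems and of cohomology
into an identity between products of values in the target algebra. -/
lemma IsGroupLikeElem.convMul_apply {C M : Type*} [AddCommMonoid C] [Module k C] [Coalgebra k C]
    [Ring M] [Algebra k M] {z : C} (hz : IsGroupLikeElem k z) (u v : WithConv (C →ₗ[k] M)) :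
    (u * v).ofConv z = u.ofConv z * v.ofConv z := by
  change LinearMap.mul' k M (TensorProduct.map u.ofConv v.ofConv (comul z)) = _
  rw [hz.comul_eq_tmul_self, TensorProduct.map_tmul, LinearMap.mul'_apply]

/-- The comultiplication of a group-like element as a sum with one term. -/
def IsGroupLikeElem.repr {C : Type*} [AddCommMonoid C] [Module k C] [Coalgebra k C] {z : C}
    (hz : IsGroupLikeElem k z) : Coalgebra.Repr k z Unit :=
  ⟨Finset.univ, fun _ => z, fun _ => z, by simp [hz.comul_eq_tmul_self]⟩

lemma IsGroupLikeElem.tmul {C D : Type*} [AddCommMonoid C] [Module k C] [Coalgebra k C]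
    [AddCommMonoid D] [Module k D] [Coalgebra k D] {c : C} {d : D} (hc : IsGroupLikeElem k c)
    (hd : IsGroupLikeElem k d) : IsGroupLikeElem k (c ⊗ₜ[k] d) where
  counit_eq_one := by
    rw [TensorProduct.counit_tmul, hc.counit_eq_one, hd.counit_eq_one, one_smul]
  comul_eq_tmul_self := by
    rw [TensorProduct.comul_tmul, hc.comul_eq_tmul_self, hd.comul_eq_tmul_self]
    simp

/-- A group-like element of a tensor product is a tensor of group-like elements. -/
lemma IsGroupLikeElem.exists_tmul {C D : Type*} [AddCommGroup C] [Module k C] [Coalgebra k C]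
    [AddCommGroup D] [Module k D] [Coalgebra k D] {z : C ⊗[k] D} (hz : IsGroupLikeElem k z) :
    ∃ (c : C) (d : D), IsGroupLikeElem k c ∧ IsGroupLikeElem k d ∧ z = c ⊗ₜ d := by
  -- The factors of z are its images under p = id ⊗ ε and q = ε ⊗ id, which are group-like because p
  -- and q are coalgebra maps.
  let p : C ⊗[k] D →ₗc[k] C := (Coalgebra.TensorProduct.rid k k C).toCoalgHom.comp
    (Coalgebra.TensorProduct.map (CoalgHom.id k C) (counitCoalgHom k D))
  let q : C ⊗[k] D →ₗc[k] D := (Coalgebra.TensorProduct.lid k D).toCoalgHom.comp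
    (Coalgebra.TensorProduct.map (counitCoalgHom k C) (CoalgHom.id k D))
  refine ⟨p z, q z, hz.map p, hz.map q, ?_⟩
  -- By the counit axioms (p ⊗ q) ∘ Δ is the identity of C ⊗ D. On a group-like z it also takes the
  -- value p(z) ⊗ q(z).
  have hpq : TensorProduct.map p.toLinearMap q.toLinearMap ∘ₗ comul = LinearMap.id := by
    refine TensorProduct.ext' fun c d => ?_
    have hp (c : C) (d : D) : p (c ⊗ₜ d) = counit (R := k) d • c := by
      simp [p]
    have hq (c : C) (d : D) : q (c ⊗ₜ d) = counit (R := k) c • d := by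
      simp [q]
    have e1 : ∑ j ∈ (ℛ k d).index, counit (R := k) ((ℛ k d).left j) • (ℛ k d).right j = d :=
      sum_counit_smul _
    have e2 : ∑ i ∈ (ℛ k c).index, counit (R := k) ((ℛ k c).right i) • (ℛ k c).left i = c := by
      simpa only [map_sum, TensorProduct.rid_tmul, one_smul] using
        congr(TensorProduct.rid k C $(sum_tmul_counit_eq (R := k) (ℛ k c)))
    rw [LinearMap.comp_apply, ← ((ℛ k c).tmul' (ℛ k d)).eq, map_sum]
    change ∑ i ∈ (ℛ k c).index ×ˢ (ℛ k d).index, p ((ℛ k c).left i.1 ⊗ₜ (ℛ k d).left i.2) ⊗ₜ[k]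
      q ((ℛ k c).right i.1 ⊗ₜ (ℛ k d).right i.2) = c ⊗ₜ d
    rw [Finset.sum_product]
    conv_rhs => rw [← e1, ← e2]
    simp only [hp, hq, TensorProduct.sum_tmul, TensorProduct.tmul_sum, TensorProduct.smul_tmul',
      TensorProduct.tmul_smul, smul_smul, Finset.smul_sum]
    rw [Finset.sum_comm]
    simp only [mul_comm]
  have h := congr($hpq z)
  rw [LinearMap.comp_apply, hz.comul_eq_tmul_self] at h
  exact h.symm

end GroupLike

/-! ### The group algebra of the cyclic group of order two -/

lemma Cyc.two_cases (h : Cyc 2) : h = 1 ∨ h = Cyc.gen 2 := by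
  revert h
  decide

namespace kC

variable (k : Type u) [Field k]

/-- The generator of `k[C_2]`. -/
def gen : kC k 2 := MonoidAlgebra.of k (Cyc 2) (Cyc.gen 2)

lemma gen_mul_gen : gen k * gen k = 1 := by
  rw [gen, ← map_mul, ← sq, Cyc.gen_pow, map_one]

lemma isGroupLikeElem_gen : IsGroupLikeElem k (gen k) := MonoidAlgebra.isGroupLikeElem_of _

lemma isGroupLikeElem_iff {h : kC k 2} : IsGroupLikeElem k h ↔ h = 1 ∨ h = gen k := by
  constructor
  · intro hh
    obtain ⟨y, rfl⟩ := MonoidAlgebra.isGroupLikeElem_iff_mem_range_of.1 hh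
    rcases Cyc.two_cases y with rfl | rfl
    · exact .inl (map_one _)
    · exact .inr rfl
  · rintro (rfl | rfl)
    · exact .one
    · exact isGroupLikeElem_gen k

variable {k}

lemma hom_ext {M : Type*} [AddCommGroup M] [Module k M] {f g : kC k 2 →ₗ[k] M}
    (h1 : f 1 = g 1) (h2 : f (gen k) = g (gen k)) : f = g := by
  refine MonoidAlgebra.lhom_ext' fun h => LinearMap.ext_ring ?_
  rcases Cyc.two_cases h with rfl | rfl
  · exact h1
  · exact h2

lemma tensor_ext {M A : Type*} [AddCommGroup M] [Module k M] [AddCommGroup A] [Module k A]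
    {f g : kC k 2 ⊗[k] A →ₗ[k] M} (h1 : ∀ a, f (1 ⊗ₜ a) = g (1 ⊗ₜ a))
    (h2 : ∀ a, f (gen k ⊗ₜ a) = g (gen k ⊗ₜ a)) : f = g :=
  TensorProduct.ext (hom_ext (LinearMap.ext h1) (LinearMap.ext h2))

/-- The hypothesis ranges over pairs of group-like elements instead of the four basis tensors, so
that a proof can expand convolutions uniformly before it splits into cases. -/
lemma tensor₂_ext {M : Type*} [AddCommGroup M] [Module k M] {f g : kC k 2 ⊗[k] kC k 2 →ₗ[k] M}
    (h : ∀ a b, IsGroupLikeElem k a → IsGroupLikeElem k b → f (a ⊗ₜ b) = g (a ⊗ₜ b)) : f = g :=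
  have h1 := IsGroupLikeElem.one
  have hg := isGroupLikeElem_gen k
  TensorProduct.ext <| hom_ext (hom_ext (h _ _ h1 h1) (h _ _ h1 hg))
    (hom_ext (h _ _ hg h1) (h _ _ hg hg))

lemma tensor₃_ext {M : Type*} [AddCommGroup M] [Module k M]
    {f g : (kC k 2 ⊗[k] kC k 2) ⊗[k] kC k 2 →ₗ[k] M}
    (h : ∀ a b c, IsGroupLikeElem k a → IsGroupLikeElem k b → IsGroupLikeElem k c →
      f ((a ⊗ₜ b) ⊗ₜ c) = g ((a ⊗ₜ b) ⊗ₜ c)) : f = g :=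
  TensorProduct.ext <| tensor₂_ext fun a b ha hb =>
    hom_ext (h a b _ ha hb .one) (h a b _ ha hb (isGroupLikeElem_gen k))

/-- The linear map from `k[C_2]` with given values at `1` and at the generator. -/
def constr {M : Type*} [AddCommGroup M] [Module k M] (m₀ m₁ : M) : kC k 2 →ₗ[k] M :=
  Finsupp.linearCombination k (fun h : Cyc 2 => if h = 1 then m₀ else m₁) ∘ₗ
    (MonoidAlgebra.coeffLinearEquiv k).toLinearMap

@[simp] lemma constr_one {M : Type*} [AddCommGroup M] [Module k M] (m₀ m₁ : M) :
    constr m₀ m₁ (1 : kC k 2) = m₀ := by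
  rw [MonoidAlgebra.one_def]
  simp [constr]

@[simp] lemma constr_gen {M : Type*} [AddCommGroup M] [Module k M] (m₀ m₁ : M) :
    constr m₀ m₁ (gen k) = m₁ := by
  have : Cyc.gen 2 ≠ 1 := by decide
  simp [constr, gen, MonoidAlgebra.of_apply, this]

lemma eq_add (h : kC k 2) : ∃ s t : k, h = s • 1 + t • gen k := by
  have : (LinearMap.id : kC k 2 →ₗ[k] kC k 2) =
      (constr (1 : k) 0).smulRight 1 + (constr (0 : k) 1).smulRight (gen k) := by
    refine hom_ext ?_ ?_ <;> simp
  exact ⟨_, _, congr($this h)⟩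

lemma finrank_eq : Module.finrank k (kC k 2) = 2 := by
  rw [(MonoidAlgebra.coeffLinearEquiv k).finrank_eq, Module.finrank_finsupp_self]
  rfl

end kC

/-! ### The pair (σ, u) of a crossed system over k[C_2], and cohomology in terms of it -/

namespace CrossedSystem

variable {k A : Type u} [Field k] [Ring A] [HopfAlgebra k A]

section Data

variable (s : CrossedSystem k A (kC k 2))

/-- The map `a ↦ c ▷ a`, where `c` is the generator of `k[C_2]`, as a linear map. -/
def genActLin : A →ₗ[k] A := TensorProduct.curry s.act.toLinearMap (kC.gen k)

lemma genActLin_apply (a : A) : s.genActLin a = s.act (kC.gen k ⊗ₜ a) := rfl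

/-- Since Δ(c) = c ⊗ c, only one Sweedler index survives in Δ(c ⊗ a), so compatibility of ▷ with Δ
makes c ▷ (-) itself a coalgebra map. -/
lemma comul_act_gen (a : A) : comul (R := k) (s.act (kC.gen k ⊗ₜ a)) =
    TensorProduct.map s.genActLin s.genActLin (comul a) := by
  have h1 := congr($(s.act.map_comp_comul) (kC.gen k ⊗ₜ a))
  rw [LinearMap.comp_apply, LinearMap.comp_apply,
    ← ((kC.isGroupLikeElem_gen k).repr.tmul' (ℛ k a)).eq, map_sum] at h1
  refine h1.symm.trans ?_
  rw [← (ℛ k a).eq, map_sum]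
  change ∑ i ∈ Finset.univ ×ˢ (ℛ k a).index, s.act (kC.gen k ⊗ₜ (ℛ k a).left i.2) ⊗ₜ[k]
    s.act (kC.gen k ⊗ₜ (ℛ k a).right i.2) = _
  rw [Finset.sum_product]
  simp [genActLin_apply]

lemma counit_act_gen (a : A) : counit (R := k) (s.act (kC.gen k ⊗ₜ a)) = counit (R := k) a := by
  rw [CoalgHomClass.counit_comp_apply, TensorProduct.counit_tmul,
    (kC.isGroupLikeElem_gen k).counit_eq_one, smul_eq_mul, mul_one]

lemma act_gen_mul (a b : A) : s.act (kC.gen k ⊗ₜ (a * b)) =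
    s.act (kC.gen k ⊗ₜ a) * s.act (kC.gen k ⊗ₜ b) :=
  (congr(($(s.act_mul a b)).ofConv (kC.gen k))).trans
    ((kC.isGroupLikeElem_gen k).convMul_apply _ _)

/-- The map `a ↦ c ▷ a`, where `c` is the generator of `k[C_2]`. -/
def genAct : A →ₐc[k] A where
  __ := s.genActLin
  counit_comp := LinearMap.ext s.counit_act_gen
  map_comp_comul := LinearMap.ext fun a => (s.comul_act_gen a).symm
  map_one' := by
    change s.act (kC.gen k ⊗ₜ 1) = 1
    rw [s.act_one, (kC.isGroupLikeElem_gen k).counit_eq_one, map_one]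
  map_mul' := s.act_gen_mul

/-- The element `f(c, c)`, where `c` is the generator of `k[C_2]`. -/
def genCocycle : A := s.cocycle (kC.gen k ⊗ₜ kC.gen k)

lemma isGroupLikeElem_genCocycle : IsGroupLikeElem k s.genCocycle :=
  ((kC.isGroupLikeElem_gen k).tmul (kC.isGroupLikeElem_gen k)).map s.cocycle

/-- The twisted module condition at c ⊗ c, where c² = 1 acts as the identity. It says that σ² is
conjugation by u. -/
lemma genAct_genAct (a : A) :
    s.genAct (s.genAct a) * s.genCocycle = s.genCocycle * a := by
  have hg := (kC.isGroupLikeElem_gen k).tmul (kC.isGroupLikeElem_gen k)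
  have h := congr(($(s.twisted a)).ofConv (kC.gen k ⊗ₜ kC.gen k))
  rw [hg.convMul_apply, hg.convMul_apply] at h
  refine h.trans (congrArg (s.genCocycle * ·) ?_)
  change s.act ((kC.gen k * kC.gen k) ⊗ₜ a) = a
  rw [kC.gen_mul_gen, s.one_act]

variable {s} in
/-- Crossed systems over `k[C_2]` are cohomologous if and only if the data that define them are
related by a group-like element. -/
lemma cohomologous_iff {s' : CrossedSystem k A (kC k 2)} : Cohomologous s s' ↔
    ∃ v : A, IsGroupLikeElem k v ∧ (∀ a, s'.genAct a * v = v * s.genAct a) ∧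
      s'.genCocycle = v * s.genAct v * s.genCocycle := by
  have hg := kC.isGroupLikeElem_gen k
  have hgg := hg.tmul hg
  have h1 : IsGroupLikeElem k (1 : kC k 2) := .one
  constructor
  · rintro ⟨r, hr, ha, hf⟩
    have hv := hg.map r
    -- A unitary r on k[C_2] carries no information beyond its value at c.
    refine ⟨r (kC.gen k), hv, fun a => ?_, ?_⟩
    · have := congr(($(ha a)).ofConv (kC.gen k))
      rw [hg.convMul_apply, hg.convMul_apply] at this
      have e : s'.genAct a = r (kC.gen k) * s.genAct a *
        HopfAlgebra.antipode k (r (kC.gen k)) := this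
      rw [e, mul_assoc, hv.antipode_mul_cancel, mul_one]
    · have := congr(($hf).ofConv (kC.gen k ⊗ₜ kC.gen k))
      rw [hgg.convMul_apply, hgg.convMul_apply, hgg.convMul_apply] at this
      refine this.trans ?_
      change tensorCounit _ r.toLinearMap (kC.gen k ⊗ₜ kC.gen k) * s.genAct (r (kC.gen k)) *
        s.genCocycle * HopfAlgebra.antipode k (r (kC.gen k * kC.gen k)) = _
      -- The antipode factor disappears at c ⊗ c, because r(c · c) = r(1) = 1.
      rw [kC.gen_mul_gen, hr.1, HopfAlgebra.antipode_one, mul_one, tensorCounit_tmul,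
        hg.counit_eq_one, one_smul]
      rfl
  · rintro ⟨v, hv, ha, hf⟩
    let r : kC k 2 →ₗc[k] A :=
      { kC.constr 1 v with
        counit_comp := kC.hom_ext (by simp) (by simp [hv.counit_eq_one, hg.counit_eq_one])
        map_comp_comul := kC.hom_ext (by simp [h1.comul_eq_tmul_self, Algebra.TensorProduct.one_def])
          (by simp [hv.comul_eq_tmul_self, hg.comul_eq_tmul_self]) }
    have r1 : r.toLinearMap 1 = 1 := kC.constr_one _ _
    have r1' : r 1 = 1 := r1
    have rg : r.toLinearMap (kC.gen k) = v := kC.constr_gen _ _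
    have rg' : r (kC.gen k) = v := rg
    -- Cocentrality of r is automatic, since k[C_2] is cocommutative.
    refine ⟨r, ⟨r1, fun h => by rw [comm_comul]⟩, fun a => WithConv.ext (kC.hom_ext ?_ ?_),
      WithConv.ext (kC.tensor₂_ext fun g h hg' hh => ?_)⟩
    · rw [h1.convMul_apply, h1.convMul_apply]
      simp [s.one_act, s'.one_act, r1']
    · rw [hg.convMul_apply, hg.convMul_apply]
      change s'.genAct a = r.toLinearMap (kC.gen k) * s.genAct a *
        HopfAlgebra.antipode k (r.toLinearMap (kC.gen k))
      rw [rg, ← ha, mul_assoc, hv.mul_antipode_cancel, mul_one]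
    · have hgh := hg'.tmul hh
      rw [hgh.convMul_apply, hgh.convMul_apply, hgh.convMul_apply]
      change s'.cocycle (g ⊗ₜ h) = tensorCounit _ r.toLinearMap (g ⊗ₜ h) *
        s.act (g ⊗ₜ r h) * s.cocycle (g ⊗ₜ h) * HopfAlgebra.antipode k (r (g * h))
      rw [tensorCounit_tmul, hh.counit_eq_one, one_smul]
      change s'.cocycle (g ⊗ₜ h) = r g *
        s.act (g ⊗ₜ r h) * s.cocycle (g ⊗ₜ h) * HopfAlgebra.antipode k (r (g * h))
      -- If one argument is 1, both cocycles are trivial and the identity reduces to r(h) S(r(h)) =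
      -- 1 for the other argument h. The hypothesis on v is needed only at c ⊗ c.
      rcases (kC.isGroupLikeElem_iff k).1 hg' with rfl | rfl
      · rw [s'.one_cocycle, s.one_cocycle, s.one_act, r1', one_mul, one_mul, hh.counit_eq_one,
          map_one, mul_one, (hh.map r).mul_antipode_cancel]
      rcases (kC.isGroupLikeElem_iff k).1 hh with rfl | rfl
      · rw [s'.cocycle_one, s.cocycle_one, r1', s.act_one, mul_one, hg.counit_eq_one,
          map_one, mul_one, mul_one, (hg.map r).mul_antipode_cancel]
      · rw [kC.gen_mul_gen, r1', HopfAlgebra.antipode_one, mul_one, rg']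
        exact hf

end Data

end CrossedSystem

/-! ### Crossed products with k[C_2] by generators, and recognition of extensions -/

namespace CrossedSystem

variable {k A : Type u} [Field k] [Ring A] [HopfAlgebra k A]

section Extension

variable (s : CrossedSystem k A (kC k 2))

namespace Product

/-- The element `1 # c`, where `c` is the generator of `k[C_2]`. -/
def gen : s.Product := sect s (kC.gen k)

lemma isGroupLikeElem_gen : IsGroupLikeElem k (gen s) := (kC.isGroupLikeElem_gen k).map (sect s)

/-- Together with `gen_mul_gen` this presents the crossed product over A: one new generator 1 # c,
which commutes past A up to σ and whose square is u. -/
lemma gen_mul_incl (b : A) : gen s * incl s b = incl s (s.genAct b) * gen s := by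
  rw [gen, ← of_eq, sect_apply, incl_apply, of_mul_of,
    s.Phi_tmul _ _ _ (kC.isGroupLikeElem_gen k).repr]
  simp only [IsGroupLikeElem.repr, Finset.univ_unique, Finset.sum_singleton]
  rw [Q_one_right, Algebra.TensorProduct.tmul_mul_tmul, Algebra.TensorProduct.tmul_mul_tmul]
  simp only [one_mul, mul_one]
  rfl

lemma gen_mul_gen : gen s * gen s = incl s s.genCocycle := by
  have hg := kC.isGroupLikeElem_gen k
  rw [gen, sect_mul_sect]
  refine ((hg.tmul hg).convMul_apply _ _).trans ?_
  change incl s s.genCocycle * sect s (kC.gen k * kC.gen k) = _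
  rw [kC.gen_mul_gen]
  exact mul_one _

lemma exists_eq (y : s.Product) : ∃ a b : A, y = incl s a + incl s b * gen s := by
  induction y using TensorProduct.induction_on with
  | zero => exact ⟨0, 0, by simp only [map_zero, zero_mul, add_zero]; rfl⟩
  | add y z hy hz =>
    obtain ⟨a, b, rfl⟩ := hy
    obtain ⟨a', b', rfl⟩ := hz
    refine ⟨a + a', b + b', ?_⟩
    simp only [map_add, add_mul]
    exact add_add_add_comm _ _ _ _
  | tmul a h =>
    obtain ⟨p, q, rfl⟩ := kC.eq_add h
    refine ⟨p • a, q • a, ?_⟩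
    change of s (a ⊗ₜ _) = _
    rw [of_eq, map_add, map_smul, map_smul, mul_add, mul_smul_comm, mul_smul_comm, map_smul,
      map_smul, smul_mul_assoc]
    congr 2
    exact mul_one _

/-- A and 1 # c generate the crossed product, as `exists_eq` shows. Compatibility with counit,
comultiplication and projection is later checked on these generators only. -/
lemma algHom_ext {B : Type*} [Ring B] [Algebra k B] {f g : s.Product →ₐ[k] B}
    (h1 : ∀ a, f (incl s a) = g (incl s a)) (h2 : f (gen s) = g (gen s)) : f = g := by
  refine AlgHom.ext fun y => ?_
  obtain ⟨a, b, rfl⟩ := exists_eq s y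
  rw [map_add, map_add, map_mul, map_mul, h1, h1, h2]

lemma proj_incl (a : A) : proj s (incl s a) = algebraMap k (kC k 2) (counit a) := by
  rw [incl_apply, proj_of, Algebra.algebraMap_eq_smul_one]

lemma proj_gen : proj s (gen s) = kC.gen k := by
  rw [gen, sect_apply, proj_of, Bialgebra.counit_one, one_smul]

/-- The multiplication rule on elements a + b d in any ring where d satisfies the relations of 1 #
c. It is used twice in `liftLin_mul`, once in the crossed product and once in the target, and the
two expansions correspond term by term. -/
lemma add_mul_gen_mul {R : Type*} [Ring R] {a b a' b' p q d u : R} (h1 : d * a' = p * d)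
    (h2 : d * b' = q * d) (h3 : d * d = u) :
    (a + b * d) * (a' + b' * d) = (a * a' + b * q * u) + (a * b' + b * p) * d :=
  calc _ = a * a' + b * (d * a') + (a * b' * d + b * (d * b') * d) := by
        simp only [add_mul, mul_add, mul_assoc]
    _ = _ := by
        rw [h1, h2, ← h3]
        simp only [add_mul, mul_assoc]
        abel

variable {E : Type u} [Ring E] [HopfAlgebra k E] (i : A →ₐc[k] E) (D : E)

/-- The linear map `a # h ↦ i(a) D ^ h`. -/
def liftLin : s.Product →ₗ[k] E :=
  TensorProduct.lift ((LinearMap.mul k E).compl₁₂ (i : A →ₗ[k] E) (kC.constr 1 D))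

lemma liftLin_incl (a : A) : liftLin s i D (incl s a) = i a := by
  change i a * kC.constr 1 D 1 = i a
  rw [kC.constr_one, mul_one]

lemma liftLin_incl_mul_gen (a : A) : liftLin s i D (incl s a * gen s) = i a * D := by
  rw [gen, ← of_eq]
  change i a * kC.constr 1 D (kC.gen k) = i a * D
  rw [kC.constr_gen]

lemma liftLin_mul (hD : ∀ a, D * i a = i (s.genAct a) * D) (hu : D * D = i s.genCocycle)
    (y z : s.Product) : liftLin s i D (y * z) = liftLin s i D y * liftLin s i D z := by
  obtain ⟨a, b, rfl⟩ := exists_eq s y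
  obtain ⟨a', b', rfl⟩ := exists_eq s z
  rw [add_mul_gen_mul (gen_mul_incl s a') (gen_mul_incl s b') (gen_mul_gen s)]
  simp only [← map_mul, ← map_add]
  simp only [map_add (liftLin s i D), liftLin_incl, liftLin_incl_mul_gen]
  simp only [map_add, map_mul]
  exact (add_mul_gen_mul (hD a') (hD b') hu).symm

variable {i D} in
/-- The map of Hopf algebras from the crossed product given by a map `i` on `A` and a group-like
element `D` that satisfy the relations of the crossed product. -/
def lift (hg : IsGroupLikeElem k D) (hD : ∀ a, D * i a = i (s.genAct a) * D)
    (hu : D * D = i s.genCocycle) : s.Product →ₐc[k] E :=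
  have h1 : liftLin s i D 1 = 1 := by
    rw [← map_one (incl s), liftLin_incl, map_one]
  have h2 : liftLin s i D (gen s) = D := by
    have := liftLin_incl_mul_gen s i D 1
    rwa [map_one, map_one, one_mul, one_mul] at this
  BialgHom.ofAlgHom (AlgHom.ofLinearMap (liftLin s i D) h1 (liftLin_mul s i D hD hu))
    (algHom_ext s
      (fun a => by
        change counit (R := k) (liftLin s i D (incl s a)) = counit (R := k) (incl s a)
        rw [liftLin_incl, CoalgHomClass.counit_comp_apply, CoalgHomClass.counit_comp_apply])
      (by
        change counit (R := k) (liftLin s i D (gen s)) = counit (R := k) (gen s)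
        rw [h2, hg.counit_eq_one, (isGroupLikeElem_gen s).counit_eq_one]))
    (algHom_ext s
      (fun a => by
        change TensorProduct.map (liftLin s i D) (liftLin s i D) (comul (incl s a)) =
          comul (R := k) (liftLin s i D (incl s a))
        rw [liftLin_incl, ← CoalgHomClass.map_comp_comul_apply,
          ← CoalgHomClass.map_comp_comul_apply, ← (ℛ k a).eq]
        simp only [map_sum, TensorProduct.map_tmul]
        refine Finset.sum_congr rfl fun j _ => ?_
        exact congrArg₂ (· ⊗ₜ[k] ·) (liftLin_incl s i D _) (liftLin_incl s i D _))
      (by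
        change TensorProduct.map (liftLin s i D) (liftLin s i D) (comul (gen s)) =
          comul (R := k) (liftLin s i D (gen s))
        rw [h2, hg.comul_eq_tmul_self, (isGroupLikeElem_gen s).comul_eq_tmul_self,
          TensorProduct.map_tmul, h2]))

end Product

open Product in
/-- A criterion for an extension to be equivalent to a crossed product with `k[C_2]`. -/
theorem isEquivTo_of_generator [FiniteDimensional k A] {E : Type u} [Ring E] [HopfAlgebra k E]
    (i : A →ₐc[k] E) (π : E →ₐc[k] kC k 2) (D : E) (hg : IsGroupLikeElem k D)
    (hD : ∀ a, D * i a = i (s.genAct a) * D) (hu : D * D = i s.genCocycle)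
    (hi : ∀ a, π (i a) = algebraMap k (kC k 2) (counit a)) (hπ : π D = kC.gen k)
    (hdim : Module.finrank k E = Module.finrank k A * 2)
    (hsurj : ∀ y : E, ∃ a b : A, i a + i b * D = y) : s.IsEquivTo i π := by
  have h2 : liftLin s i D (gen s) = D := by
    have := liftLin_incl_mul_gen s i D 1
    rwa [map_one, map_one, one_mul, one_mul] at this
  have : FiniteDimensional k (kC k 2) := .of_finrank_pos (by rw [kC.finrank_eq]; norm_num)
  have : FiniteDimensional k s.Product := inferInstanceAs (FiniteDimensional k (A ⊗[k] kC k 2))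
  -- Bijectivity comes from a dimension count: the map a # h ↦ i(a) D^h is surjective by assumption,
  -- between spaces of the same finite dimension.
  have hfin : Module.finrank k s.Product = Module.finrank k E := by
    refine (Module.finrank_tensorProduct (R := k) (S := k) (M := A) (M' := kC k 2)).trans ?_
    rw [hdim, kC.finrank_eq]
  have hs : Function.Surjective (liftLin s i D) := by
    intro y
    obtain ⟨a, b, rfl⟩ := hsurj y
    exact ⟨incl s a + incl s b * gen s, by rw [map_add, liftLin_incl, liftLin_incl_mul_gen]⟩
  have hE : FiniteDimensional k E := Module.Finite.of_surjective _ hs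
  have hb : Function.Bijective (lift s hg hD hu) :=
    ⟨(LinearMap.injective_iff_surjective_of_finrank_eq_finrank hfin).2 hs, hs⟩
  refine ⟨BialgEquiv.ofBijective _ hb, liftLin_incl s i D, fun y => ?_⟩
  -- Both sides of π ψ = proj are algebra maps, so A and 1 # c suffice. There, agreement is the
  -- hypotheses on π ∘ i and π(D).
  have : ((π : E →ₐ[k] kC k 2).comp (lift s hg hD hu : s.Product →ₐ[k] E)) =
      (proj s : s.Product →ₐ[k] kC k 2) := by
    refine algHom_ext s (fun a => ?_) ?_
    · change π (liftLin s i D (incl s a)) = proj s (incl s a)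
      rw [liftLin_incl, hi, proj_incl]
    · change π (liftLin s i D (gen s)) = proj s (gen s)
      rw [h2, hπ, proj_gen]
  exact congr($this y)

end Extension

end CrossedSystem

/-! ### Construction of a crossed system from a pair (σ, u) -/

namespace CrossedSystem

variable {k A : Type u} [Field k] [Ring A] [HopfAlgebra k A]

section OfGen

variable (σ : A →ₐc[k] A) (u : A)

/-- The linear map `1 ⊗ a ↦ a`, `c ⊗ a ↦ σ(a)`. -/
def actLin : kC k 2 ⊗[k] A →ₗ[k] A :=
  TensorProduct.lift (kC.constr LinearMap.id (σ : A →ₗ[k] A))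

@[simp] lemma actLin_one (a : A) : actLin σ (1 ⊗ₜ a) = a := by simp [actLin]
@[simp] lemma actLin_gen (a : A) : actLin σ (kC.gen k ⊗ₜ a) = σ a := by simp [actLin]

/-- For a group-like element `h` of `k[C_2]`, the map `a ↦ h ▷ a` of Hopf algebras. -/
lemma exists_actLin_eq {h : kC k 2} (hh : IsGroupLikeElem k h) :
    ∃ φ : A →ₐc[k] A, ∀ a, actLin σ (h ⊗ₜ a) = φ a := by
  rcases (kC.isGroupLikeElem_iff k).1 hh with rfl | rfl
  · exact ⟨.id k A, actLin_one σ⟩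
  · exact ⟨σ, actLin_gen σ⟩

/-- The linear map with values `1`, `1`, `1` and `u` at `1 ⊗ 1`, `1 ⊗ c`, `c ⊗ 1` and `c ⊗ c`. -/
def cocycleLin : kC k 2 ⊗[k] kC k 2 →ₗ[k] A :=
  TensorProduct.lift (kC.constr (kC.constr 1 1) (kC.constr 1 u))

@[simp] lemma cocycleLin_one_left {h : kC k 2} (hh : IsGroupLikeElem k h) :
    cocycleLin u (1 ⊗ₜ h) = 1 := by
  rcases (kC.isGroupLikeElem_iff k).1 hh with rfl | rfl <;> simp [cocycleLin]
@[simp] lemma cocycleLin_one_right {h : kC k 2} (hh : IsGroupLikeElem k h) :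
    cocycleLin u (h ⊗ₜ 1) = 1 := by
  rcases (kC.isGroupLikeElem_iff k).1 hh with rfl | rfl <;> simp [cocycleLin]
@[simp] lemma cocycleLin_gen : cocycleLin u (kC.gen k ⊗ₜ kC.gen k) = u := by simp [cocycleLin]

variable {u} in
lemma isGroupLikeElem_cocycleLin (hu : IsGroupLikeElem k u) {g h : kC k 2}
    (hg : IsGroupLikeElem k g) (hh : IsGroupLikeElem k h) :
    IsGroupLikeElem k (cocycleLin u (g ⊗ₜ h)) := by
  rcases (kC.isGroupLikeElem_iff k).1 hg with rfl | rfl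
  · rw [cocycleLin_one_left u hh]; exact .one
  rcases (kC.isGroupLikeElem_iff k).1 hh with rfl | rfl
  · rw [cocycleLin_one_right u hg]; exact .one
  · rwa [cocycleLin_gen]

/-- The map `h ⊗ a ↦ h ▷ a` of coalgebras for which `c` acts by `σ`. -/
def actHom : kC k 2 ⊗[k] A →ₗc[k] A :=
    { actLin σ with
      counit_comp := by
        have h (h : kC k 2) (hh : IsGroupLikeElem k h) (a : A) :
            counit (R := k) (actLin σ (h ⊗ₜ a)) = counit (R := k) (h ⊗ₜ[k] a) := by
          -- Each group-like element acts by a Hopf algebra map, the identity or σ, so the cases h =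
          -- 1 and h = c need no separate treatment.
          obtain ⟨φ, hφ⟩ := exists_actLin_eq σ hh
          rw [hφ, CoalgHomClass.counit_comp_apply, TensorProduct.counit_tmul, hh.counit_eq_one,
            smul_eq_mul, mul_one]
        exact kC.tensor_ext (h 1 .one) (h _ (kC.isGroupLikeElem_gen k))
      map_comp_comul := by
        have h (h : kC k 2) (hh : IsGroupLikeElem k h) (a : A) :
            TensorProduct.map (actLin σ) (actLin σ) (comul (h ⊗ₜ[k] a)) =
              comul (R := k) (actLin σ (h ⊗ₜ a)) := by
          obtain ⟨φ, hφ⟩ := exists_actLin_eq σ hh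
          rw [hφ, ← CoalgHomClass.map_comp_comul_apply, ← (hh.repr.tmul' (ℛ k a)).eq,
            ← (ℛ k a).eq, map_sum, map_sum]
          change ∑ i ∈ Finset.univ ×ˢ (ℛ k a).index, actLin σ (h ⊗ₜ (ℛ k a).left i.2) ⊗ₜ[k]
            actLin σ (h ⊗ₜ (ℛ k a).right i.2) = _
          rw [Finset.sum_product]
          simp [hφ]
        exact kC.tensor_ext (h 1 .one) (h _ (kC.isGroupLikeElem_gen k)) }

variable {u} in
/-- The map of coalgebras with values `1`, `1`, `1` and `u` at `1 ⊗ 1`, `1 ⊗ c`, `c ⊗ 1` and `c ⊗ c`. -/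
def cocycleHom (hu : IsGroupLikeElem k u) : kC k 2 ⊗[k] kC k 2 →ₗc[k] A :=
    { cocycleLin u with
      counit_comp := kC.tensor₂_ext fun g h hg hh => by
        change counit (R := k) (cocycleLin u (g ⊗ₜ h)) = counit (R := k) (g ⊗ₜ[k] h)
        rw [(isGroupLikeElem_cocycleLin hu hg hh).counit_eq_one, (hg.tmul hh).counit_eq_one]
      map_comp_comul := kC.tensor₂_ext fun g h hg hh => by
        change TensorProduct.map (cocycleLin u) (cocycleLin u) (comul (g ⊗ₜ[k] h)) =
          comul (R := k) (cocycleLin u (g ⊗ₜ h))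
        rw [(isGroupLikeElem_cocycleLin hu hg hh).comul_eq_tmul_self,
          (hg.tmul hh).comul_eq_tmul_self, TensorProduct.map_tmul] }

/-- The crossed system over `k[C_2]` given by a map `σ` of Hopf algebras and a group-like element
`u`, where the generator `c` acts by `σ` and `f(c, c) = u`. -/
def ofGen (hu : IsGroupLikeElem k u) (hσu : σ u = u) (hσ : ∀ a, σ (σ a) * u = u * a) :
    CrossedSystem k A (kC k 2) where
  act := actHom σ
  cocycle := cocycleHom hu
  one_act := actLin_one σ
  act_one h := by
    have e : (actLin σ ∘ₗ (TensorProduct.mk k (kC k 2) A).flip 1) =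
        Algebra.linearMap k A ∘ₗ counit := by
      refine kC.hom_ext ?_ ?_
      · simp
      · simp [(kC.isGroupLikeElem_gen k).counit_eq_one]
    exact congr($e h)
  act_mul a b := WithConv.ext <| by
    have h (h : kC k 2) (hh : IsGroupLikeElem k h) :
        actLin σ (h ⊗ₜ (a * b)) = actLin σ (h ⊗ₜ a) * actLin σ (h ⊗ₜ b) := by
      obtain ⟨φ, hφ⟩ := exists_actLin_eq σ hh
      rw [hφ, hφ, hφ, map_mul]
    have hg := kC.isGroupLikeElem_gen k
    refine kC.hom_ext (Eq.trans ?_ (IsGroupLikeElem.one.convMul_apply _ _).symm)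
      (Eq.trans ?_ (hg.convMul_apply _ _).symm)
    · exact h _ .one
    · exact h _ hg
  cocycle_one h := by
    have e : (cocycleLin u ∘ₗ (TensorProduct.mk k (kC k 2) (kC k 2)).flip 1) =
        Algebra.linearMap k A ∘ₗ counit := by
      have hg := kC.isGroupLikeElem_gen k
      have h1 : IsGroupLikeElem k (1 : kC k 2) := .one
      refine kC.hom_ext ?_ ?_
      · simp [h1]
      · simp [hg, hg.counit_eq_one]
    exact congr($e h)
  one_cocycle h := by
    have e : (cocycleLin u ∘ₗ (TensorProduct.mk k (kC k 2) (kC k 2)) 1) =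
        Algebra.linearMap k A ∘ₗ counit := by
      have hg := kC.isGroupLikeElem_gen k
      have h1 : IsGroupLikeElem k (1 : kC k 2) := .one
      refine kC.hom_ext ?_ ?_
      · simp [h1]
      · simp [hg, hg.counit_eq_one]
    exact congr($e h)
  twisted a := WithConv.ext <| kC.tensor₂_ext fun g h hg hh => by
    have hgh := hg.tmul hh
    rw [hgh.convMul_apply, hgh.convMul_apply]
    change actLin σ (g ⊗ₜ actLin σ (h ⊗ₜ a)) * cocycleLin u (g ⊗ₜ h) =
      cocycleLin u (g ⊗ₜ h) * actLin σ ((g * h) ⊗ₜ a)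
    -- The condition has content only at c ⊗ c, where it is the hypothesis σ²(a) u = u a.
    rcases (kC.isGroupLikeElem_iff k).1 hg with rfl | rfl
    · rw [cocycleLin_one_left u hh, actLin_one, one_mul, one_mul, mul_one]
    rcases (kC.isGroupLikeElem_iff k).1 hh with rfl | rfl
    · rw [cocycleLin_one_right u hg, actLin_one, one_mul, mul_one, mul_one]
    · rw [kC.gen_mul_gen, cocycleLin_gen, actLin_gen, actLin_gen, actLin_one, hσ]
  cocycle_cond := WithConv.ext <| kC.tensor₃_ext fun g h l hg hh hl => by
    have hghl := (hg.tmul hh).tmul hl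
    rw [hghl.convMul_apply, hghl.convMul_apply]
    change actLin σ (g ⊗ₜ cocycleLin u (h ⊗ₜ l)) * cocycleLin u (g ⊗ₜ (h * l)) =
      tensorCounit (kC k 2) (cocycleLin u) ((g ⊗ₜ h) ⊗ₜ l) * cocycleLin u ((g * h) ⊗ₜ l)
    rw [tensorCounit_tmul, hl.counit_eq_one, one_smul]
    have hσ1 : actLin σ (g ⊗ₜ 1) = 1 := by
      obtain ⟨φ, hφ⟩ := exists_actLin_eq σ hg
      rw [hφ, map_one]
    -- If any of the three arguments is 1, normalization makes the two sides equal. At c ⊗ c ⊗ c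
    -- they are σ(u) and u.
    rcases (kC.isGroupLikeElem_iff k).1 hg with rfl | rfl
    · rw [cocycleLin_one_left u hh, cocycleLin_one_left u (hh.mul hl), actLin_one, one_mul, one_mul,
        mul_one]
    rcases (kC.isGroupLikeElem_iff k).1 hh with rfl | rfl
    · rw [cocycleLin_one_left u hl, cocycleLin_one_right u hg, one_mul, hσ1, mul_one]
    rcases (kC.isGroupLikeElem_iff k).1 hl with rfl | rfl
    · rw [cocycleLin_one_right u hg, cocycleLin_one_right u (hg.mul hg), hσ1, mul_one, one_mul,
        mul_one]
    · rw [kC.gen_mul_gen, cocycleLin_gen, cocycleLin_one_right u hg, cocycleLin_one_left u hg,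
        actLin_gen, hσu]
  -- This condition and the next compare Δ with its flip, so cocommutativity of k[C_2] gives them.
  act_comm g a := by rw [comm_comul]
  cocycle_comm y := by
    rw [comm_comul]

variable {σ u} (hu : IsGroupLikeElem k u) (hσu : σ u = u) (hσ : ∀ a, σ (σ a) * u = u * a)

lemma genCocycle_ofGen : (ofGen σ u hu hσu hσ).genCocycle = u := cocycleLin_gen u

end OfGen

end CrossedSystem

/-! ### Group-like elements and endomorphisms of Sweedler's Hopf algebra -/

namespace H4

variable {k : Type u} [Field k]

variable (k) in
lemma g_mul_g : g k * g k = 1 := by rw [← sq, g_sq]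

variable (k) in
lemma g_mul_x : g k * x k = -(x k * g k) := by rw [x_mul_g, neg_neg]

variable (k) in
lemma isGroupLikeElem_g : IsGroupLikeElem k (g k) := ⟨counit_g k, comul_g k⟩

variable (k) in
lemma finrank_eq : Module.finrank k (H4 k) = 4 := by
  obtain ⟨b, -⟩ := exists_basis k
  rw [Module.finrank_eq_card_basis b, Fintype.card_fin]

instance : FiniteDimensional k (H4 k) := .of_finrank_pos (by rw [finrank_eq]; norm_num)

lemma lhom_ext {M : Type*} [AddCommGroup M] [Module k M] {f f' : H4 k →ₗ[k] M}
    (h1 : f 1 = f' 1) (hg : f (g k) = f' (g k)) (hx : f (x k) = f' (x k))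
    (hgx : f (g k * x k) = f' (g k * x k)) : f = f' := by
  obtain ⟨b, hb⟩ := exists_basis k
  refine b.ext fun i => ?_
  rw [hb]
  fin_cases i
  exacts [h1, hg, hx, hgx]

/-- Coordinates with respect to the basis `1, g, x, g x`. -/
lemma exists_coords (y : H4 k) :
    ∃ p q r s : k, y = p • 1 + q • g k + r • x k + s • (g k * x k) := by
  obtain ⟨b, hb⟩ := exists_basis k
  refine ⟨b.repr y 0, b.repr y 1, b.repr y 2, b.repr y 3, ?_⟩
  have := (b.sum_repr y).symm
  rw [Fin.sum_univ_four, hb] at this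
  exact this

/-- An intertwining relation on `H4` can be checked on the generators. -/
lemma intertwine {E : Type*} [Ring E] [Algebra k E] {i j : H4 k →ₐ[k] E} {D : E}
    (hg : D * i (g k) = j (g k) * D) (hx : D * i (x k) = j (x k) * D) (a : H4 k) :
    D * i a = j a * D := by
  have : LinearMap.mulLeft k D ∘ₗ i.toLinearMap = LinearMap.mulRight k D ∘ₗ j.toLinearMap := by
    refine lhom_ext ?_ hg hx ?_
    · simp
    · change D * i (g k * x k) = j (g k * x k) * D
      rw [map_mul, map_mul, ← mul_assoc, hg, mul_assoc, hx, mul_assoc]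
  exact congr($this a)

/-- The coordinates of a tensor in `H4 ⊗ H4`. -/
lemma exists_tensor_coords : ∃ F : Fin 4 → Fin 4 → H4 k ⊗[k] H4 k →ₗ[k] k,
    ∀ i j p q r s p' q' r' s', F i j ((p • 1 + q • g k + r • x k + s • (g k * x k)) ⊗ₜ
      (p' • 1 + q' • g k + r' • x k + s' • (g k * x k))) =
        ![p, q, r, s] i * ![p', q', r', s'] j := by
  obtain ⟨b, hb⟩ := exists_basis k
  -- F i j is the product of the i-th and j-th coordinate functionals for the basis 1, g, x, g x,
  -- and it reads off the coefficient of the (i, j)-th basis tensor.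
  have hc (i) (p q r s : k) :
      b.coord i (p • 1 + q • g k + r • x k + s • (g k * x k)) = ![p, q, r, s] i := by
    have : p • 1 + q • g k + r • x k + s • (g k * x k) = ∑ j, ![p, q, r, s] j • b j := by
      rw [Fin.sum_univ_four, hb]
      rfl
    rw [this, Module.Basis.coord_apply, b.repr_sum_self]
  refine ⟨fun i j => LinearMap.mul' k k ∘ₗ TensorProduct.map (b.coord i) (b.coord j),
    fun i j p q r s p' q' r' s' => ?_⟩
  rw [LinearMap.comp_apply, TensorProduct.map_tmul, hc, hc, LinearMap.mul'_apply]

lemma comul_coords (p q r s : k) :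
    comul (R := k) (p • 1 + q • g k + r • x k + s • (g k * x k)) =
      p • ((1 : H4 k) ⊗ₜ[k] (1 : H4 k)) + q • (g k ⊗ₜ[k] g k) +
        r • (x k ⊗ₜ[k] 1 + g k ⊗ₜ[k] x k) +
        s • ((g k * x k) ⊗ₜ[k] g k + 1 ⊗ₜ[k] (g k * x k)) := by
  simp only [map_add, map_smul, Bialgebra.comul_mul, Bialgebra.comul_one, comul_g, comul_x,
    mul_add, Algebra.TensorProduct.tmul_mul_tmul, mul_one, g_mul_g]
  rfl

/-- The coordinates of the comultiplication. -/
lemma exists_comul_coords : ∃ F : Fin 4 → Fin 4 → H4 k ⊗[k] H4 k →ₗ[k] k,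
    (∀ i j p q r s p' q' r' s', F i j ((p • 1 + q • g k + r • x k + s • (g k * x k)) ⊗ₜ
      (p' • 1 + q' • g k + r' • x k + s' • (g k * x k))) =
        ![p, q, r, s] i * ![p', q', r', s'] j) ∧
    ∀ i j p q r s, F i j (comul (R := k) (p • 1 + q • g k + r • x k + s • (g k * x k))) =
      !![p, 0, 0, s; 0, q, r, 0; r, 0, 0, 0; 0, s, 0, 0] i j := by
  obtain ⟨F, hF⟩ := exists_tensor_coords (k := k)
  refine ⟨F, hF, fun i j p q r s => ?_⟩
  have e1 : (1 : H4 k) = (1 : k) • 1 + (0 : k) • g k + (0 : k) • x k + (0 : k) • (g k * x k) := by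
    simp
  have eg : g k = (0 : k) • 1 + (1 : k) • g k + (0 : k) • x k + (0 : k) • (g k * x k) := by simp
  have ex : x k = (0 : k) • 1 + (0 : k) • g k + (1 : k) • x k + (0 : k) • (g k * x k) := by simp
  have egx : g k * x k = (0 : k) • 1 + (0 : k) • g k + (0 : k) • x k + (1 : k) • (g k * x k) := by
    simp
  -- These are the coefficients of the six basis tensors that occur in `comul_coords`, in the order
  -- 1 ⊗ 1, g ⊗ g, x ⊗ 1, g ⊗ x, g x ⊗ g and 1 ⊗ g x.
  have h11 := hF i j 1 0 0 0 1 0 0 0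
  have hgg := hF i j 0 1 0 0 0 1 0 0
  have hx1 := hF i j 0 0 1 0 1 0 0 0
  have hgx := hF i j 0 1 0 0 0 0 1 0
  have hyg := hF i j 0 0 0 1 0 1 0 0
  have h1y := hF i j 1 0 0 0 0 0 0 1
  rw [← e1] at h11
  rw [← eg] at hgg
  rw [← ex, ← e1] at hx1
  rw [← ex, ← eg] at hgx
  rw [← egx, ← eg] at hyg
  rw [← egx, ← e1] at h1y
  rw [comul_coords]
  simp only [map_add, map_smul, h11, hgg, hx1, hgx, hyg, h1y]
  fin_cases i <;> fin_cases j <;> simp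

/-- Comparing coefficients in Δ(y) = y ⊗ y gives quadratic equations for the coordinates. Three of
them and ε(y) = 1 leave only 1 and g. -/
lemma isGroupLikeElem_iff {y : H4 k} : IsGroupLikeElem k y ↔ y = 1 ∨ y = g k := by
  constructor
  · intro hy
    obtain ⟨F, hF, hF'⟩ := exists_comul_coords (k := k)
    obtain ⟨p, q, r, s, rfl⟩ := exists_coords y
    have h (i j) := hF' i j p q r s
    rw [hy.comul_eq_tmul_self] at h
    -- The coefficients of 1 ⊗ g, x ⊗ x and g x ⊗ g x vanish in Δ(y), so p q = 0, r² = 0 and s² = 0.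
    -- The counit then gives p + q = 1.
    have h01 := h 0 1
    have h22 := h 2 2
    have h33 := h 3 3
    simp [hF] at h01 h22 h33
    subst h22 h33
    have he := hy.counit_eq_one
    simp [counit_g] at he
    rcases h01 with rfl | rfl
    · right
      rw [zero_add] at he
      simp [he]
    · left
      rw [add_zero] at he
      simp [he]
  · rintro (rfl | rfl)
    · exact .one
    · exact isGroupLikeElem_g k

/-- Used to read off α² from an equation between multiples of x g, which is a nonzero element. -/
lemma smul_x_mul_g_injective : Function.Injective fun c : k => c • (x k * g k) := by
  obtain ⟨b, hb⟩ := exists_basis k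
  have : x k * g k = -b 3 := by rw [hb, x_mul_g]; rfl
  simp only [this]
  exact smul_left_injective k (neg_ne_zero.2 (b.ne_zero 3))

variable (k) in
lemma one_ne_g : (1 : H4 k) ≠ g k := by
  obtain ⟨b, hb⟩ := exists_basis k
  have h0 : b 0 = 1 := by rw [hb]; rfl
  have h1 : b 1 = g k := by rw [hb]; rfl
  rw [← h0, ← h1]
  exact b.injective.ne (by decide)

/-- The image of g is group-like, hence 1 or g, and injectivity excludes 1. -/
lemma injective_endo_g {σ : H4 k →ₐc[k] H4 k} (hσ : Function.Injective σ) : σ (g k) = g k := by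
  rcases isGroupLikeElem_iff.1 ((isGroupLikeElem_g k).map σ) with h | h
  · exact absurd (hσ ((map_one σ).trans h.symm)) (one_ne_g k)
  · exact h

/-- Two constraints cut σ(x) = p + q g + r x + s g x down to r x: skew primitivity with respect to g
gives s = 0, and anticommutation with g gives 2p = 2q = 0. The scalar may be zero at this stage. -/
lemma endo_x (hk : (2 : k) ≠ 0) {σ : H4 k →ₐc[k] H4 k} (hg : σ (g k) = g k) :
    ∃ α : k, σ (x k) = α • x k := by
  obtain ⟨F, hF, hF'⟩ := exists_comul_coords (k := k)
  have hc := CoalgHomClass.map_comp_comul_apply σ (x k)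
  have hm := congrArg σ (x_mul_g k)
  rw [map_neg, map_mul, map_mul, hg] at hm
  rw [comul_x, map_add, TensorProduct.map_tmul, TensorProduct.map_tmul] at hc
  change σ (x k) ⊗ₜ σ 1 + σ (g k) ⊗ₜ σ (x k) = _ at hc
  rw [map_one, hg] at hc
  obtain ⟨p, q, r, s, h⟩ := exists_coords (σ (x k))
  rw [h] at hc hm
  have e1 : (1 : H4 k) = (1 : k) • 1 + (0 : k) • g k + (0 : k) • x k + (0 : k) • (g k * x k) := by
    simp
  have eg : g k = (0 : k) • 1 + (1 : k) • g k + (0 : k) • x k + (0 : k) • (g k * x k) := by simp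
  -- The coefficient of g x ⊗ g is s in Δ(σ(x)) and 0 in σ(x) ⊗ 1 + g ⊗ σ(x).
  have h31 := congrArg (F 3 1) hc
  have a1 := hF 3 1 p q r s 1 0 0 0
  have a2 := hF 3 1 0 1 0 0 p q r s
  rw [← e1] at a1
  rw [← eg] at a2
  rw [map_add, hF', a1, a2] at h31
  simp at h31
  subst h31
  -- This is σ(x) g + g σ(x) = 0 with s = 0. The r-terms cancel, because x itself anticommutes with
  -- g.
  have hm' : (2 * q) • (1 : H4 k) + (2 * p) • g k = 0 := by
    simp only [add_mul, mul_add, smul_mul_assoc, mul_smul_comm, one_mul, mul_one, x_mul_g, g_mul_g,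
      zero_smul, add_zero] at hm
    rw [← sub_eq_zero] at hm
    rw [← hm]
    module
  obtain ⟨b, hb⟩ := exists_basis k
  have h0 : b 0 = 1 := by rw [hb]; rfl
  have h1 : b 1 = g k := by rw [hb]; rfl
  rw [← h0, ← h1] at hm'
  have c0 := congrArg (fun y => b.repr y 0) hm'
  have c1 := congrArg (fun y => b.repr y 1) hm'
  simp [hk] at c0 c1
  exact ⟨r, by rw [h, c0, c1]; simp⟩

/-- The algebra map `g ↦ g`, `x ↦ α x`. -/
def scaleAlg (α : k) : H4 k →ₐ[k] H4 k :=
  Bosonization.lift (datum4 k) (Bosonization.grp (datum4 k)) (α • x k)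
    (by rw [smul_mul_smul_comm, x, Bosonization.x_mul_x, smul_zero])
    (fun h => by rw [mul_smul_comm, smul_mul_assoc, x, Bosonization.grp_mul_x, smul_comm])

lemma scaleAlg_grp (α : k) (h : Cyc 2) :
    scaleAlg α (Bosonization.grp (datum4 k) h) = Bosonization.grp (datum4 k) h := by
  rw [scaleAlg, Bosonization.lift_grp]

lemma scaleAlg_x (α : k) : scaleAlg α (Bosonization.x (datum4 k)) = α • x k := by
  rw [scaleAlg, Bosonization.lift_x]

/-- The map of Hopf algebras `g ↦ g`, `x ↦ α x`. -/
def scale (α : k) : H4 k →ₐc[k] H4 k :=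
  BialgHom.ofAlgHom (scaleAlg α)
    (Bosonization.algHom_ext (fun h => by simp [scaleAlg_grp])
      (by simp [scaleAlg_x, x, Bosonization.counit_x]))
    (Bosonization.algHom_ext (fun h => by simp [scaleAlg_grp, Bosonization.comul_grp])
      (by simp [scaleAlg_x, x, scaleAlg_grp, Bosonization.comul_x, TensorProduct.smul_tmul']))

lemma scale_g (α : k) : scale α (g k) = g k := scaleAlg_grp α _
lemma scale_x (α : k) : scale α (x k) = α • x k := scaleAlg_x α

end H4

/-! ### Classification by the value f(c, c), and the two families of extensions -/

section Classification

variable {k : Type u} [Field k]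

namespace CrossedSystem

variable (s : CrossedSystem k (H4 k) (kC k 2))

/-- The relation σ²(a) u = u a makes σ injective: σ(a) = σ(b) gives u a = u b, and the group-like
element u is invertible. -/
lemma genAct_g : s.genAct (H4.g k) = H4.g k := by
  refine H4.injective_endo_g fun a b hab => ?_
  have h := (s.genAct_genAct a).symm.trans
    ((congrArg (fun c => s.genAct c * s.genCocycle) hab).trans (s.genAct_genAct b))
  exact s.isGroupLikeElem_genCocycle.isUnit.mul_left_cancel h

/-- The action of the generator scales `x`, by a square root of `1` or of `-1` according to the
value of the cocycle. -/
lemma exists_genAct_x (hk : (2 : k) ≠ 0) : ∃ α : k, s.genAct (H4.x k) = α • H4.x k ∧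
    (s.genCocycle = 1 ∧ α ^ 2 = 1 ∨ s.genCocycle = H4.g k ∧ α ^ 2 = -1) := by
  obtain ⟨α, hα⟩ := H4.endo_x hk s.genAct_g
  refine ⟨α, hα, ?_⟩
  have h := s.genAct_genAct (H4.x k)
  rw [hα, map_smul, hα, smul_smul, ← sq] at h
  rcases H4.isGroupLikeElem_iff.1 s.isGroupLikeElem_genCocycle with hu | hu
  · left
    rw [hu, mul_one, one_mul] at h
    refine ⟨hu, H4.smul_x_mul_g_injective ?_⟩
    change α ^ 2 • (H4.x k * H4.g k) = (1 : k) • (H4.x k * H4.g k)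
    rw [← smul_mul_assoc, h, one_smul]
  · right
    rw [hu, H4.g_mul_x] at h
    refine ⟨hu, H4.smul_x_mul_g_injective ?_⟩
    change α ^ 2 • (H4.x k * H4.g k) = (-1 : k) • (H4.x k * H4.g k)
    rw [← smul_mul_assoc, h, neg_one_smul]

variable {s} in
/-- The value of the cocycle at the generator classifies crossed systems. -/
theorem cohomologous_iff_genCocycle_eq (hk : (2 : k) ≠ 0)
    {s' : CrossedSystem k (H4 k) (kC k 2)} :
    Cohomologous s s' ↔ s.genCocycle = s'.genCocycle := by
  rw [cohomologous_iff]
  constructor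
  · rintro ⟨v, hv, -, h⟩
    rw [h]
    -- In both cases v σ(v) = v² = 1, so u' = u.
    rcases H4.isGroupLikeElem_iff.1 hv with rfl | rfl
    · rw [map_one, one_mul, one_mul]
    · rw [genAct_g, H4.g_mul_g, one_mul]
  · intro h
    obtain ⟨α, hα, hu⟩ := s.exists_genAct_x hk
    obtain ⟨β, hβ, hu'⟩ := s'.exists_genAct_x hk
    have hαβ : α = β ∨ α = -β := by
      rw [← sq_eq_sq_iff_eq_or_eq_neg]
      -- Equal cocycle values put both systems in the same alternative, so α² and β² are both 1 or
      -- both -1.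
      have := H4.one_ne_g k
      rcases hu with ⟨hu, h2⟩ | ⟨hu, h2⟩ <;> rcases hu' with ⟨hu', h2'⟩ | ⟨hu', h2'⟩
      · rw [h2, h2']
      · exact absurd (hu.symm.trans (h.trans hu')) this
      · exact absurd (hu'.symm.trans (h.symm.trans hu)) this
      · rw [h2, h2']
    have key (v : H4 k) (hg : v * H4.g k = H4.g k * v)
        (hx : v * (α • H4.x k) = (β • H4.x k) * v) (a : H4 k) :
        s'.genAct a * v = v * s.genAct a := by
      refine (H4.intertwine (i := (s.genAct : H4 k →ₐ[k] H4 k))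
        (j := (s'.genAct : H4 k →ₐ[k] H4 k)) (D := v) ?_ ?_ a).symm
      · change v * s.genAct _ = s'.genAct _ * v
        rw [genAct_g, genAct_g, hg]
      · change v * s.genAct _ = s'.genAct _ * v
        rw [hα, hβ, hx]
    -- If α = β, then v = 1 serves. If α = -β, then v = g does, since it anticommutes with x and
    -- commutes with g.
    rcases hαβ with rfl | rfl
    · exact ⟨1, .one, key 1 (by rw [one_mul, mul_one]) (by rw [one_mul, mul_one]),
        by rw [map_one, one_mul, one_mul, h]⟩
    · refine ⟨H4.g k, H4.isGroupLikeElem_g k, key _ rfl ?_, ?_⟩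
      · rw [mul_smul_comm, smul_mul_assoc, H4.g_mul_x, smul_neg, neg_smul, neg_neg]
      · rw [genAct_g, H4.g_mul_g, one_mul, h]

/-- A crossed product with trivial cocycle is the tensor product, as an extension. -/
theorem isEquivTo_tensor (hk : (2 : k) ≠ 0) (hu : s.genCocycle = 1) :
    s.IsEquivTo (tensorIncl k (H4 k) (kC k 2)) (tensorProj k (H4 k) (kC k 2)) := by
  obtain ⟨α, hα, h⟩ := s.exists_genAct_x hk
  have hα2 : α = 1 ∨ α = -1 := by
    rcases h with ⟨-, h⟩ | ⟨h, -⟩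
    · exact sq_eq_sq_iff_eq_or_eq_neg.1 (h.trans (one_pow 2).symm)
    · exact absurd (hu.symm.trans h) (H4.one_ne_g k)
  -- Since α = ±1, σ is inner: it is conjugation by v = 1 or v = g. The action of 1 # c on A can
  -- thus be absorbed into the group-like element v.
  obtain ⟨v, hv, hvv, hvg, hvx⟩ : ∃ v : H4 k, IsGroupLikeElem k v ∧ v * v = 1 ∧
      v * H4.g k = H4.g k * v ∧ v * H4.x k = (α • H4.x k) * v := by
    rcases hα2 with rfl | rfl
    · exact ⟨1, .one, one_mul 1, by rw [one_mul, mul_one], by rw [one_mul, mul_one, one_smul]⟩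
    · exact ⟨H4.g k, H4.isGroupLikeElem_g k, H4.g_mul_g k, rfl,
        by rw [H4.g_mul_x, neg_smul, one_smul, neg_mul]⟩
  have hc := kC.isGroupLikeElem_gen k
  -- The factor c commutes with H_4, so D = v ⊗ c acts on H_4 through v, that is by σ, and D² = v² ⊗
  -- c² = 1 = u.
  refine s.isEquivTo_of_generator _ _ (v ⊗ₜ kC.gen k) (hv.tmul hc) ?_ ?_ (fun a => ?_) ?_ ?_ ?_
  · refine H4.intertwine (i := (tensorIncl k (H4 k) (kC k 2) : H4 k →ₐ[k] H4 k ⊗[k] kC k 2))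
      (j := (tensorIncl k (H4 k) (kC k 2) : H4 k →ₐ[k] H4 k ⊗[k] kC k 2).comp (s.genAct : H4 k →ₐ[k] H4 k)) ?_ ?_
    · change _ * tensorIncl k (H4 k) (kC k 2) _ = tensorIncl k (H4 k) (kC k 2) (s.genAct _) * _
      rw [genAct_g, tensorIncl_apply, Algebra.TensorProduct.tmul_mul_tmul,
        Algebra.TensorProduct.tmul_mul_tmul, hvg, one_mul, mul_one]
    · change _ * tensorIncl k (H4 k) (kC k 2) _ = tensorIncl k (H4 k) (kC k 2) (s.genAct _) * _
      rw [hα, tensorIncl_apply, tensorIncl_apply, Algebra.TensorProduct.tmul_mul_tmul,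
        Algebra.TensorProduct.tmul_mul_tmul, hvx, one_mul, mul_one]
  · rw [Algebra.TensorProduct.tmul_mul_tmul, hvv, kC.gen_mul_gen, hu, map_one]
    rfl
  · rw [tensorIncl_apply, tensorProj_tmul, Algebra.algebraMap_eq_smul_one]
  · rw [tensorProj_tmul, hv.counit_eq_one, one_smul]
  · refine (Module.finrank_tensorProduct (R := k) (S := k) (M := H4 k) (M' := kC k 2)).trans ?_
    rw [kC.finrank_eq]
  · intro y
    induction y with
    | zero => exact ⟨0, 0, by rw [map_zero, zero_mul, add_zero]⟩
    | add y z hy hz =>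
      obtain ⟨a, b, rfl⟩ := hy
      obtain ⟨a', b', rfl⟩ := hz
      exact ⟨a + a', b + b', by rw [map_add, map_add, add_mul, add_add_add_comm]⟩
    | tmul a h =>
      obtain ⟨p, q, rfl⟩ := kC.eq_add h
      -- The factor v compensates the one in D: (a v ⊗ 1)(v ⊗ c) = a ⊗ c, because v² = 1.
      refine ⟨p • a, q • (a * v), ?_⟩
      rw [tensorIncl_apply, tensorIncl_apply, Algebra.TensorProduct.tmul_mul_tmul, smul_mul_assoc,
        mul_assoc, hvv, mul_one, one_mul, TensorProduct.tmul_add, TensorProduct.smul_tmul,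
        TensorProduct.smul_tmul]

end CrossedSystem

/-! ### The Hopf algebra H_{8,ζ} as an extension -/

namespace H8

variable (ζ : k) (hζ : ζ ^ 2 = -1)

lemma finrank_eq : Module.finrank k (H8 ζ hζ) = 8 := by
  obtain ⟨b, -⟩ := exists_basis ζ hζ
  rw [Module.finrank_eq_card_basis b, Fintype.card_fin]

lemma isGroupLikeElem_d : IsGroupLikeElem k (d ζ hζ) := ⟨counit_d ζ hζ, comul_d ζ hζ⟩

lemma isGroupLikeElem_g : IsGroupLikeElem k (g ζ hζ) := ⟨counit_g ζ hζ, comul_g ζ hζ⟩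

/-- The standard basis of H_{8,ζ} consists of the four basis elements of H_4 and their products with
d. This supplies the surjectivity required by `isEquivTo_of_generator`. -/
lemma exists_eq (y : H8 ζ hζ) : ∃ a b : H4 k, incl ζ hζ a + incl ζ hζ b * d ζ hζ = y := by
  let L : H4 k × H4 k →ₗ[k] H8 ζ hζ := LinearMap.coprod (incl ζ hζ : H4 k →ₗ[k] H8 ζ hζ)
    (LinearMap.mulRight k (d ζ hζ) ∘ₗ (incl ζ hζ : H4 k →ₗ[k] H8 ζ hζ))
  have hL (a b) : L (a, b) = incl ζ hζ a + incl ζ hζ b * d ζ hζ := rfl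
  suffices h : LinearMap.range L = ⊤ by
    obtain ⟨⟨a, b⟩, hab⟩ := LinearMap.range_eq_top.1 h y
    exact ⟨a, b, hab⟩
  obtain ⟨b, hb⟩ := exists_basis ζ hζ
  rw [eq_top_iff, ← b.span_eq, Submodule.span_le]
  rintro _ ⟨i, rfl⟩
  rw [hb]
  fin_cases i
  · exact ⟨(1, 0), by rw [hL]; simp⟩
  · exact ⟨(H4.g k, 0), by rw [hL]; simp [incl_g]⟩
  · exact ⟨(H4.x k, 0), by rw [hL]; simp [incl_x]⟩
  · exact ⟨(H4.g k * H4.x k, 0), by rw [hL]; simp [incl_g, incl_x]⟩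
  · exact ⟨(0, 1), by rw [hL]; simp⟩
  · exact ⟨(0, H4.g k), by rw [hL]; simp [incl_g]⟩
  · exact ⟨(0, H4.x k), by rw [hL]; simp [incl_x]⟩
  · exact ⟨(0, H4.g k * H4.x k), by rw [hL]; simp [incl_g, incl_x]⟩

lemma proj_g : proj ζ hζ (g ζ hζ) = 1 := by
  rw [← d_sq, map_pow, proj_d, ← map_pow, Cyc.gen_pow, map_one]

lemma proj_incl (a : H4 k) : proj ζ hζ (incl ζ hζ a) = algebraMap k (kC k 2) (counit a) := by
  have : (proj ζ hζ : H8 ζ hζ →ₗ[k] kC k 2) ∘ₗ (incl ζ hζ : H4 k →ₗ[k] H8 ζ hζ) =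
      Algebra.linearMap k (kC k 2) ∘ₗ counit := by
    refine H4.lhom_ext ?_ ?_ ?_ ?_
    · change proj ζ hζ (incl ζ hζ 1) = algebraMap k _ (counit 1)
      rw [map_one, map_one, Bialgebra.counit_one, map_one]
    · change proj ζ hζ (incl ζ hζ (H4.g k)) = algebraMap k _ (counit (H4.g k))
      rw [incl_g, proj_g, H4.counit_g, map_one]
    · simp [incl_x, proj_x, H4.counit_x]
    · simp [incl_x, proj_x, H4.counit_x]
  exact congr($this a)

/-- Since d² = g, this says that d is a group-like element whose square is not 1, which
distinguishes H_{8,ζ} from H_4 ⊗ k[C_2]. -/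
lemma g_ne_one : g ζ hζ ≠ 1 := by
  obtain ⟨b, hb⟩ := exists_basis ζ hζ
  have h0 : b 0 = 1 := by rw [hb]; rfl
  have h1 : b 1 = g ζ hζ := by rw [hb]; rfl
  rw [← h0, ← h1]
  exact b.injective.ne (by decide)

end H8

/-! ### Nontrivial cocycle: equivalence with H_{8,ζ} -/

namespace CrossedSystem

variable (s : CrossedSystem k (H4 k) (kC k 2))

/-- A crossed product with nontrivial cocycle is `H8`, as an extension. -/
theorem isEquivTo_H8 (hk : (2 : k) ≠ 0) (ζ : k) (hζ : ζ ^ 2 = -1) (hu : s.genCocycle = H4.g k) :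
    s.IsEquivTo (H8.incl ζ hζ) (H8.proj ζ hζ) := by
  obtain ⟨α, hα, h⟩ := s.exists_genAct_x hk
  -- The square of α is -1, so the action matches conjugation by d up to a sign.
  have hα2 : α = ζ ∨ α = -ζ := by
    rcases h with ⟨h, -⟩ | ⟨-, h⟩
    · exact absurd (h.symm.trans hu) (H4.one_ne_g k)
    · rw [← sq_eq_sq_iff_eq_or_eq_neg, h, hζ]
  have hgg : H8.g ζ hζ * H8.g ζ hζ = 1 := by rw [← sq, H8.g_sq]
  have hdd : H8.d ζ hζ * H8.d ζ hζ = H8.g ζ hζ := by rw [← sq, H8.d_sq]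
  -- The element v, equal to 1 for α = ζ and to g for α = -ζ, corrects that sign. The last property
  -- is the one that gives (v d) x = ζ v x d = α x (v d).
  obtain ⟨v, hv, hvv, hvd, hpv, hvx⟩ : ∃ v : H4 k, IsGroupLikeElem k (H8.incl ζ hζ v) ∧
      v * v = 1 ∧ H8.incl ζ hζ v * H8.d ζ hζ = H8.d ζ hζ * H8.incl ζ hζ v ∧
      H8.proj ζ hζ (H8.incl ζ hζ v) = 1 ∧
      ζ • (H8.incl ζ hζ v * H8.x ζ hζ) = α • (H8.x ζ hζ * H8.incl ζ hζ v) := by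
    rcases hα2 with rfl | rfl
    · exact ⟨1, by rw [map_one]; exact .one, one_mul 1, by rw [map_one, one_mul, mul_one],
        by rw [map_one, map_one], by rw [map_one, one_mul, mul_one]⟩
    · refine ⟨H4.g k, by rw [H8.incl_g]; exact H8.isGroupLikeElem_g ζ hζ, H4.g_mul_g k, ?_, ?_, ?_⟩
      · rw [H8.incl_g, H8.d_mul_g]
      · rw [H8.incl_g, H8.proj_g]
      · rw [H8.incl_g, H8.x_mul_g, smul_neg, neg_smul, neg_neg]
  have hvv' : H8.incl ζ hζ v * H8.incl ζ hζ v = 1 := by rw [← map_mul, hvv, map_one]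
  -- Since v commutes with d, it commutes with g = d².
  have hvg : H8.incl ζ hζ v * H8.g ζ hζ = H8.g ζ hζ * H8.incl ζ hζ v := by
    rw [← hdd, ← mul_assoc, hvd, mul_assoc, hvd, mul_assoc]
  refine s.isEquivTo_of_generator _ _ (H8.incl ζ hζ v * H8.d ζ hζ)
    (hv.mul (H8.isGroupLikeElem_d ζ hζ)) ?_ ?_ (H8.proj_incl ζ hζ) ?_ ?_ ?_
  · refine H4.intertwine (i := (H8.incl ζ hζ : H4 k →ₐ[k] H8 ζ hζ))
      (j := (H8.incl ζ hζ : H4 k →ₐ[k] H8 ζ hζ).comp (s.genAct : H4 k →ₐ[k] H4 k)) ?_ ?_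
    · change _ * H8.incl ζ hζ _ = H8.incl ζ hζ (s.genAct _) * _
      rw [genAct_g, H8.incl_g, mul_assoc, H8.d_mul_g, ← mul_assoc, hvg, mul_assoc]
    · change _ * H8.incl ζ hζ _ = H8.incl ζ hζ (s.genAct _) * _
      rw [hα, map_smul, H8.incl_x, mul_assoc, H8.d_mul_x, mul_smul_comm, ← mul_assoc,
        ← smul_mul_assoc, hvx, ← mul_assoc, smul_mul_assoc, smul_mul_assoc, smul_mul_assoc]
  -- Here (v d)² = v² d² = g, since v commutes with d and v² = 1.
  · rw [hu, H8.incl_g, mul_assoc, ← mul_assoc (H8.d ζ hζ), ← hvd, mul_assoc, hdd, ← mul_assoc,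
      hvv', one_mul]
  · rw [map_mul, hpv, one_mul, H8.proj_d]
    rfl
  · rw [H8.finrank_eq, H4.finrank_eq]
  · intro y
    obtain ⟨a, b, rfl⟩ := H8.exists_eq ζ hζ y
    -- Again v² = 1 gives (b v)(v d) = b d.
    refine ⟨a, b * v, ?_⟩
    rw [map_mul, mul_assoc, ← mul_assoc (H8.incl ζ hζ v), hvv', one_mul]

lemma IsEquivTo.isoClass_eq {k A H : Type u} [Field k] [Ring A] [Ring H] [HopfAlgebra k A]
    [HopfAlgebra k H] [IsCocomm k H] {s : CrossedSystem k A H} {E : Type u} [Ring E]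
    [HopfAlgebra k E] {i : A →ₐc[k] E} {π : E →ₐc[k] H} (h : s.IsEquivTo i π) :
    isoClass k s.Product = isoClass k E := by
  obtain ⟨ψ, -⟩ := h
  exact Quotient.sound ⟨ψ.toHopfAlgIso⟩

end CrossedSystem

/-- The Hopf algebras `H4 ⊗ k[C_2]` and `H8` are not isomorphic: all group-like elements of the
former square to `1`. -/
theorem isoClass_tensor_ne_H8 (ζ : k) (hζ : ζ ^ 2 = -1) :
    isoClass k (H4 k ⊗[k] kC k 2) ≠ isoClass k (H8 ζ hζ) := by
  intro h
  obtain ⟨e⟩ := Quotient.exact h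
  have φ : H4 k ⊗[k] kC k 2 ≃ₐc[k] H8 ζ hζ := e.toHopfAlgEquiv
  have hd := (H8.isGroupLikeElem_d ζ hζ).map φ.symm
  -- The preimage of d is a tensor of group-like elements of H_4 and k[C_2], each of which squares
  -- to 1. Hence the preimage of d² = g is 1, which contradicts g ≠ 1.
  obtain ⟨a, b, ha, hb, hab⟩ := hd.exists_tmul
  have ha2 : a * a = 1 := by
    rcases H4.isGroupLikeElem_iff.1 ha with rfl | rfl
    exacts [one_mul 1, H4.g_mul_g k]
  have hb2 : b * b = 1 := by
    rcases (kC.isGroupLikeElem_iff k).1 hb with rfl | rfl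
    exacts [one_mul 1, kC.gen_mul_gen k]
  have h1 : φ.symm (H8.g ζ hζ) = φ.symm 1 := by
    rw [← H8.d_sq, sq, map_mul, hab, Algebra.TensorProduct.tmul_mul_tmul, ha2, hb2, map_one]
    rfl
  exact H8.g_ne_one ζ hζ (φ.symm.injective h1)

/-! ### Existence of both cocycle values and the final count -/

namespace CrossedSystem

lemma exists_genCocycle_eq_one : ∃ s : CrossedSystem k (H4 k) (kC k 2), s.genCocycle = 1 :=
  ⟨ofGen (.id k (H4 k)) 1 .one rfl fun a => by rw [mul_one, one_mul]; rfl, genCocycle_ofGen ..⟩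

/-- The pair is σ(g) = g, σ(x) = ζ x and u = g. It is admissible because σ²(x) = -x is the effect on
x of conjugation by g. -/
lemma exists_genCocycle_eq_g (ζ : k) (hζ : ζ ^ 2 = -1) :
    ∃ s : CrossedSystem k (H4 k) (kC k 2), s.genCocycle = H4.g k := by
  refine ⟨ofGen (H4.scale ζ) (H4.g k) (H4.isGroupLikeElem_g k) (H4.scale_g ζ) fun a => ?_,
    genCocycle_ofGen ..⟩
  refine (H4.intertwine (i := .id k (H4 k)) (j := (H4.scale ζ : H4 k →ₐ[k] H4 k).comp
    (H4.scale ζ : H4 k →ₐ[k] H4 k)) (D := H4.g k) ?_ ?_ a).symm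
  · change H4.g k * H4.g k = H4.scale ζ (H4.scale ζ _) * _
    rw [H4.scale_g, H4.scale_g]
  · change H4.g k * H4.x k = H4.scale ζ (H4.scale ζ _) * _
    rw [H4.scale_x, map_smul, H4.scale_x, smul_smul, ← sq, hζ, neg_one_smul, neg_mul, H4.g_mul_x]

end CrossedSystem

lemma H2.mk_eq_mk_iff (hk : (2 : k) ≠ 0) {s s' : CrossedSystem k (H4 k) (kC k 2)} :
    H2.mk s = H2.mk s' ↔ s.genCocycle = s'.genCocycle :=
  Quotient.eq.trans (CrossedSystem.cohomologous_iff_genCocycle_eq hk)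

/-- If f(c, c) = g, the scalar α by which c acts on x is itself a square root of -1. -/
lemma CrossedSystem.genCocycle_cases (hk : (2 : k) ≠ 0) (s : CrossedSystem k (H4 k) (kC k 2)) :
    s.genCocycle = 1 ∨ s.genCocycle = H4.g k ∧ ∃ ζ : k, ζ ^ 2 = -1 := by
  obtain ⟨α, -, ⟨h, -⟩ | ⟨h, h2⟩⟩ := s.exists_genAct_x hk
  exacts [.inl h, .inr ⟨h, α, h2⟩]

end Classification

end

/-- The classification of the crossed products of Sweedler's Hopf algebra with `k[C_2]`. -/
theorem mainTheorem6 (k : Type u) [Field k] (hk : (2 : k) ≠ 0) :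
    -- the canonical surjection from `ℋ²` to `Crp` is injective
    (∀ s s' : CrossedSystem k (H4 k) (kC k 2),
      H2.mk s = H2.mk s' ↔ isoClass k s.Product = isoClass k s'.Product) ∧
    -- the case in which `-1` is not a square
    (¬ IsSquare (-1 : k) →
      ∃ s₀ : CrossedSystem k (H4 k) (kC k 2),
        s₀.IsEquivTo (tensorIncl k (H4 k) (kC k 2)) (tensorProj k (H4 k) (kC k 2)) ∧
        (Set.univ : Set (H2 k (kC k 2) (H4 k))) = {H2.mk s₀} ∧
        Crp k (kC k 2) (H4 k) = {isoClass k (H4 k ⊗[k] kC k 2)}) ∧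
    -- the case in which `-1 = ζ²`
    (∀ (ζ : k) (hζ : ζ ^ 2 = -1),
      ∃ s₀ s₁ : CrossedSystem k (H4 k) (kC k 2),
        s₀.IsEquivTo (tensorIncl k (H4 k) (kC k 2)) (tensorProj k (H4 k) (kC k 2)) ∧
        s₁.IsEquivTo (H8.incl ζ hζ) (H8.proj ζ hζ) ∧
        H2.mk s₀ ≠ H2.mk s₁ ∧
        (Set.univ : Set (H2 k (kC k 2) (H4 k))) = {H2.mk s₀, H2.mk s₁} ∧
        isoClass k (H4 k ⊗[k] kC k 2) ≠ isoClass k (H8 ζ hζ) ∧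
        Crp k (kC k 2) (H4 k) = {isoClass k (H4 k ⊗[k] kC k 2), isoClass k (H8 ζ hζ)}) := by
  have H1 (s : CrossedSystem k (H4 k) (kC k 2)) (hs : s.genCocycle = 1) :
      isoClass k s.Product = isoClass k (H4 k ⊗[k] kC k 2) :=
    (s.isEquivTo_tensor hk hs).isoClass_eq
  have H2' (ζ : k) (hζ : ζ ^ 2 = -1) (s : CrossedSystem k (H4 k) (kC k 2))
      (hs : s.genCocycle = H4.g k) : isoClass k s.Product = isoClass k (H8 ζ hζ) :=
    (s.isEquivTo_H8 hk ζ hζ hs).isoClass_eq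
  obtain ⟨s₀, h₀⟩ := CrossedSystem.exists_genCocycle_eq_one (k := k)
  refine ⟨fun s s' => ?_, fun hsq => ⟨s₀, s₀.isEquivTo_tensor hk h₀, ?_, ?_⟩, fun ζ hζ => ?_⟩
  -- Both sides of the equivalence depend only on the two cocycle values: they hold when the values
  -- agree and fail when one is 1 and the other is g.
  · rw [H2.mk_eq_mk_iff hk]
    rcases s.genCocycle_cases hk with h | ⟨h, ζ, hζ⟩ <;>
      rcases s'.genCocycle_cases hk with h' | ⟨h', ζ', hζ'⟩
    · rw [h, h', H1 s h, H1 s' h']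
      exact iff_of_true rfl rfl
    · rw [h, h', H1 s h, H2' ζ' hζ' s' h']
      exact iff_of_false (H4.one_ne_g k) (isoClass_tensor_ne_H8 ζ' hζ')
    · rw [h, h', H1 s' h', H2' ζ hζ s h]
      exact iff_of_false (H4.one_ne_g k).symm (isoClass_tensor_ne_H8 ζ hζ).symm
    -- The roots ζ and ζ' supplied by the two systems may differ, but `H2'` identifies either
    -- crossed product with H_{8,ζ} for any chosen root, so the same ζ is used for both.
    · rw [h, h', H2' ζ hζ s h, H2' ζ hζ s' h']
      exact iff_of_true rfl rfl
  · refine (Set.eq_univ_of_forall fun c => ?_).symm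
    induction c using Quotient.inductionOn with | _ s
    rcases s.genCocycle_cases hk with h | ⟨-, ζ, hζ⟩
    · exact (H2.mk_eq_mk_iff hk).2 (h.trans h₀.symm)
    -- The value g would make -1 a square.
    · exact absurd ⟨ζ, by rw [← hζ, sq]⟩ hsq
  · refine Set.eq_singleton_iff_unique_mem.2 ⟨⟨s₀, H1 s₀ h₀⟩, ?_⟩
    rintro _ ⟨s, rfl⟩
    rcases s.genCocycle_cases hk with h | ⟨-, ζ, hζ⟩
    · exact H1 s h
    · exact absurd ⟨ζ, by rw [← hζ, sq]⟩ hsq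
  · obtain ⟨s₁, h₁⟩ := CrossedSystem.exists_genCocycle_eq_g ζ hζ
    refine ⟨s₀, s₁, s₀.isEquivTo_tensor hk h₀, s₁.isEquivTo_H8 hk ζ hζ h₁, ?_, ?_,
      isoClass_tensor_ne_H8 ζ hζ, ?_⟩
    · rw [Ne, H2.mk_eq_mk_iff hk, h₀, h₁]
      exact H4.one_ne_g k
    · refine (Set.eq_univ_of_forall fun c => ?_).symm
      induction c using Quotient.inductionOn with | _ s
      rcases s.genCocycle_cases hk with h | ⟨h, -⟩
      · exact .inl ((H2.mk_eq_mk_iff hk).2 (h.trans h₀.symm))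
      · exact .inr ((H2.mk_eq_mk_iff hk).2 (h.trans h₁.symm))
    · refine Set.Subset.antisymm ?_ ?_
      · rintro _ ⟨s, rfl⟩
        rcases s.genCocycle_cases hk with h | ⟨h, -⟩
        · exact .inl (H1 s h)
        · exact .inr (H2' ζ hζ s h)
      · rintro _ (rfl | rfl)
        · exact ⟨s₀, H1 s₀ h₀⟩
        · exact ⟨s₁, H2' ζ hζ s₁ h₁⟩
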